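/- Let $(W,S)$ be a Coxeter system with $S$ finite and Coxeter matrix $(m_{rs})$, which is even (for $r\ne s$, $m_{rs}$ is even or $\infty$). For $T\subseteq S$ let $W_T=\langle T\rangle$; $T$ is spherical if $W_T$ is finite. The nerve $L$ of $(W,S)$ is the simplicial complex of nonempty spherical subsets of $S$. Assume that $L$ is a flag complex whose geometric realization is homeomorphic to $\mathbb S^3$. The Davis complex $\Sigma=\Sigma(W,S)$ is the simplicial complex of finite nonempty chains of spherical cosets $wW_T$ ($w\in W$, $T$ spherical), ordered by inclusion; for a spherical coset $wW_T$ the subcomplex of chains of cosets contained in $wW_T$ is the closed cell of type $T$ corresponding to $wW_T$, and $w\in W$ is identified with the vertex $wW_\emptyset$. Let $K\subset\Sigma$ be the subcomplex of chains of cosets of the form $W_T$, $T$ spherical. Fix $t\in S$ and put $U=\{r\in S: m_{rt}<\infty\}$. Let $\Omega(S,t)$ be the union of the closed cells of type $T\ni t$, and $\partial\Omega(S,t)$ the union of the closed cells contained in $\Omega(S,t)$ of type $T\not\ni t$. Let $\Omega$ be the component of $\Omega(S,t)$ containing $e$ (the elements of $W$ that are vertices of $\Omega$ are those of $W_U$),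 $\partial\Omega=\Omega\cap\partial\Omega(S,t)$ and $K(U)=K\cap\Omega$. The boundary collar containing $v\in W_U$ is $\bigcup_w wK(U)$, where $w\in W$ runs over the vertices of the component of $\partial\Omega$ containing $v$. For $T\subseteq S$ let $g_T:W\to W_T$ be the homomorphism that fixes the generators in $T$ and sends the others to $e$. The color of $v\in W_U$ is $c(v)=(g_T(v)W_{T-t})_T\in A:=\prod_{T}W_T/W_{T-t}$, the product over the spherical $T\ni t$. For $a\in A$, $F_a$ is the union of the boundary collars containing vertices $v\in W_U$ with $c(v)=a$; $a$ (or $F_a$) is an even color if $a=c(v)$ for some $v\in W_U$ with $g_{\{t\}}(v)=e$. Let $\mathcal H_*$ denote reduced $\ell^2$-homology ($\ell^2$-cycles modulo the closure of the $\ell^2$-boundaries, for square-summable real simplicial chains). 1. Let $s\in S$ with $2<m_{st}<\infty$, and let $u\in W_{\{s,t\}}$ be $t$-even (both $s$ and $t$ occur in its reduced expressions, and every factorization of $u$ into generators contains at least two, and an even number of, $t$'s) with a reduced expression ending in $t$. Let $D_0$ and $D_2$ be the boundary collars containing $e$ and $u$, let $U_{st}=\{r\in S: m_{rs}=m_{rt}=2\}$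 and $W'=W_{U_{st}}$. Then $(W',U_{st})$ is a Coxeter system with the restricted Coxeter matrix, $D_0\cap D_2$ is isomorphic, as a simplicial complex, to the Davis complex $\Sigma(W',U_{st})$, the nerve of $(W',U_{st})$ is the link $L_{st}$ in $L$ of the edge $\{s,t\}$, and $D_0\cap D_2$ is infinite (has infinitely many simplices) and its geometric realization is a connected topological $2$-manifold without boundary. 2. If $F\ne F'$ are even colors, then $\mathcal H_2(F\cap F')=0$. 3. If $F_1,\dots,F_n,F_e$ are even colors with $F_e\ne F_j$ for all $j$, then $\mathcal H_2\bigl(F_e\cap\bigcup_{j=1}^nF_j\bigr)=0$. -/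

import Mathlib

noncomputable section

/-! ### Simplicial complexes -/

namespace PreAbstractSimplicialComplex

variable {V V' : Type*}

/-- The simplicial complex of nonempty finite chains of a poset. Its geometric realization is, by
definition, the geometric realization of the poset. -/
def orderComplex (P : Type*) [PartialOrder P] : PreAbstractSimplicialComplex P where
  faces := {σ | σ.Nonempty ∧ IsChain (· ≤ ·) (σ : Set P)}
  isRelLowerSet_faces := fun _ h =>
    ⟨h.1, fun _ hb hne => ⟨hne, h.2.mono (Finset.coe_subset.2 hb)⟩⟩

/-- The full subcomplex of `X` on the vertices lying in `A`. -/
def restrictTo (X : PreAbstractSimplicialComplex V) (A : Set V) :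
    PreAbstractSimplicialComplex V where
  faces := {σ | σ ∈ X.faces ∧ ∀ v ∈ σ, v ∈ A}
  isRelLowerSet_faces := fun _ h =>
    ⟨(X.isRelLowerSet_faces h.1).1, fun _ hb hne =>
      ⟨(X.isRelLowerSet_faces h.1).2 hb hne, fun v hv => h.2 v (hb hv)⟩⟩

/-- Two vertices are joined by an edge path in `X`. -/
def EdgeReachable (X : PreAbstractSimplicialComplex V) : V → V → Prop :=
  Relation.ReflTransGen fun x y => ∃ σ ∈ X.faces, x ∈ σ ∧ y ∈ σ

/-- The (path) component of `X` containing the vertex `x`. -/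
def component (X : PreAbstractSimplicialComplex V) (x : V) : PreAbstractSimplicialComplex V :=
  X.restrictTo {y | X.EdgeReachable x y}

open Classical in
/-- The link of the simplex `σ` in `X`. -/
def link (X : PreAbstractSimplicialComplex V) (σ : Finset V) : PreAbstractSimplicialComplex V where
  faces := {τ | τ.Nonempty ∧ Disjoint τ σ ∧ τ ∪ σ ∈ X.faces}
  isRelLowerSet_faces := fun _ h =>
    ⟨h.1, fun _ hb hne => ⟨hne, h.2.1.mono_left hb,
      (X.isRelLowerSet_faces h.2.2).2 (Finset.union_subset_union_left hb)
        (hne.mono Finset.subset_union_left)⟩⟩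

open Classical in
/-- A complex is flag if every nonempty finite set of pairwise adjacent vertices spans a simplex. -/
def IsFlag (X : PreAbstractSimplicialComplex V) : Prop :=
  ∀ σ : Finset V, σ.Nonempty → (∀ i ∈ σ, ∀ j ∈ σ, ({i, j} : Finset V) ∈ X.faces) → σ ∈ X.faces

/-- The vertices (`0`-simplices) of `X`. -/
def Vertex (X : PreAbstractSimplicialComplex V) : Type _ := {v : V // {v} ∈ X.faces}

/-- A simplicial isomorphism: a bijection of vertices that preserves and reflects simplices. -/
structure Iso (X : PreAbstractSimplicialComplex V) (Y : PreAbstractSimplicialComplex V') where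
  /-- the bijection of vertices -/
  toEquiv : X.Vertex ≃ Y.Vertex
  map_faces : ∀ σ : Finset X.Vertex,
    σ.map ⟨Subtype.val, Subtype.val_injective⟩ ∈ X.faces ↔
      (σ.map toEquiv.toEmbedding).map ⟨Subtype.val, Subtype.val_injective⟩ ∈ Y.faces

/-- The geometric realization of `X`: barycentric coordinates supported on a simplex of `X`. -/
def Realization (X : PreAbstractSimplicialComplex V) : Type _ :=
  {x : V →₀ ℝ // (∀ v, 0 ≤ x v) ∧ (x.sum fun _ r => r) = 1 ∧ x.support ∈ X.faces}

/-- The closed geometric simplex of the realization spanned by `σ`. -/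
def GeomSimplex (X : PreAbstractSimplicialComplex V) (σ : Finset V) : Type _ :=
  {x : X.Realization // x.1.support ⊆ σ}

/-- The Euclidean topology of a closed simplex, given by the barycentric coordinates. -/
instance (X : PreAbstractSimplicialComplex V) (σ : Finset V) : TopologicalSpace (X.GeomSimplex σ) :=
  TopologicalSpace.induced (fun x : X.GeomSimplex σ => (x.1.1 : V → ℝ)) inferInstance

/-- The weak topology: a set is open if and only if its intersection with every closed simplex is
relatively open. -/
instance (X : PreAbstractSimplicialComplex V) : TopologicalSpace X.Realization :=
  ⨆ σ : X.faces,
    TopologicalSpace.coinduced (fun x : X.GeomSimplex (σ : Finset V) => x.1) inferInstance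

/-! ### Reduced `ℓ²`-homology

Simplices of a subcomplex of the order complex of a poset are chains, and are oriented by the order
of the poset. -/

variable {P : Type*} [PartialOrder P]

/-- The `k`-simplices of `X`. -/
def Simplex (X : PreAbstractSimplicialComplex P) (k : ℕ) : Type _ :=
  {σ : Finset P // σ ∈ X.faces ∧ σ.card = k + 1}

open Classical in
/-- The coefficient of `τ` in the boundary `∑ᵢ (-1)ⁱ [x₀, …, x̂ᵢ, …, xₖ]` of the chain
`σ = {x₀ < ⋯ < xₖ}`. -/
def incidence (σ τ : Finset P) : ℝ :=
  ∑ v ∈ σ, if σ.erase v = τ then (-1 : ℝ) ^ (σ.filter (· < v)).card else 0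

/-- The Hilbert space of square-summable real simplicial `k`-chains. -/
abbrev L2Chain (X : PreAbstractSimplicialComplex P) (k : ℕ) : Type _ :=
  lp (fun _ : X.Simplex k => ℝ) 2

/-- The `ℓ²`-cycles: the square-summable chains `f` with `∂ f = 0`. -/
def l2Cycles (X : PreAbstractSimplicialComplex P) (k : ℕ) : Submodule ℝ (X.L2Chain k) where
  carrier := {f | ∀ τ ∈ X.faces, HasSum (fun σ : X.Simplex k => incidence σ.1 τ * f σ) 0}
  zero_mem' := fun τ _ => by simp
  add_mem' := fun {f g} hf hg τ hτ => by
    simpa [mul_add] using (hf τ hτ).add (hg τ hτ)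
  smul_mem' := fun c f hf τ hτ => by
    simpa [mul_left_comm] using (hf τ hτ).mul_left c

/-- The `ℓ²`-boundaries: the square-summable chains `f` of the form `∂ g` with `g`
square-summable. -/
def l2Boundaries (X : PreAbstractSimplicialComplex P) (k : ℕ) : Submodule ℝ (X.L2Chain k) where
  carrier := {f | ∃ g : X.L2Chain (k + 1), ∀ τ : X.Simplex k,
    HasSum (fun σ : X.Simplex (k + 1) => incidence σ.1 τ.1 * g σ) (f τ)}
  zero_mem' := ⟨0, fun τ => by simp⟩
  add_mem' := by
    rintro f f' ⟨g, hg⟩ ⟨g', hg'⟩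
    exact ⟨g + g', fun τ => by simpa [mul_add] using (hg τ).add (hg' τ)⟩
  smul_mem' := by
    rintro c f ⟨g, hg⟩
    exact ⟨c • g, fun τ => by simpa [mul_left_comm] using (hg τ).mul_left c⟩

/-- Reduced `ℓ²`-homology: `ℓ²`-cycles modulo the closure of the `ℓ²`-boundaries. -/
abbrev ReducedL2Homology (X : PreAbstractSimplicialComplex P) (k : ℕ) : Type _ :=
  X.l2Cycles k ⧸ (X.l2Boundaries k).topologicalClosure.submoduleOf (X.l2Cycles k)

end PreAbstractSimplicialComplex

/-- `X` is a topological `n`-manifold (without boundary). -/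
def IsTopManifold (n : ℕ) (X : Type*) [TopologicalSpace X] : Prop :=
  T2Space X ∧ SecondCountableTopology X ∧ Nonempty (ChartedSpace (EuclideanSpace ℝ (Fin n)) X)

/-! ### Coxeter systems

In a `CoxeterMatrix` the entry `0` stands for `∞`. -/

namespace CoxeterMatrix

variable {B : Type*} (M : CoxeterMatrix B)

/-- Every off-diagonal entry is even or infinite (encoded as `0`, which is even). -/
def IsEven : Prop := ∀ i j, i ≠ j → Even (M i j)

/-- The Coxeter matrix restricted to a subset of the generators. -/
def restrict (U : Set B) : CoxeterMatrix U where
  M := fun i j => M i j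
  isSymm := by ext i j; exact M.symmetric j i
  diagonal := fun i => M.diagonal i
  off_diagonal := fun i j h => M.off_diagonal i j fun h' => h (Subtype.ext h')

/-- `U = {r | m_{rt} < ∞}`. -/
def finiteNeighbors (t : B) : Set B := {r | M r t ≠ 0}

/-- `U_{st} = {r | m_{rt} = m_{rs} = 2}`. -/
def commonCommuting (s t : B) : Set B := {r | M r t = 2 ∧ M r s = 2}

end CoxeterMatrix

namespace CoxeterSystem

open PreAbstractSimplicialComplex
open scoped Pointwise

variable {B W : Type*} [Group W] {M : CoxeterMatrix B} (cs : CoxeterSystem M W)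

/-- The subgroup `W_T` generated by `T`. -/
def parabolic (T : Set B) : Subgroup W := Subgroup.closure (cs.simple '' T)

/-- `T` is spherical if `W_T` is finite. -/
def IsSpherical (T : Set B) : Prop := Finite (cs.parabolic T)

theorem IsSpherical.mono {cs : CoxeterSystem M W} {T T' : Set B} (h : T ⊆ T')
    (hT : cs.IsSpherical T') : cs.IsSpherical T :=
  Set.Finite.subset (s := (cs.parabolic T' : Set W)) hT
    (Subgroup.closure_mono (Set.image_mono h))

/-- The nerve `L`. -/
def nerve : PreAbstractSimplicialComplex B where
  faces := {T | T.Nonempty ∧ cs.IsSpherical (T : Set B)}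
  isRelLowerSet_faces := fun _ h =>
    ⟨h.1, fun _ hb hne => ⟨hne, h.2.mono (Finset.coe_subset.2 hb)⟩⟩

/-- `C` is the coset `w W_T` for some `w`. -/
def IsCosetOfType (C : Set W) (T : Set B) : Prop :=
  ∃ w : W, C = w • (cs.parabolic T : Set W)

/-- The poset `W𝒮` of spherical cosets, ordered by inclusion. Its elements are also the cells of
the cellulation of the Davis complex by Coxeter cells. -/
abbrev SphericalCoset : Type _ :=
  {C : Set W // ∃ T : Set B, cs.IsSpherical T ∧ cs.IsCosetOfType C T}

/-- The Davis complex `Σ(W, S)`. -/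
def davisComplex : PreAbstractSimplicialComplex cs.SphericalCoset :=
  orderComplex cs.SphericalCoset

/-- The spherical coset `w W_T`. -/
def coset (w : W) (T : Set B) (hT : cs.IsSpherical T) : cs.SphericalCoset :=
  ⟨w • (cs.parabolic T : Set W), T, hT, w, rfl⟩

theorem isSpherical_empty : cs.IsSpherical ∅ := by
  unfold IsSpherical parabolic
  rw [Set.image_empty, Subgroup.closure_empty]
  infer_instance

/-- The vertex of the Coxeter cellulation corresponding to `w`, the coset `w W_∅ = {w}`. -/
def vertex (w : W) : cs.SphericalCoset := cs.coset w ∅ cs.isSpherical_empty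

/-- The left action of `w` on spherical cosets. -/
def translate (w : W) (C : cs.SphericalCoset) : cs.SphericalCoset :=
  ⟨w • C.1, by
    obtain ⟨C, T, hT, v, rfl⟩ := C
    exact ⟨T, hT, w * v, smul_smul w v _⟩⟩

/-- The fundamental chamber `K`, the realization of the poset of the `W_T`, `T` spherical. -/
def chamber : PreAbstractSimplicialComplex cs.SphericalCoset :=
  cs.davisComplex.restrictTo {C | ∃ (T : Set B) (hT : cs.IsSpherical T), C = cs.coset 1 T hT}

/-- The closed Coxeter cell corresponding to the spherical coset `C`. -/
def closedCell (C : cs.SphericalCoset) : PreAbstractSimplicialComplex cs.SphericalCoset :=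
  cs.davisComplex.restrictTo {C' | C' ≤ C}

/-- `Ω(S, t)`: the union of the closed cells of type `T ∋ t`. -/
def ruin (t : B) : PreAbstractSimplicialComplex cs.SphericalCoset :=
  ⨆ C ∈ {C : cs.SphericalCoset | ∃ T, cs.IsSpherical T ∧ t ∈ T ∧ cs.IsCosetOfType C.1 T},
    cs.closedCell C

/-- `∂Ω(S, t)`: the cells of `Ω(S, t)` of type `T ∌ t`. -/
def ruinBoundary (t : B) : PreAbstractSimplicialComplex cs.SphericalCoset :=
  ⨆ C ∈ {C : cs.SphericalCoset | cs.closedCell C ≤ cs.ruin t ∧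
      ∃ T, cs.IsSpherical T ∧ t ∉ T ∧ cs.IsCosetOfType C.1 T},
    cs.closedCell C

/-- `Ω`: the component of `Ω(S, t)` containing the vertex `e`. -/
def Omega (t : B) : PreAbstractSimplicialComplex cs.SphericalCoset :=
  (cs.ruin t).component (cs.vertex 1)

/-- `∂Ω = Ω ∩ ∂Ω(S, t)`. -/
def OmegaBoundary (t : B) : PreAbstractSimplicialComplex cs.SphericalCoset :=
  cs.Omega t ⊓ cs.ruinBoundary t

/-- `K(U) = K ∩ Ω`. -/
def chamberU (t : B) : PreAbstractSimplicialComplex cs.SphericalCoset :=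
  cs.chamber ⊓ cs.Omega t

open Classical in
/-- The boundary collar containing the vertex `v`: the union of the translates `w K(U)`, where `w`
runs over the vertices of the component of `∂Ω` that contains `v`. -/
def collar (t : B) (v : W) : PreAbstractSimplicialComplex cs.SphericalCoset :=
  ⨆ w ∈ {w : W | {cs.vertex w} ∈ ((cs.OmegaBoundary t).component (cs.vertex v)).faces},
    (cs.chamberU t).map (cs.translate w)

/-! ### Colors -/

open Classical in
/-- The homomorphism `g_T : W → W_T` of an even Coxeter system which is the identity on the
generators in `T` and kills the other generators. -/
def retraction (hM : M.IsEven) (T : Set B) : W →* cs.parabolic T :=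
  cs.lift ⟨fun i => if h : i ∈ T then
      ⟨cs.simple i, Subgroup.subset_closure (Set.mem_image_of_mem _ h)⟩ else 1, by
    intro i j
    by_cases hi : i ∈ T <;> by_cases hj : j ∈ T
    · apply Subtype.ext
      simp [hi, hj]
    · obtain ⟨k, hk⟩ := hM i j fun h => hj (h ▸ hi)
      apply Subtype.ext
      simp [hi, hj, hk, ← two_mul, pow_mul]
    · obtain ⟨k, hk⟩ := hM i j fun h => hi (h ▸ hj)
      apply Subtype.ext
      simp [hi, hj, hk, ← two_mul, pow_mul]
    · simp [hi, hj]⟩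

/-- The set of colors `A = ∏_{T ∋ t spherical} W_T / W_{T - t}`. -/
abbrev Color (t : B) : Type _ :=
  ∀ T : {T : Set B // cs.IsSpherical T ∧ t ∈ T},
    cs.parabolic T.1 ⧸ (cs.parabolic (T.1 \ {t})).subgroupOf (cs.parabolic T.1)

/-- The color `c(w) = w · ē = (g_T(w) W_{T - t})_T`. -/
def color (hM : M.IsEven) (t : B) (w : W) : cs.Color t :=
  fun T => (cs.retraction hM T.1 w : cs.parabolic T.1 ⧸ _)

/-- `F_a`: the union of the boundary collars in `Ω` whose vertices have color `a`. -/
def colorComplex (hM : M.IsEven) (t : B) (a : cs.Color t) :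
    PreAbstractSimplicialComplex cs.SphericalCoset :=
  ⨆ v ∈ {v : W | {cs.vertex v} ∈ (cs.OmegaBoundary t).faces ∧ cs.color hM t v = a}, cs.collar t v

/-- `a` is an even color: it is the color of a vertex `v ∈ W_U` with an even number of `t`'s. -/
def IsEvenColor (hM : M.IsEven) (t : B) (a : cs.Color t) : Prop :=
  ∃ v ∈ cs.parabolic (M.finiteNeighbors t), cs.retraction hM {t} v = 1 ∧ cs.color hM t v = a

open Classical in
/-- `w` is `t`-even (with respect to `s`): `s` and `t` occur in reduced expressions of `w`, and
every factorization of `w` into generators contains at least two, and an even number of, `t`'s. -/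
def IsTEven (s t : B) (w : W) : Prop :=
  (∀ ω : List B, cs.IsReduced ω → cs.wordProd ω = w → s ∈ ω ∧ t ∈ ω) ∧
    ∀ ω : List B, cs.wordProd ω = w → 2 ≤ ω.count t ∧ Even (ω.count t)

/-- `w` has a reduced expression ending in `t`. -/
def HasReducedExprEndingIn (w : W) (t : B) : Prop :=
  ∃ ω : List B, cs.IsReduced (ω ++ [t]) ∧ cs.wordProd (ω ++ [t]) = w

end CoxeterSystem

end

/-! Everything reduces to Davis complexes of the groups W' generated by the sets U_st. In the
complexes at hand a simplex is a chain of cosets wW_T with T contained in U, and all its members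
contain the representative of the smallest one. Lying in a collar or in a color is therefore a
condition on the elements of a coset.

Suppose a coset of type T meets two different even colors. If t were not in T, the two colors would
agree. If t commuted with the rest of T, equality of the numbers of t's mod 2 would again make them
agree. So T contains t and some s with m_st > 2 (`exists_two_lt_of_color_ne`). In a spherical subset
of an even system no generator fails to commute with two others, since the rank three form would
then not be positive definite (`eq_two_or_eq_two_of_isSpherical`). Hence T is {s,t} together with a
subset R of U_st, and s does not change between comparable cosets. The map sending xW'_R to the
coset of wx of type {s,t} ∪ R identifies Σ(W', U_st) with a union of components of the intersection
(`exists_isComponentEmbedding`).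

The nerve of W' is the link of the edge {s,t} in L. Invariance of domain (`isOpen_image_of_injOn`)
shows that in a triangulated 3-manifold triangles lie in exactly two tetrahedra and tetrahedra are
maximal; flagness excludes 3-cycles, so the link is a cycle of length at least 4
(`exists_cycle_link`). A Coxeter system whose nerve is a cycle has a surface as Davis complex
(`HasCycleNerve.isClosedSurface`), and W' is infinite because it has at least four generators while
spherical subsets have at most two.

On a surface the two triangles at an edge carry coefficients of equal absolute value in any 2-cycle,
so this value is constant on components. If the components are infinite, a square-summable cycle
vanishes (`IsClosedSurface.eq_zero_of_mem_l2Cycles`), which gives the two homology statements.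

For two collars one must show further that the intersection is a single copy of Σ(W', U_st).
Retractions onto parabolic subgroups produce an element that commutes with a nontrivial product in
W_{s,t} having an even number of t's. The splitting of W_U over the subgroup generated by U_st and t
confines that element to W_{s,t} × W' (`mem_parabolic_of_commute`). -/

/-! ### Invariance of domain -/

namespace InvarianceOfDomain

open MeasureTheory Metric Set Polynomial
open scoped NNReal

/-- As a function of r, det(1 + rA) is a polynomial of degree at most n, so Lagrange interpolation
at more than n nodes recovers its value at 1. This later carries a volume identity from small
parameters to the parameter 1. -/
theorem sum_basis_mul_det_one_add_smul {n : ℕ} {ι : Type*} [DecidableEq ι] (s : Finset ι) (v : ι → ℝ)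
    (hv : Set.InjOn v s) (hs : n < s.card) (A : Matrix (Fin n) (Fin n) ℝ) :
    ∑ j ∈ s, (Lagrange.basis s v j).eval 1 * (1 + v j • A).det = (1 + A).det := by
  set q : ℝ[X] := ((X : ℝ[X]) • A.map C + (1 : Matrix (Fin n) (Fin n) ℝ).map C).det with hq
  have hdeg : q.degree < s.card := by
    refine lt_of_le_of_lt degree_le_natDegree ?_
    have := natDegree_det_X_add_C_le A 1
    rw [Fintype.card_fin] at this
    exact_mod_cast lt_of_le_of_lt this hs
  have hev : ∀ r : ℝ, q.eval r = (1 + r • A).det := by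
    intro r
    rw [hq, ← coe_evalRingHom, RingHom.map_det]
    congr 1
    ext i j
    rcases eq_or_ne i j with rfl | hij
    · simp only [RingHom.mapMatrix_apply, Matrix.map_apply, Matrix.add_apply, Matrix.smul_apply,
        Matrix.one_apply_eq, smul_eq_mul, coe_evalRingHom, eval_add, eval_mul, eval_X, eval_C]
      ring
    · simp only [RingHom.mapMatrix_apply, Matrix.map_apply, Matrix.add_apply, Matrix.smul_apply,
        Matrix.one_apply_ne hij, smul_eq_mul, coe_evalRingHom, eval_add, eval_mul, eval_X, eval_C]
      ring
  have h1 := congrArg (eval 1) (Lagrange.eq_interpolate hv hdeg)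
  rw [Lagrange.interpolate_apply, eval_finsetSum, hev, one_smul] at h1
  rw [h1]
  refine Finset.sum_congr rfl fun j _ => ?_
  rw [eval_mul, eval_C, hev, mul_comm]

/-! ### The no-retraction theorem by a volume computation. -/

variable {E : Type*} [NormedAddCommGroup E] [InnerProductSpace ℝ E] [FiniteDimensional ℝ E]

theorem sum_basis_mul_continuousLinearMap_det {ι : Type*} [DecidableEq ι] (s : Finset ι) (v : ι → ℝ)
    (hv : Set.InjOn v s) (hs : Module.finrank ℝ E < s.card) (A : E →L[ℝ] E) :
    ∑ j ∈ s, (Lagrange.basis s v j).eval 1 * (1 + v j • A).det = (1 + A).det := by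
  set b := Module.finBasis ℝ E
  have h := sum_basis_mul_det_one_add_smul s v hv hs (LinearMap.toMatrix b b A)
  have hdet : ∀ r : ℝ, (1 + r • A).det = (1 + r • LinearMap.toMatrix b b A).det := by
    intro r
    rw [ContinuousLinearMap.det, ← LinearMap.det_toMatrix b]
    congr 1
    simp [LinearMap.toMatrix_one]
  have h1 := hdet 1
  rw [one_smul, one_smul] at h1
  rw [h1, ← h]
  exact Finset.sum_congr rfl fun j _ => by rw [hdet]

/-- The identity is perturbed by a contraction, of constant tC < 1. -/
theorem bijective_add_smul {k : E → E} {C : ℝ≥0} (hk : LipschitzWith C k) {t : ℝ}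
    (ht : 0 < t) (htC : t * C < 1) : Function.Bijective fun x => x + t • k x := by
  have hlip : ∀ x y, ‖t • k x - t • k y‖ ≤ (t * C) * ‖x - y‖ := by
    intro x y
    rw [← smul_sub, norm_smul, Real.norm_of_nonneg ht.le, mul_assoc]
    exact mul_le_mul_of_nonneg_left (by simpa [dist_eq_norm] using hk.dist_le_mul x y) ht.le
  have happ : ApproximatesLinearOn (fun x => x + t • k x)
      ((ContinuousLinearEquiv.refl ℝ E : E ≃L[ℝ] E) : E →L[ℝ] E) univ
      ⟨t * C, mul_nonneg ht.le C.2⟩ := by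
    intro x _ y _
    have := hlip x y
    simp only [ContinuousLinearEquiv.coe_refl, ContinuousLinearMap.id_apply]
    rwa [add_sub_add_comm, add_sub_cancel_left]
  have hc : Subsingleton E ∨ (⟨t * C, mul_nonneg ht.le C.2⟩ : ℝ≥0) <
      ‖((ContinuousLinearEquiv.refl ℝ E).symm : E →L[ℝ] E)‖₊⁻¹ := by
    rcases subsingleton_or_nontrivial E with h | h
    · exact Or.inl h
    · right
      have : ‖((ContinuousLinearEquiv.refl ℝ E).symm : E →L[ℝ] E)‖₊ = 1 := by
        simp
      rw [this, inv_one]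
      exact htC
  refine ⟨fun x y hxy => ?_, happ.surjective hc⟩
  have := happ.injective hc (a₁ := ⟨x, mem_univ x⟩) (a₂ := ⟨y, mem_univ y⟩) hxy
  exact congrArg Subtype.val this

variable [MeasurableSpace E] [BorelSpace E]

/-- For small t the map x + t k(x) is a bijection fixing all points outside the ball, so it maps the
ball onto itself. Its Jacobian determinant is positive, and the change of variables formula gives
the volume. -/
theorem integral_det_add_smul_fderiv {k : E → E} {C : ℝ≥0} (hk : LipschitzWith C k)
    (hk0 : ∀ x, 1 ≤ ‖x‖ → k x = 0) (hd : ∀ x ∈ ball (0 : E) 1, DifferentiableAt ℝ k x) :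
    ∃ ε > 0, ∀ t : ℝ, 0 < t → t < ε →
      IntegrableOn (fun x => (1 + t • fderiv ℝ k x).det) (ball 0 1) ∧
      ∫ x in ball (0 : E) 1, (1 + t • fderiv ℝ k x).det = volume.real (ball (0 : E) 1) := by
  have hcont : ContinuousAt (fun A : E →L[ℝ] E => A.det) 1 :=
    ContinuousLinearMap.continuous_det.continuousAt
  have hpos : ∀ᶠ A in nhds (1 : E →L[ℝ] E), 0 < A.det := by
    refine hcont.eventually (lt_mem_nhds ?_)
    simp [ContinuousLinearMap.det]
  obtain ⟨δ, hδ, hball⟩ := Metric.eventually_nhds_iff.1 hpos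
  -- The bound by 1 makes t k a contraction; the bound by δ keeps the determinant positive, as the
  -- derivative of k has norm at most C.
  refine ⟨min δ 1 / (C + 1), by positivity, fun t ht htε => ?_⟩
  have hC : (0 : ℝ) < C + 1 := by positivity
  have htC : t * (C + 1) < min δ 1 := by rwa [lt_div_iff₀ hC] at htε
  have ht1 : t * C < 1 := by
    have := min_le_right δ 1
    nlinarith
  have htδ : t * C < δ := by
    have := min_le_left δ 1
    nlinarith
  have hbij := bijective_add_smul hk ht ht1
  have hder : ∀ x ∈ ball (0 : E) 1, HasFDerivWithinAt (fun x => x + t • k x)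
      ((1 : E →L[ℝ] E) + t • fderiv ℝ k x) (ball 0 1) x := fun x hx =>
    ((hasFDerivAt_id x).add ((hd x hx).hasFDerivAt.const_smul t)).hasFDerivWithinAt
  have hdet : ∀ x ∈ ball (0 : E) 1, 0 < (1 + t • fderiv ℝ k x).det := by
    intro x _
    apply hball
    rw [dist_eq_norm, add_sub_cancel_left, norm_smul, Real.norm_of_nonneg ht.le]
    refine lt_of_le_of_lt (mul_le_mul_of_nonneg_left ?_ ht.le) htδ
    exact norm_fderiv_le_of_lipschitz ℝ hk
  have himage : (fun x => x + t • k x) '' ball (0 : E) 1 = ball 0 1 := by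
    have hout : ∀ x, x ∉ ball (0 : E) 1 → x + t • k x = x := by
      intro x hx
      rw [hk0 x (by simpa using hx), smul_zero, add_zero]
    ext y
    constructor
    · rintro ⟨x, hx, rfl⟩
      by_contra hy
      -- An image point outside the ball is fixed, so by injectivity it is x itself, which lies
      -- inside.
      have := hbij.1 ((hout _ hy).trans rfl : (fun x => x + t • k x) (x + t • k x) = x + t • k x)
      exact hy (by rw [this]; exact hx)
    · intro hy
      obtain ⟨x, hx⟩ := hbij.2 y
      refine ⟨x, ?_, hx⟩
      by_contra hx'
      have := hout x hx'
      simp only at hx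
      rw [this] at hx
      exact hx' (hx ▸ hy)
  have hmeas : MeasurableSet (ball (0 : E) 1) := measurableSet_ball
  have hinj : InjOn (fun x => x + t • k x) (ball (0 : E) 1) := hbij.1.injOn
  constructor
  · have h := (integrableOn_image_iff_integrableOn_abs_det_fderiv_smul volume hmeas hder hinj
      (fun _ => (1 : ℝ))).1 (by rw [himage]; exact integrableOn_const measure_ball_lt_top.ne)
    refine h.congr_fun (fun x hx => ?_) hmeas
    simp [abs_of_pos (hdet x hx)]
  · have h := integral_image_eq_integral_abs_det_fderiv_smul volume hmeas hder hinj
      (fun _ => (1 : ℝ))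
    rw [himage] at h
    simp only [integral_const, smul_eq_mul, mul_one, measureReal_restrict_apply MeasurableSet.univ,
      univ_inter] at h
    rw [h]
    exact setIntegral_congr_fun hmeas fun x hx => by simp [abs_of_pos (hdet x hx)]

/-- The integral of det(1 + t Dk) is polynomial in t and equals the volume for all small t > 0. It
therefore equals the volume at t = 1 too, although the map need not be injective there. -/
theorem integral_det_one_add_fderiv {k : E → E} {C : ℝ≥0} (hk : LipschitzWith C k)
    (hk0 : ∀ x, 1 ≤ ‖x‖ → k x = 0) (hd : ∀ x ∈ ball (0 : E) 1, DifferentiableAt ℝ k x) :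
    ∫ x in ball (0 : E) 1, (1 + fderiv ℝ k x).det = volume.real (ball (0 : E) 1) := by
  obtain ⟨ε, hε, h⟩ := integral_det_add_smul_fderiv hk hk0 hd
  set s := Finset.range (Module.finrank ℝ E + 1)
  -- Distinct nodes in the open interval (0, ε); the shift by 2 keeps the node for j = 0 below ε.
  set v : ℕ → ℝ := fun j => ε / (j + 2)
  have hv0 : ∀ j, 0 < v j := fun j => by positivity
  have hv1 : ∀ j, v j < ε := fun j => by
    rw [div_lt_iff₀ (by positivity)]
    nlinarith [(Nat.cast_nonneg j : (0 : ℝ) ≤ j)]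
  have hv : Set.InjOn v s := by
    intro i _ j _ hij
    have : (i : ℝ) + 2 = j + 2 := by
      have := hij
      simp only [v] at this
      rw [div_eq_div_iff (by positivity) (by positivity)] at this
      exact (mul_left_cancel₀ hε.ne' this).symm
    exact_mod_cast add_right_cancel this
  have hs : Module.finrank ℝ E < s.card := by simp [s]
  have hint : ∀ x, (1 + fderiv ℝ k x).det =
      ∑ j ∈ s, (Lagrange.basis s v j).eval 1 * (1 + v j • fderiv ℝ k x).det := fun x =>
    (sum_basis_mul_continuousLinearMap_det s v hv hs _).symm
  simp_rw [hint]
  rw [integral_finsetSum]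
  · simp_rw [integral_const_mul, (h _ (hv0 _) (hv1 _)).2, ← Finset.sum_mul, ← eval_finsetSum]
    rw [Lagrange.sum_basis hv ⟨0, by simp [s]⟩, eval_one, one_mul]
  · exact fun j _ => (h _ (hv0 _) (hv1 _)).1.const_mul _

/-- This is the absence of a Lipschitz retraction of the ball onto its sphere. If x + k(x) were
always a unit vector, its derivative would have image orthogonal to it, hence zero determinant, and
the integral would be 0 instead of the volume. -/
theorem exists_norm_add_ne_one {k : E → E} {C : ℝ≥0} (hk : LipschitzWith C k)
    (hk0 : ∀ x, 1 ≤ ‖x‖ → k x = 0) (hd : ∀ x ∈ ball (0 : E) 1, DifferentiableAt ℝ k x) :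
    ∃ x ∈ ball (0 : E) 1, ‖x + k x‖ ≠ 1 := by
  by_contra! hcon
  have hdet : ∀ x ∈ ball (0 : E) 1, (1 + fderiv ℝ k x).det = 0 := by
    intro x hx
    by_contra hne
    have hr : HasFDerivAt (fun x => x + k x) (1 + fderiv ℝ k x) x :=
      (hasFDerivAt_id x).add (hd x hx).hasFDerivAt
    have hsq : HasFDerivAt (fun x => ‖x + k x‖ ^ 2)
        (2 • (innerSL ℝ (x + k x)).comp (1 + fderiv ℝ k x)) x := hr.norm_sq
    have hc : HasFDerivAt (fun x => ‖x + k x‖ ^ 2) (0 : E →L[ℝ] ℝ) x := by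
      refine (hasFDerivAt_const (1 : ℝ) x).congr_of_eventuallyEq ?_
      filter_upwards [isOpen_ball.mem_nhds hx] with y hy
      rw [hcon y hy, one_pow]
    have heq := hsq.unique hc
    -- An invertible derivative would take some w to x + k(x) itself, and the constant squared norm
    -- would have derivative 2 along w.
    have hsurj : Function.Surjective ((1 + fderiv ℝ k x : E →L[ℝ] E) : E →ₗ[ℝ] E) :=
      (LinearMap.equivOfDetNeZero _ hne).surjective
    obtain ⟨w, hw⟩ := hsurj (x + k x)
    have := DFunLike.congr_fun heq w
    simp only [smul_apply, ContinuousLinearMap.comp_apply,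
      zero_apply, innerSL_apply_apply] at this
    rw [ContinuousLinearMap.coe_coe] at hw
    rw [hw, real_inner_self_eq_norm_sq, hcon x hx] at this
    norm_num at this
  have h := integral_det_one_add_fderiv hk hk0 hd
  rw [setIntegral_congr_fun measurableSet_ball hdet, integral_zero] at h
  exact (ENNReal.toReal_pos (measure_ball_pos volume (0 : E) one_pos).ne'
    measure_ball_lt_top.ne).ne h

/-- A map H without zeros could be smoothed, deformed to the identity near the sphere and divided by
its norm, which gives the excluded retraction. -/
theorem exists_eq_zero_of_norm_sub_le [Nontrivial E] {H : E → E} (hH : ContinuousOn H (closedBall 0 1))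
    (hclose : ∀ x ∈ closedBall (0 : E) 1, ‖H x - x‖ ≤ 1 / 3) :
    ∃ x ∈ closedBall (0 : E) 1, H x = 0 := by
  by_contra! hne
  obtain ⟨G, hG⟩ := ContinuousMap.exists_restrict_eq (isClosed_closedBall (x := (0 : E)) (ε := 1))
    ⟨_, hH.domRestrict⟩
  have hGH : ∀ x ∈ closedBall (0 : E) 1, G x = H x := fun x hx =>
    DFunLike.congr_fun hG ⟨x, hx⟩
  obtain ⟨δ, hδ, hδle⟩ : ∃ δ > 0, ∀ x ∈ closedBall (0 : E) 1, δ ≤ ‖H x‖ := by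
    obtain ⟨x, hx, hmin⟩ := (isCompact_closedBall (0 : E) 1).exists_isMinOn
      ⟨0, by simp⟩ hH.norm
    exact ⟨‖H x‖, norm_pos_iff.2 (hne x hx), fun y hy => hmin hy⟩
  -- The error δ/2 keeps P away from zero on the ball; the error 1/12, added to 1/3, keeps P within
  -- 1/2 of the identity.
  obtain ⟨P, hP, hPG, -⟩ := G.continuous.exists_contDiff_approx (n := 1)
    (ε := fun _ => min (δ / 2) (1 / 12)) continuous_const (fun _ => by positivity)
  have hPδ : ∀ x ∈ closedBall (0 : E) 1, P x ≠ 0 := by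
    intro x hx h0
    have h1 := (hPG x).trans_le (min_le_left _ _)
    rw [h0, hGH x hx, dist_zero_left] at h1
    linarith [hδle x hx]
  have hPx : ∀ x ∈ closedBall (0 : E) 1, ‖P x - x‖ < 1 / 2 := by
    intro x hx
    have h1 := (hPG x).trans_le (min_le_right _ _)
    rw [hGH x hx, dist_eq_norm] at h1
    have := norm_add_le (P x - H x) (H x - x)
    rw [sub_add_sub_cancel] at this
    linarith [hclose x hx]
  let χ : ContDiffBump (0 : E) := ⟨1 / 2, 3 / 4, by norm_num, by norm_num⟩
  set h : E → E := fun x => x + χ x • (P x - x) with hh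
  have hsm : ContDiff ℝ 1 h :=
    contDiff_id.add (χ.contDiff.smul (hP.sub contDiff_id))
  have hout : ∀ x : E, 3 / 4 ≤ ‖x‖ → h x = x := by
    intro x hx
    have : χ x = 0 := χ.zero_of_le_dist (by rw [dist_zero_right]; exact hx)
    simp [h, this]
  have hne0 : ∀ x, h x ≠ 0 := by
    intro x h0
    rcases le_or_gt ‖x‖ (1 / 2) with hx | hx
    · have : χ x = 1 := χ.one_of_mem_closedBall (by simpa [χ] using hx)
      simp only [h, this, one_smul, add_sub_cancel] at h0
      exact hPδ x (by simpa using hx.trans (by norm_num)) h0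
    · rcases le_or_gt (3 / 4) ‖x‖ with hx' | hx'
      · rw [hout x hx'] at h0
        rw [h0, norm_zero] at hx
        norm_num at hx
      -- Where the bump function interpolates, 1/2 < ‖x‖ < 3/4, a zero would force ‖x‖ ≤ ‖P x - x‖ <
      -- 1/2.
      · have h1 : x = -(χ x • (P x - x)) := eq_neg_of_add_eq_zero_left h0
        have h2 : ‖x‖ = χ x * ‖P x - x‖ := by
          conv_lhs => rw [h1, norm_neg, norm_smul, Real.norm_of_nonneg χ.nonneg]
        have h3 := hPx x (by rw [mem_closedBall_zero_iff]; linarith)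
        nlinarith [χ.nonneg (x := x), χ.le_one (x := x), norm_nonneg (P x - x)]
  set k₀ : E → E := fun x => ‖h x‖⁻¹ • h x - x with hk₀
  have hk₀sm : ContDiff ℝ 1 k₀ :=
    (((hsm.norm ℝ hne0).inv fun x => norm_ne_zero_iff.2 (hne0 x)).smul hsm).sub contDiff_id
  have hk₀0 : ∀ x : E, ‖x‖ = 1 → k₀ x = 0 := by
    intro x hx
    simp [k₀, hout x (by rw [hx]; norm_num), hx]
  obtain ⟨C, hC⟩ := hk₀sm.contDiffOn.exists_lipschitzOnWith (s := closedBall (0 : E) 1) one_ne_zero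
    (convex_closedBall _ _) (isCompact_closedBall _ _)
  classical
  -- Extension by zero preserves the Lipschitz constant because k₀ vanishes on the unit sphere,
  -- which every segment leaving the ball must cross.
  set k : E → E := fun x => if ‖x‖ < 1 then k₀ x else 0 with hk
  have hcross : ∀ x y : E, ‖x‖ < 1 → 1 ≤ ‖y‖ → dist (k₀ x) 0 ≤ C * dist x y := by
    intro x y hx hy
    obtain ⟨a, ha, ha1⟩ : ∃ a ∈ Icc (0 : ℝ) 1, ‖AffineMap.lineMap x y a‖ = 1 := by
      have hc : ContinuousOn (fun a : ℝ => ‖AffineMap.lineMap x y a‖) (Icc 0 1) :=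
        (AffineMap.lineMap_continuous).norm.continuousOn
      exact intermediate_value_Icc zero_le_one hc (by simp [hx.le, hy])
    have h1 := hC.dist_le_mul x (by simpa using hx.le) (AffineMap.lineMap x y a)
      (by simpa using ha1.le)
    rw [hk₀0 _ ha1] at h1
    refine h1.trans (mul_le_mul_of_nonneg_left ?_ C.2)
    rw [dist_left_lineMap, Real.norm_of_nonneg ha.1]
    nlinarith [ha.2, dist_nonneg (x := x) (y := y)]
  have hklip : LipschitzWith C k := by
    refine LipschitzWith.of_dist_le_mul fun x y => ?_
    simp only [k]
    split_ifs with hx hy hy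
    · exact hC.dist_le_mul x (by simpa using hx.le) y (by simpa using hy.le)
    · exact hcross x y hx (not_lt.1 hy)
    · rw [dist_comm, dist_comm x y]
      exact hcross y x hy (not_lt.1 hx)
    · rw [dist_self]; positivity
  obtain ⟨x, hx, hx1⟩ := exists_norm_add_ne_one hklip (fun x hx => if_neg (not_lt.2 hx)) (by
    intro x hx
    refine (hk₀sm.differentiable one_ne_zero x).congr_of_eventuallyEq ?_
    filter_upwards [isOpen_ball.mem_nhds hx] with y hy
    exact if_pos (by simpa using hy))
  refine hx1 ?_
  have : k x = k₀ x := if_pos (by simpa using hx)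
  rw [this, hk₀, add_sub_cancel, norm_smul, norm_inv, norm_norm,
    inv_mul_cancel₀ (norm_ne_zero_iff.2 (hne0 x))]

/-- If f(0) were not interior, one could choose a point c close to f(0) off the image, push the
image away from c onto a small sphere, and follow with a smooth approximation of the inverse of f. A
generic translate of the composite has no zero but stays close to the identity, contradicting
`exists_eq_zero_of_norm_sub_le`. -/
theorem mem_interior_image_closedBall [Nontrivial E] {f : E → E}
    (hf : ContinuousOn f (closedBall 0 1)) (hinj : InjOn f (closedBall 0 1)) :
    f 0 ∈ interior (f '' closedBall 0 1) := by
  by_contra hint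
  have h0 : (0 : E) ∈ closedBall (0 : E) 1 := by simp
  have : CompactSpace (closedBall (0 : E) 1) := isCompact_iff_compactSpace.1 (isCompact_closedBall _ _)
  have hemb : Topology.IsClosedEmbedding ((closedBall (0 : E) 1).domRestrict f) :=
    Continuous.isClosedEmbedding hf.domRestrict (injOn_iff_injective.1 hinj)
  -- Tietze extension of the inverse of f from the compact image to the whole space.
  obtain ⟨G, hG⟩ := ContinuousMap.exists_extension hemb
    (⟨Subtype.val, continuous_subtype_val⟩ : C(closedBall (0 : E) 1, E))
  have hGf : ∀ x ∈ closedBall (0 : E) 1, G (f x) = x := fun x hx =>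
    DFunLike.congr_fun hG ⟨x, hx⟩
  have hK : IsCompact (f '' closedBall 0 1) := (isCompact_closedBall _ _).image_of_continuousOn hf
  obtain ⟨ε, hε, hGε⟩ : ∃ ε > 0, ∀ y, dist y (f 0) ≤ 2 * ε → ‖G y‖ ≤ 1 / 10 := by
    have hc := Metric.continuousAt_iff.1 (G.continuous.continuousAt (x := f 0)) (1 / 10) (by norm_num)
    obtain ⟨r, hr, hr'⟩ := hc
    refine ⟨r / 4, by positivity, fun y hy => ?_⟩
    have := hr' (x := y) (by linarith)
    rw [hGf 0 h0, dist_zero_right] at this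
    exact this.le
  obtain ⟨c, hc, hcK⟩ : ∃ c, dist c (f 0) < ε ∧ c ∉ f '' closedBall 0 1 := by
    by_contra! hall
    exact hint (mem_interior_iff_mem_nhds.2 (Metric.mem_nhds_iff.2 ⟨ε, hε, fun y hy => hall y hy⟩))
  set S₁ : Set E := f '' closedBall 0 1 ∩ {y | ε ≤ ‖y - c‖} with hS₁
  have hS₁c : IsCompact S₁ := hK.inter_right (isClosed_le continuous_const (by fun_prop))
  obtain ⟨δ, hδ, hδle⟩ : ∃ δ > 0, ∀ y ∈ S₁, δ ≤ ‖G y‖ := by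
    rcases S₁.eq_empty_or_nonempty with he | hne
    · exact ⟨1, one_pos, by simp [he]⟩
    · obtain ⟨y, hy, hmin⟩ := hS₁c.exists_isMinOn hne (G.continuous.norm.continuousOn)
      refine ⟨‖G y‖, norm_pos_iff.2 fun hGy => ?_, fun z hz => hmin hz⟩
      obtain ⟨⟨x, hx, rfl⟩, hy2⟩ := hy
      rw [hGf x hx] at hGy
      rw [hGy, mem_ofPred_eq, ← dist_eq_norm, dist_comm] at hy2
      linarith
  set η : ℝ := min (δ / 4) (1 / 24) with hη
  have hη0 : 0 < η := by positivity
  obtain ⟨P, hP, hPG, -⟩ := G.continuous.exists_contDiff_approx (n := 1)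
    (ε := fun _ => η) continuous_const (fun _ => hη0)
  -- The image of a sphere under a differentiable map is a null set, so arbitrarily small vectors
  -- avoid it.
  obtain ⟨a, ha, haP⟩ : ∃ a ∈ ball (0 : E) η, a ∉ P '' sphere c ε := by
    by_contra! hall
    have hz : volume (P '' sphere c ε) = 0 :=
      addHaar_image_eq_zero_of_differentiableOn_of_addHaar_eq_zero volume
        (hP.differentiable one_ne_zero).differentiableOn
        (Measure.addHaar_sphere volume c ε)
    exact (measure_ball_pos volume (0 : E) hη0).ne' (measure_mono_null (fun x hx => hall x hx) hz)
  -- Radial projection from c: the punctured ball of radius ε goes to its sphere and everything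
  -- farther from c stays fixed.
  set Φ : E → E := fun y => c + max (ε / ‖y - c‖) 1 • (y - c) with hΦ
  have hΦ₁ : ∀ y, y ≠ c → ε ≤ ‖y - c‖ → Φ y = y := by
    intro y hy hle
    have : ε / ‖y - c‖ ≤ 1 := (div_le_one (norm_pos_iff.2 (sub_ne_zero.2 hy))).2 hle
    simp [Φ, max_eq_right this]
  have hΦ₂ : ∀ y, y ≠ c → ‖y - c‖ ≤ ε → ‖Φ y - c‖ = ε := by
    intro y hy hle
    have hpos := norm_pos_iff.2 (sub_ne_zero.2 hy)
    have : 1 ≤ ε / ‖y - c‖ := (one_le_div hpos).2 hle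
    simp only [Φ, max_eq_left this, add_sub_cancel_left, norm_smul, norm_div, norm_norm,
      Real.norm_of_nonneg hε.le]
    field_simp
  have hne : ∀ x ∈ closedBall (0 : E) 1, f x ≠ c := fun x hx h => hcK ⟨x, hx, h⟩
  have hPG' : ∀ y, ‖P y - a - G y‖ ≤ 2 * η := by
    intro y
    have h1 := hPG y
    rw [dist_eq_norm] at h1
    have h2 : ‖a‖ < η := by simpa using ha
    have h3 : P y - a - G y = (P y - G y) - a := by abel
    rw [h3]
    linarith [norm_sub_le (P y - G y) a]
  -- The distance to the identity is at most 1/12 away from c. Near c both G(f x) = x and G(Φ(f x))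
  -- have norm at most 1/10, and 1/12 + 1/10 + 1/10 < 1/3.
  obtain ⟨x, hx, hx0⟩ := exists_eq_zero_of_norm_sub_le (H := fun x => P (Φ (f x)) - a) (by
    have hΦc : ContinuousOn Φ {y | y ≠ c} := by
      refine continuousOn_const.add (ContinuousOn.smul ?_ (by fun_prop))
      refine ContinuousOn.sup (continuousOn_const.div (by fun_prop) fun y hy => ?_) continuousOn_const
      exact (norm_pos_iff.2 (sub_ne_zero.2 hy)).ne'
    exact ((hP.continuous.comp_continuousOn (hΦc.comp hf hne)).sub continuousOn_const)) (by
    intro x hx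
    have hGx := hGf x hx
    have h1 := hPG' (Φ (f x))
    have hη2 : η ≤ 1 / 24 := min_le_right _ _
    rcases le_total ε ‖f x - c‖ with hle | hle
    · rw [hΦ₁ _ (hne x hx) hle, hGx] at h1
      simp only [hΦ₁ _ (hne x hx) hle]
      linarith
    · have h2 : ‖G (f x)‖ ≤ 1 / 10 := by
        apply hGε
        rw [← dist_eq_norm] at hle
        linarith [dist_triangle (f x) c (f 0)]
      have h3 : ‖G (Φ (f x))‖ ≤ 1 / 10 := by
        apply hGε
        have := hΦ₂ _ (hne x hx) hle
        rw [← dist_eq_norm] at this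
        linarith [dist_triangle (Φ (f x)) c (f 0)]
      rw [hGx] at h2
      have h4 : P (Φ (f x)) - a - x = (P (Φ (f x)) - a - G (Φ (f x))) + G (Φ (f x)) - x := by abel
      rw [h4]
      linarith [norm_sub_le (P (Φ (f x)) - a - G (Φ (f x)) + G (Φ (f x))) x,
        norm_add_le (P (Φ (f x)) - a - G (Φ (f x))) (G (Φ (f x)))])
  -- The zero is impossible in both regions: far from c, G has norm at least δ, which exceeds 2η;
  -- near c, the vector a would lie in the image of the sphere.
  rcases le_total ε ‖f x - c‖ with hle | hle
  · simp only [hΦ₁ _ (hne x hx) hle] at hx0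
    have h1 := hPG' (f x)
    rw [hx0, zero_sub, norm_neg] at h1
    have h2 := hδle (f x) ⟨⟨x, hx, rfl⟩, hle⟩
    have hη2 : η ≤ δ / 4 := min_le_left _ _
    linarith
  · refine haP ⟨Φ (f x), ?_, sub_eq_zero.1 hx0⟩
    rw [mem_sphere, dist_eq_norm]
    exact hΦ₂ _ (hne x hx) hle

/-- **Invariance of domain**. -/
theorem isOpen_image_of_injOn [Nontrivial E] {U : Set E} (hU : IsOpen U) {f : E → E}
    (hf : ContinuousOn f U) (hinj : InjOn f U) : IsOpen (f '' U) := by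
  refine isOpen_iff_mem_nhds.2 ?_
  rintro _ ⟨x, hx, rfl⟩
  obtain ⟨r, hr, hsub⟩ := Metric.nhds_basis_closedBall.mem_iff.1 (hU.mem_nhds hx)
  have hmaps : MapsTo (fun y : E => x + r • y) (closedBall 0 1) U := by
    intro y hy
    apply hsub
    rw [mem_closedBall, dist_eq_norm, add_sub_cancel_left, norm_smul, Real.norm_of_nonneg hr.le]
    have : ‖y‖ ≤ 1 := by simpa using hy
    nlinarith
  have h := mem_interior_image_closedBall (f := fun y => f (x + r • y))
    (hf.comp (by fun_prop) hmaps) (by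
      intro y hy z hz hyz
      have := hinj (hmaps hy) (hmaps hz) hyz
      exact smul_right_injective E hr.ne' (add_left_cancel this))
  simp only [smul_zero, add_zero] at h
  refine Filter.mem_of_superset (mem_interior_iff_mem_nhds.1 h) ?_
  rintro _ ⟨y, hy, rfl⟩
  exact ⟨_, hmaps hy, rfl⟩

/-! ### Invariance of domain for maps to and from manifolds. -/

variable {N : Type*} [TopologicalSpace N] [ChartedSpace E N]

theorem isOpen_image_chartedSpace [Nontrivial E] {U : Set E} (hU : IsOpen U) {g : E → N}
    (hg : ContinuousOn g U) (hinj : InjOn g U) : IsOpen (g '' U) := by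
  refine isOpen_iff_mem_nhds.2 ?_
  rintro _ ⟨x, hx, rfl⟩
  set φ := chartAt E (g x)
  have hV : IsOpen (U ∩ g ⁻¹' φ.source) := hg.isOpen_inter_preimage hU φ.open_source
  have hO := isOpen_image_of_injOn hV (f := φ ∘ g)
    (φ.continuousOn.comp (hg.mono inter_subset_left) fun y hy => hy.2)
    (φ.injOn.comp (hinj.mono inter_subset_left) fun y hy => hy.2)
  have hpre := φ.isOpen_inter_preimage hO
  refine Filter.mem_of_superset (hpre.mem_nhds ⟨mem_chart_source E (g x), x,
    ⟨hx, mem_chart_source E (g x)⟩, rfl⟩) ?_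
  rintro y ⟨hy, z, hz, hzy⟩
  exact ⟨z, hz.1, φ.injOn hz.2 hy hzy⟩

theorem isOpen_image_of_chartedSpace [Nontrivial E] {U : Set N} (hU : IsOpen U) {F : N → E}
    (hF : ContinuousOn F U) (hinj : InjOn F U) : IsOpen (F '' U) := by
  refine isOpen_iff_mem_nhds.2 ?_
  rintro _ ⟨x, hx, rfl⟩
  set φ := chartAt E x
  have hV : IsOpen (φ.target ∩ φ.symm ⁻¹' U) := φ.isOpen_inter_preimage_symm hU
  have hO := isOpen_image_of_injOn hV (f := F ∘ φ.symm)
    (hF.comp (φ.continuousOn_symm.mono inter_subset_left) fun y hy => hy.2)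
    (hinj.comp (φ.symm.injOn.mono inter_subset_left) fun y hy => hy.2)
  refine Filter.mem_of_superset (hO.mem_nhds ⟨φ x, ⟨mem_chart_target E x, ?_⟩, ?_⟩) ?_
  · simpa [φ, φ.left_inv (mem_chart_source E x)] using hx
  · simp [φ, φ.left_inv (mem_chart_source E x)]
  · rintro _ ⟨y, hy, rfl⟩
    exact ⟨_, hy.2, rfl⟩

end InvarianceOfDomain

noncomputable section

/-! ### Topology of realizations -/

namespace PreAbstractSimplicialComplex

open Topology Set

variable {V V' : Type*} {X : PreAbstractSimplicialComplex V} {Y : PreAbstractSimplicialComplex V'}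

theorem mem_faces_of_subset {σ τ : Finset V} (hσ : σ ∈ X.faces) (h : τ ⊆ σ) (hne : τ.Nonempty) :
    τ ∈ X.faces :=
  (X.isRelLowerSet_faces hσ).2 h hne

theorem nonempty_of_mem_faces {σ : Finset V} (hσ : σ ∈ X.faces) : σ.Nonempty :=
  (X.isRelLowerSet_faces hσ).1

theorem continuous_geomSimplex_val {σ : Finset V} (hσ : σ ∈ X.faces) :
    Continuous (fun x : X.GeomSimplex σ => x.1) :=
  continuous_iff_coinduced_le.2
    (le_iSup (fun σ : X.faces => TopologicalSpace.coinduced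
      (fun x : X.GeomSimplex (σ : Finset V) => x.1) inferInstance) ⟨σ, hσ⟩)

theorem continuous_realization_iff {Z : Type*} [TopologicalSpace Z] {f : X.Realization → Z} :
    Continuous f ↔ ∀ σ ∈ X.faces, Continuous fun x : X.GeomSimplex σ => f x.1 := by
  constructor
  · exact fun h σ hσ => h.comp (continuous_geomSimplex_val hσ)
  · intro h
    refine continuous_iSup_dom.2 fun σ => continuous_coinduced_dom.2 (h σ σ.2)

theorem continuous_geomSimplex_iff {Z : Type*} [TopologicalSpace Z] {σ : Finset V}
    {f : Z → X.GeomSimplex σ} : Continuous f ↔ ∀ v, Continuous fun z => (f z).1.1 v := by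
  rw [continuous_induced_rng, continuous_pi_iff]
  rfl

theorem continuous_coord (v : V) : Continuous fun x : X.Realization => x.1 v :=
  continuous_realization_iff.2 fun _ _ => continuous_geomSimplex_iff.1 continuous_id v

theorem Realization.ext {x y : X.Realization} (h : ∀ v, x.1 v = y.1 v) : x = y :=
  Subtype.ext (Finsupp.ext h)

instance : T2Space X.Realization := by
  refine T2Space.of_injective_continuous (f := fun x : X.Realization => (x.1 : V → ℝ))
    (fun x y h => Realization.ext fun v => congrFun h v) (continuous_pi fun v => continuous_coord v)

/-- A map into a realization with continuous coordinates is continuous if it meets only finitely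
many simplices. -/
theorem continuous_into_realization {Z : Type*} [TopologicalSpace Z] {g : Z → X.Realization}
    (A : Finset V) (hA : ∀ z, (g z).1.support ⊆ A) (hc : ∀ v ∈ A, Continuous fun z => (g z).1 v) :
    Continuous g := by
  classical
  have hc' : ∀ v, Continuous fun z => (g z).1 v := by
    intro v
    by_cases hv : v ∈ A
    · exact hc v hv
    · have : (fun z => (g z).1 v) = fun _ => 0 := by
        funext z
        by_contra h
        exact hv (hA z (Finsupp.mem_support_iff.2 h))
      rw [this]
      exact continuous_const
  let f : {σ : Finset V // σ ∈ A.powerset ∧ σ ∈ X.faces} → Set Z := fun σ =>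
    {z | (g z).1.support ⊆ σ.1}
  have hfin : Finite {σ : Finset V // σ ∈ A.powerset ∧ σ ∈ X.faces} :=
    Set.Finite.subset A.powerset.finite_toSet fun σ hσ => hσ.1
  -- The domain is a finite union of the closed sets on which the support lies in a given simplex;
  -- on each of them the map factors through a closed simplex, where coordinates determine the
  -- topology.
  refine LocallyFinite.continuous (locallyFinite_of_finite f) ?_ ?_ ?_
  · refine eq_univ_of_forall fun z => mem_iUnion.2 ⟨⟨(g z).1.support, ?_, (g z).2.2.2⟩, ?_⟩
    · exact Finset.mem_powerset.2 (hA z)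
    · exact Finset.Subset.refl _
  · intro σ
    have : f σ = ⋂ v ∈ ((σ.1 : Set V)ᶜ), {z | (g z).1 v = 0} := by
      ext z
      simp only [f, mem_iInter, mem_ofPred_eq, Finset.subset_iff, Finsupp.mem_support_iff,
        mem_compl_iff, Finset.mem_coe]
      exact forall_congr' fun v => not_imp_comm
    rw [this]
    exact isClosed_biInter fun v _ => isClosed_eq (hc' v) continuous_const
  · intro σ
    rw [continuousOn_iff_continuous_domRestrict]
    let g' : f σ → X.GeomSimplex σ.1 := fun z => ⟨g z.1, z.2⟩
    have h1 : Continuous g' :=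
      continuous_geomSimplex_iff.2 fun v => (hc' v).comp continuous_subtype_val
    exact (continuous_geomSimplex_val σ.2.2).comp h1

/-- The point of the realization with barycentric coordinates proportional to `c`. -/
def normalize (X : PreAbstractSimplicialComplex V) (c : V →₀ ℝ) (h0 : ∀ v, 0 ≤ c v)
    (hc : c.support ∈ X.faces) : X.Realization :=
  ⟨(c.sum fun _ r => r)⁻¹ • c, by
    have hpos : 0 < c.sum fun _ r => r :=
      Finset.sum_pos (fun v hv => lt_of_le_of_ne (h0 v) (Finsupp.mem_support_iff.1 hv).symm)
        (nonempty_of_mem_faces hc)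
    refine ⟨fun v => mul_nonneg (inv_nonneg.2 hpos.le) (h0 v), ?_, ?_⟩
    · rw [Finsupp.sum_smul_index (fun _ => rfl), ← Finsupp.mul_sum]
      exact inv_mul_cancel₀ hpos.ne'
    · rwa [Finsupp.support_smul_eq (inv_ne_zero hpos.ne')]⟩

theorem sum_pos_of_support_mem {c : V →₀ ℝ} (h0 : ∀ v, 0 ≤ c v) (hc : c.support ∈ X.faces) :
    0 < c.sum fun _ r => r :=
  Finset.sum_pos (fun v hv => lt_of_le_of_ne (h0 v) (Finsupp.mem_support_iff.1 hv).symm)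
    (nonempty_of_mem_faces hc)

theorem normalize_apply {c : V →₀ ℝ} (h0 : ∀ v, 0 ≤ c v) (hc : c.support ∈ X.faces) (v : V) :
    (X.normalize c h0 hc).1 v = (c.sum fun _ r => r)⁻¹ * c v := rfl

theorem support_normalize {c : V →₀ ℝ} (h0 : ∀ v, 0 ≤ c v) (hc : c.support ∈ X.faces) :
    (X.normalize c h0 hc).1.support = c.support :=
  Finsupp.support_smul_eq (inv_ne_zero (sum_pos_of_support_mem h0 hc).ne')

theorem normalize_div {c : V →₀ ℝ} (h0 : ∀ v, 0 ≤ c v) (hc : c.support ∈ X.faces) (v w : V) :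
    (X.normalize c h0 hc).1 v / (X.normalize c h0 hc).1 w = c v / c w := by
  rw [normalize_apply, normalize_apply,
    mul_div_mul_left _ _ (inv_ne_zero (sum_pos_of_support_mem h0 hc).ne')]

theorem continuous_normalize {Z : Type*} [TopologicalSpace Z] {c : Z → V →₀ ℝ}
    (h0 : ∀ z v, 0 ≤ c z v) (hc : ∀ z, (c z).support ∈ X.faces) (A : Finset V)
    (hA : ∀ z, (c z).support ⊆ A) (hcont : ∀ v ∈ A, Continuous fun z => c z v) :
    Continuous fun z => X.normalize (c z) (h0 z) (hc z) := by
  refine continuous_into_realization A (fun z => by rw [support_normalize]; exact hA z) fun v hv => ?_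
  simp only [normalize_apply]
  refine Continuous.mul (Continuous.inv₀ ?_ fun z => (sum_pos_of_support_mem (h0 z) (hc z)).ne')
    (hcont v hv)
  have : (fun z => (c z).sum fun _ r => r) = fun z => ∑ v ∈ A, c z v := by
    funext z
    exact Finsupp.sum_of_support_subset _ (hA z) _ fun _ _ => rfl
  rw [this]
  exact continuous_finsetSum _ fun v hv => hcont v hv

/-- Points of the closed simplices through a point of an open set fill a simplex. -/
theorem exists_mem_support_eq {O : Set X.Realization} (hO : IsOpen O) {p : X.Realization}
    (hp : p ∈ O) {σ : Finset V} (hσ : σ ∈ X.faces) (hpσ : p.1.support ⊆ σ) :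
    ∃ q ∈ O, q.1.support = σ := by
  classical
  -- Add ε to every coordinate in σ and renormalize. Truncation at 0 extends the path to negative ε,
  -- so that continuity at 0 can be used.
  set c : ℝ → V →₀ ℝ := fun ε => p.1 + (max ε 0) • Finsupp.indicator σ fun _ _ => (1 : ℝ) with hc
  have hcv : ∀ ε v, c ε v = p.1 v + max ε 0 * (if v ∈ σ then 1 else 0) := by
    intro ε v
    simp [c, Finsupp.indicator_apply]
  have h0 : ∀ ε v, 0 ≤ c ε v := by
    intro ε v
    rw [hcv]
    have := p.2.1 v
    split_ifs <;> positivity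
  have hsub : ∀ ε, (c ε).support ⊆ σ := by
    intro ε v hv
    by_contra hvσ
    rw [Finsupp.mem_support_iff, hcv, if_neg hvσ, mul_zero, add_zero] at hv
    exact hvσ (hpσ (Finsupp.mem_support_iff.2 hv))
  have hsup : ∀ ε, p.1.support ⊆ (c ε).support := by
    intro ε v hv
    rw [Finsupp.mem_support_iff, hcv] at *
    have h1 := lt_of_le_of_ne (p.2.1 v) (Ne.symm hv)
    have : 0 ≤ max ε 0 * (if v ∈ σ then 1 else 0) := by split_ifs <;> positivity
    linarith
  have hface : ∀ ε, (c ε).support ∈ X.faces := fun ε =>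
    mem_faces_of_subset hσ (hsub ε) ((nonempty_of_mem_faces p.2.2.2).mono (hsup ε))
  have hcont : Continuous fun ε => X.normalize (c ε) (h0 ε) (hface ε) := by
    refine continuous_normalize h0 hface σ hsub fun v _ => ?_
    simp only [hcv]
    fun_prop
  have hzero : X.normalize (c 0) (h0 0) (hface 0) = p := by
    refine Realization.ext fun v => ?_
    have hc0 : c 0 = p.1 := by simp [c]
    rw [normalize_apply, hc0, p.2.2.1, inv_one, one_mul]
  have hev : ∀ᶠ ε in 𝓝[>] (0 : ℝ), X.normalize (c ε) (h0 ε) (hface ε) ∈ O :=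
    (hcont.tendsto 0).mono_left nhdsWithin_le_nhds (hO.mem_nhds (by rw [hzero]; exact hp))
  obtain ⟨ε, hεO, hε⟩ := (hev.and self_mem_nhdsWithin).exists
  refine ⟨_, hεO, ?_⟩
  rw [support_normalize]
  refine (hsub ε).antisymm fun v hv => ?_
  rw [Finsupp.mem_support_iff, hcv, if_pos hv]
  have := p.2.1 v
  have h1 : 0 < max ε 0 := lt_max_of_lt_left hε
  nlinarith

/-! #### Isomorphisms -/

theorem singleton_mem_of_mem {σ : Finset V} (hσ : σ ∈ X.faces) {v : V} (hv : v ∈ σ) :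
    {v} ∈ X.faces :=
  mem_faces_of_subset hσ (Finset.singleton_subset_iff.2 hv) ⟨v, Finset.mem_singleton_self v⟩

/-- The inverse of an isomorphism. -/
def Iso.symm (e : X.Iso Y) : Y.Iso X where
  toEquiv := e.toEquiv.symm
  map_faces σ := by
    refine Iff.trans ?_ (e.map_faces _).symm
    rw [Finset.map_map _ _ σ]
    have : e.toEquiv.symm.toEmbedding.trans e.toEquiv.toEmbedding = Function.Embedding.refl _ :=
      Function.Embedding.ext fun x => e.toEquiv.apply_symm_apply x
    rw [this, Finset.map_refl]

theorem singleton_mem_of_mem_support (x : X.Realization) {v : V} (hv : v ∈ x.1.support) :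
    {v} ∈ X.faces :=
  singleton_mem_of_mem x.2.2.2 hv

/-! #### Connectedness -/

/-- The vertex `v` as a point of the realization. -/
def vertexPoint (X : PreAbstractSimplicialComplex V) (v : V) (hv : {v} ∈ X.faces) : X.Realization :=
  ⟨Finsupp.single v 1, by
    classical
    refine ⟨fun w => ?_, by simp, by rwa [Finsupp.support_single v (one_ne_zero (α := ℝ))]⟩
    rw [Finsupp.single_apply]
    split_ifs <;> norm_num⟩

/-- The straight segment between the two points stays in the common simplex. -/
theorem joined_of_support_subset {σ : Finset V} (hσ : σ ∈ X.faces) {p q : X.Realization}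
    (hp : p.1.support ⊆ σ) (hq : q.1.support ⊆ σ) : Joined p q := by
  classical
  let c : unitInterval → V →₀ ℝ := fun t => (1 - (t : ℝ)) • p.1 + (t : ℝ) • q.1
  have hcv : ∀ t v, c t v = (1 - (t : ℝ)) * p.1 v + t * q.1 v := fun t v => by simp [c]
  have h0 : ∀ t v, 0 ≤ c t v := by
    intro t v
    rw [hcv]
    have := p.2.1 v
    have := q.2.1 v
    have := t.2.1
    have := t.2.2
    have : 0 ≤ 1 - (t : ℝ) := by linarith
    positivity
  have hsub : ∀ t, (c t).support ⊆ σ := fun t =>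
    (Finsupp.support_add).trans (Finset.union_subset
      (Finsupp.support_smul.trans hp) (Finsupp.support_smul.trans hq))
  have hsum : ∀ t, (c t).sum (fun _ r => r) = 1 := by
    intro t
    rw [Finsupp.sum_of_support_subset _ (hsub t) _ fun _ _ => rfl]
    have h1 := p.2.2.1
    have h2 := q.2.2.1
    rw [Finsupp.sum_of_support_subset _ hp _ fun _ _ => rfl] at h1
    rw [Finsupp.sum_of_support_subset _ hq _ fun _ _ => rfl] at h2
    simp only [hcv]
    rw [Finset.sum_add_distrib, ← Finset.mul_sum, ← Finset.mul_sum, h1, h2]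
    ring
  have hface : ∀ t, (c t).support ∈ X.faces := by
    intro t
    refine mem_faces_of_subset hσ (hsub t) ?_
    by_contra h
    rw [Finset.not_nonempty_iff_eq_empty] at h
    have := hsum t
    rw [Finsupp.sum, h, Finset.sum_empty] at this
    exact zero_ne_one this
  let g : unitInterval → X.Realization := fun t => ⟨c t, h0 t, hsum t, hface t⟩
  have hg : Continuous g := by
    refine continuous_into_realization σ hsub fun v _ => ?_
    have : (fun t => (g t).1 v) = fun t : unitInterval => (1 - (t : ℝ)) * p.1 v + t * q.1 v :=
      funext fun t => hcv t v
    rw [this]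
    fun_prop
  refine ⟨⟨⟨g, hg⟩, ?_, ?_⟩⟩
  · exact Realization.ext fun v => by simp [g, c]
  · exact Realization.ext fun v => by simp [g, c]

theorem connectedSpace_realization {v₀ : V} (hv₀ : {v₀} ∈ X.faces)
    (hconn : ∀ v, {v} ∈ X.faces → X.EdgeReachable v₀ v) : ConnectedSpace X.Realization := by
  have hjoin : ∀ v, X.EdgeReachable v₀ v → ∀ hv : {v} ∈ X.faces,
      Joined (X.vertexPoint v₀ hv₀) (X.vertexPoint v hv) := by
    intro v hv
    induction hv with
    | refl => exact fun _ => Joined.refl _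
    | @tail a b _ hab ih =>
      intro hb
      obtain ⟨σ, hσ, ha', hb'⟩ := hab
      have ha : {a} ∈ X.faces := mem_faces_of_subset hσ (Finset.singleton_subset_iff.2 ha')
        ⟨_, Finset.mem_singleton_self _⟩
      refine (ih ha).trans (joined_of_support_subset hσ ?_ ?_)
      · exact Finsupp.support_single_subset.trans (Finset.singleton_subset_iff.2 ha')
      · exact Finsupp.support_single_subset.trans (Finset.singleton_subset_iff.2 hb')
  have hall : ∀ x : X.Realization, Joined (X.vertexPoint v₀ hv₀) x := by
    intro x
    obtain ⟨v, hv⟩ := nonempty_of_mem_faces x.2.2.2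
    have hv' := singleton_mem_of_mem_support x hv
    exact (hjoin v (hconn v hv') hv').trans (joined_of_support_subset x.2.2.2
      (Finsupp.support_single_subset.trans (Finset.singleton_subset_iff.2 hv))
      (Finset.Subset.refl _))
  have : PathConnectedSpace X.Realization :=
    ⟨⟨X.vertexPoint v₀ hv₀⟩, fun x y => (hall x).symm.trans (hall y)⟩
  infer_instance

end PreAbstractSimplicialComplex

end

noncomputable section

/-! ### Cycles in two-regular graphs -/

/-- Walk along the graph without turning back. On the finite set of directed edges this is a
permutation, and the orbit of one directed edge closes up. The work lies in showing that a vertex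
met twice is met in the same direction. Connectedness is not assumed, so the cycle need not exhaust
S. -/
theorem exists_cycle_of_two_regular {V : Type*} (adj : V → V → Prop) (hsymm : ∀ a b, adj a b → adj b a)
    (hirr : ∀ a, ¬ adj a a) (htri : ∀ a b c, adj a b → adj b c → ¬ adj a c) (S : Set V)
    (hfin : S.Finite)
    (hreg : ∀ v ∈ S, ∃ a ∈ S, ∃ b ∈ S, a ≠ b ∧ ∀ w, adj v w ↔ w = a ∨ w = b) (v₀ : V) (hv₀ : v₀ ∈ S) :
    ∃ n : ℕ, 4 ≤ n ∧ ∃ c : ℤ → V, c 0 = v₀ ∧ (∀ i, c i ∈ S) ∧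
      (∀ i j, c i = c j ↔ (n : ℤ) ∣ i - j) ∧
      ∀ i w, adj (c i) w ↔ w = c (i + 1) ∨ w = c (i - 1) := by
  classical
  have hother : ∀ v ∈ S, ∀ a, adj v a → a ∈ S ∧ ∃ b ∈ S, b ≠ a ∧ ∀ w, adj v w ↔ w = a ∨ w = b := by
    intro v hv a ha
    obtain ⟨x, hx, y, hy, hxy, h⟩ := hreg v hv
    rcases (h a).1 ha with rfl | rfl
    · exact ⟨hx, y, hy, hxy.symm, h⟩
    · exact ⟨hy, x, hx, hxy, fun w => (h w).trans or_comm⟩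
  -- A pair (current vertex, following vertex); `next` passes to the second vertex and its neighbor
  -- different from the first.
  let D := {d : V × V // d.1 ∈ S ∧ d.2 ∈ S ∧ adj d.2 d.1}
  have hD : Finite D := Set.Finite.subset (hfin.prod hfin) fun d hd => ⟨hd.1, hd.2.1⟩
  choose! o ho using fun v hv a ha => (hother v hv a ha).2
  let next : D → D := fun d => ⟨(d.1.2, o d.1.2 d.1.1), d.2.2.1, (ho _ d.2.2.1 _ d.2.2.2).1,
    hsymm _ _ (((ho _ d.2.2.1 _ d.2.2.2).2.2 _).2 (Or.inr rfl))⟩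
  have hnext : Function.Injective next := by
    rintro ⟨⟨a, v⟩, ha, hv, hav⟩ ⟨⟨b, w⟩, hb, hw, hbw⟩ h
    have hvw : v = w := congrArg (fun d : D => d.1.1) h
    have h : o v a = o w b := congrArg (fun d : D => d.1.2) h
    subst hvw
    have h1 := ho v hv a hav
    have h2 := ho v hw b hbw
    rcases (h1.2.2 b).1 hbw with rfl | hb'
    · rfl
    · exact absurd (hb'.trans h) h2.2.1.symm
  let π : Equiv.Perm D := Equiv.ofBijective next (Finite.injective_iff_bijective.1 hnext)
  obtain ⟨a₀, ha₀, b₀, -, -, hab⟩ := hreg v₀ hv₀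
  let d₀ : D := ⟨(v₀, a₀), hv₀, ha₀, hsymm _ _ ((hab a₀).2 (Or.inl rfl))⟩
  let c : ℤ → V := fun k => ((π ^ k) d₀).1.1
  have hstep : ∀ k : ℤ, (π ^ (k + 1)) d₀ = next ((π ^ k) d₀) := by
    intro k
    rw [add_comm, zpow_add, zpow_one]
    rfl
  have hsnd : ∀ k, ((π ^ k) d₀).1.2 = c (k + 1) := by
    intro k
    simp only [c, hstep, next]
  have hcS : ∀ k, c k ∈ S := fun k => ((π ^ k) d₀).2.1
  have hadj1 : ∀ k, adj (c (k + 1)) (c k) := by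
    intro k
    rw [← hsnd]
    exact ((π ^ k) d₀).2.2.2
  have hspec : ∀ k, c (k + 1) ≠ c (k - 1) ∧ ∀ w, adj (c k) w ↔ w = c (k + 1) ∨ w = c (k - 1) := by
    intro k
    have h1 : c k = ((π ^ (k - 1)) d₀).1.2 := by rw [hsnd, sub_add_cancel]
    have h2 : c (k + 1) = o (c k) (c (k - 1)) := by
      rw [← hsnd, h1]
      conv_lhs => rw [show k = (k - 1) + 1 by ring, hstep]
    have h3 := ho (c k) (hcS k) (c (k - 1)) (by simpa using hadj1 (k - 1))
    rw [h2]
    exact ⟨h3.2.1, fun w => (h3.2.2 w).trans or_comm⟩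
  have hd : ∀ i j, c i = c j → c (i + 1) = c (j + 1) → (π ^ i) d₀ = (π ^ j) d₀ := by
    intro i j h1 h2
    rw [← hsnd, ← hsnd] at h2
    exact Subtype.ext (Prod.ext h1 h2)
  -- Once the walk retraces itself in the opposite direction, it does so forever.
  have hrefl : ∀ i j, c i = c j → c (i + 1) = c (j - 1) →
      ∀ k : ℕ, c (i + k) = c (j - k) ∧ c (i + k + 1) = c (j - k - 1) := by
    intro i j hij hrev k
    induction k with
    | zero => simpa using ⟨hij, hrev⟩
    | succ k ih =>
      have e1 : i + ((k + 1 : ℕ) : ℤ) = i + k + 1 := by push_cast; ring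
      have e2 : j - ((k + 1 : ℕ) : ℤ) = j - k - 1 := by push_cast; ring
      rw [e1, e2]
      refine ⟨ih.2, ?_⟩
      have h1 := (hspec (j - k - 1)).2 (c (i + k + 1 + 1))
      rw [← ih.2, hspec _ |>.2] at h1
      rcases h1.1 (Or.inl rfl) with h | h
      · exfalso
        rw [sub_add_cancel, ← ih.1] at h
        exact (hspec (i + k + 1)).1 (by rw [h]; congr 1; ring)
      · exact h
  -- At the middle of a retraced stretch there would be either a vertex whose two neighbors coincide
  -- or a loop, according to the parity of k.
  have key : ∀ k : ℕ, ∀ i j : ℤ, i + k = j → c i = c j → c (i + 1) ≠ c (j - 1) := by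
    intro k i j hjk hij hrev
    have hr := hrefl i j hij hrev
    rcases Nat.even_or_odd' k with ⟨m, rfl | rfl⟩
    · rcases m with _ | m
      · have := (hr 0).2
        simp only [← hjk] at this
        exact (hspec i).1 (by simpa using this)
      · have := (hr m).1
        rw [← hjk] at this
        refine (hspec (i + m + 1)).1 ?_
        rw [show i + (m : ℤ) + 1 - 1 = i + m by ring, this]
        congr 1
        push_cast
        ring
    · have := (hr m).1
      rw [← hjk] at this
      have h2 := hadj1 (i + m)
      rw [this, show i + (m : ℤ) + 1 = i + ((2 * m + 1 : ℕ) : ℤ) - m by push_cast; ring] at h2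
      exact hirr _ h2
  have hnone : ∀ i j, c i = c j → c (i + 1) ≠ c (j - 1) := by
    intro i j hij hrev
    rcases le_total i j with h | h
    · obtain ⟨k, hk⟩ := Int.le.dest h
      exact key k i j hk hij hrev
    · obtain ⟨k, hk⟩ := Int.le.dest h
      refine key k j i hk hij.symm ?_
      have h1 := (hspec i).2 (c (j + 1))
      rw [hij, (hspec j).2] at h1
      refine (h1.1 (Or.inl rfl)).resolve_left fun h => ?_
      rw [hrev] at h
      exact (hspec j).1 h
  have hinj : ∀ i j, c i = c j → (π ^ i) d₀ = (π ^ j) d₀ := by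
    intro i j hij
    refine hd i j hij ?_
    have h1 := (hspec j).2 (c (i + 1))
    rw [← hij, (hspec i).2] at h1
    exact (h1.1 (Or.inl rfl)).resolve_right (hnone i j hij)
  set n := Function.minimalPeriod π d₀ with hn
  have hdvd : ∀ i j, c i = c j ↔ (n : ℤ) ∣ i - j := by
    intro i j
    have hz : (π ^ i) d₀ = (π ^ j) d₀ ↔ (n : ℤ) ∣ i - j := by
      have h := MulAction.zpow_smul_eq_iff_minimalPeriod_dvd (a := π) (b := d₀) (n := -j + i)
      rw [zpow_add, zpow_neg, mul_smul, inv_smul_eq_iff, neg_add_eq_sub] at h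
      exact h
    exact ⟨fun h => hz.1 (hinj i j h), fun h => congrArg (fun d : D => d.1.1) (hz.2 h)⟩
  have hn0 : 0 < n := Function.minimalPeriod_pos_of_mem_periodicPts
    (π.injective.mem_periodicPts d₀)
  refine ⟨n, ?_, c, rfl, hcS, hdvd, fun i => (hspec i).2⟩
  -- Period 1 is a loop, period 2 makes the two neighbors of a vertex coincide, and period 3 is a
  -- triangle.
  by_contra! hlt
  have h10 := hadj1 0
  have h21 := hadj1 1
  have h32 := hadj1 2
  norm_num at h10 h21 h32
  interval_cases n
  · exact hirr _ (by have := (hdvd 1 0).2 (by norm_num); rwa [this] at h10)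
  · have := (hdvd 1 (-1)).2 (by norm_num)
    exact (hspec 0).1 (by simpa using this)
  · have := (hdvd 3 0).2 (by norm_num)
    rw [this] at h32
    exact htri _ _ _ h32 h21 (hsymm _ _ h10)

/-! ### Polar coordinates adapted to a regular polygon -/

namespace PolygonCone

open Real

/-- `ρ sin (θ - β)`, where `(ρ, θ)` are the polar coordinates of `(x, y)`. -/
def height (β x y : ℝ) : ℝ := y * cos β - x * sin β

/-- The coordinates of a point of the plane with respect to the cones spanned by consecutive
vertices `(cos (2πi/n), sin (2πi/n))` of a regular polygon. -/
def coord (n : ℕ) (i : ℤ) (x y : ℝ) : ℝ :=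
  max 0 (min (height ((i - 1) * (2 * π / n)) x y) (-height ((i + 1) * (2 * π / n)) x y)) /
    sin (2 * π / n)

variable {n : ℕ}

theorem angle_pos (hn : 4 ≤ n) : 0 < 2 * π / n := by
  have : (0 : ℝ) < n := by exact_mod_cast (by omega : 0 < n)
  positivity

theorem angle_le (hn : 4 ≤ n) : 2 * π / n ≤ π / 2 := by
  have h4 : (4 : ℝ) ≤ n := by exact_mod_cast hn
  rw [div_le_div_iff₀ (by linarith) (by norm_num)]
  nlinarith [pi_pos]

theorem mul_angle (hn : 4 ≤ n) : (n : ℝ) * (2 * π / n) = 2 * π := by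
  have : (n : ℝ) ≠ 0 := by exact_mod_cast (by omega : n ≠ 0)
  field_simp

theorem sin_angle_pos (hn : 4 ≤ n) : 0 < sin (2 * π / n) :=
  sin_pos_of_pos_of_lt_pi (angle_pos hn) (by linarith [angle_le hn, pi_pos])

theorem coord_nonneg (hn : 4 ≤ n) (i : ℤ) (x y : ℝ) : 0 ≤ coord n i x y :=
  div_nonneg (le_max_left _ _) (sin_angle_pos hn).le

theorem continuous_coord (n : ℕ) (i : ℤ) : Continuous fun p : ℝ × ℝ => coord n i p.1 p.2 := by
  unfold coord height
  fun_prop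

theorem angle_add_mul (hn : 4 ≤ n) (i k : ℤ) :
    ((i + n * k : ℤ) : ℝ) * (2 * π / n) = i * (2 * π / n) + k * (2 * π) := by
  push_cast
  linear_combination (k : ℝ) * mul_angle hn

theorem cos_eq_of_dvd (hn : 4 ≤ n) {i j : ℤ} (h : (n : ℤ) ∣ i - j) :
    cos (i * (2 * π / n)) = cos (j * (2 * π / n)) := by
  obtain ⟨k, hk⟩ := h
  rw [show i = j + n * k by linarith, angle_add_mul hn, cos_add_int_mul_two_pi]

theorem sin_eq_of_dvd (hn : 4 ≤ n) {i j : ℤ} (h : (n : ℤ) ∣ i - j) :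
    sin (i * (2 * π / n)) = sin (j * (2 * π / n)) := by
  obtain ⟨k, hk⟩ := h
  rw [show i = j + n * k by linarith, angle_add_mul hn, sin_add_int_mul_two_pi]

theorem coord_eq_of_dvd (hn : 4 ≤ n) {i j : ℤ} (h : (n : ℤ) ∣ i - j) (x y : ℝ) :
    coord n i x y = coord n j x y := by
  have h1 : (n : ℤ) ∣ (i - 1) - (j - 1) := by rwa [sub_sub_sub_cancel_right]
  have h2 : (n : ℤ) ∣ (i + 1) - (j + 1) := by rwa [add_sub_add_right_eq_sub]
  have e1 := cos_eq_of_dvd hn h1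
  have e2 := sin_eq_of_dvd hn h1
  have e3 := cos_eq_of_dvd hn h2
  have e4 := sin_eq_of_dvd hn h2
  push_cast at e1 e2 e3 e4
  simp only [coord, height, e1, e2, e3, e4]

theorem height_combination (a b φ ψ β : ℝ) :
    height β (a * cos φ + b * cos ψ) (a * sin φ + b * sin ψ) = a * sin (φ - β) + b * sin (ψ - β) := by
  rw [height, sin_sub, sin_sub]
  ring

/-- By rotational symmetry the formula depends only on the offset k between the vertex and the
sector containing the point. -/
theorem coord_combination (n : ℕ) {a b : ℝ} (i k : ℤ) :
    coord n (i + k) (a * cos (i * (2 * π / n)) + b * cos ((i + 1) * (2 * π / n)))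
      (a * sin (i * (2 * π / n)) + b * sin ((i + 1) * (2 * π / n))) =
    max 0 (min (a * sin ((1 - k) * (2 * π / n)) + b * sin ((2 - k) * (2 * π / n)))
      (a * sin ((k + 1) * (2 * π / n)) + b * sin (k * (2 * π / n)))) / sin (2 * π / n) := by
  rw [coord, height_combination, height_combination, neg_add, ← mul_neg, ← mul_neg, ← sin_neg,
    ← sin_neg]
  push_cast
  ring_nf

/-- With angle α = 2π/n, the bound n ≥ 4 gives sin 2α ≥ 0, so the minimum is attained by the height
a sin α. -/
theorem coord_left (hn : 4 ≤ n) {a b : ℝ} (ha : 0 ≤ a) (hb : 0 ≤ b) (i : ℤ) :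
    coord n i (a * cos (i * (2 * π / n)) + b * cos ((i + 1) * (2 * π / n)))
      (a * sin (i * (2 * π / n)) + b * sin ((i + 1) * (2 * π / n))) = a := by
  have h := coord_combination n (a := a) (b := b) i 0
  have hs := sin_angle_pos hn
  have hs2 : 0 ≤ sin (2 * (2 * π / n)) :=
    sin_nonneg_of_nonneg_of_le_pi (by linarith [angle_pos hn]) (by linarith [angle_le hn])
  rw [add_zero] at h
  rw [h]
  simp only [Int.cast_zero, sub_zero, one_mul, zero_add, zero_mul, sin_zero, mul_zero, add_zero]
  rw [min_eq_right (by nlinarith), max_eq_right (by positivity), mul_div_cancel_right₀ _ hs.ne']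

theorem coord_right (hn : 4 ≤ n) {a b : ℝ} (ha : 0 ≤ a) (hb : 0 ≤ b) (i : ℤ) :
    coord n (i + 1) (a * cos (i * (2 * π / n)) + b * cos ((i + 1) * (2 * π / n)))
      (a * sin (i * (2 * π / n)) + b * sin ((i + 1) * (2 * π / n))) = b := by
  have h := coord_combination n (a := a) (b := b) i 1
  have hs := sin_angle_pos hn
  have hs2 : 0 ≤ sin (2 * (2 * π / n)) :=
    sin_nonneg_of_nonneg_of_le_pi (by linarith [angle_pos hn]) (by linarith [angle_le hn])
  rw [h]
  norm_num
  rw [min_eq_left (by nlinarith), max_eq_right (by positivity), mul_div_cancel_right₀ _ hs.ne']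

theorem coord_other (hn : 4 ≤ n) {a b : ℝ} (ha : 0 ≤ a) (hb : 0 ≤ b) (i j : ℤ)
    (h0 : ¬ (n : ℤ) ∣ j - i) (h1 : ¬ (n : ℤ) ∣ j - (i + 1)) :
    coord n j (a * cos (i * (2 * π / n)) + b * cos ((i + 1) * (2 * π / n)))
      (a * sin (i * (2 * π / n)) + b * sin ((i + 1) * (2 * π / n))) = 0 := by
  have hn0 : (0 : ℤ) < n := by omega
  set k := (j - i) % n with hk
  have hkn : k < n := Int.emod_lt_of_pos _ hn0
  have hk0 : 0 ≤ k := Int.emod_nonneg _ hn0.ne'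
  have hdvd : (n : ℤ) ∣ j - (i + k) := by
    rw [show j - (i + k) = (j - i) - k by ring]
    exact Int.dvd_self_sub_emod
  have hk2 : 2 ≤ k := by
    by_contra! hlt
    have : k = 0 ∨ k = 1 := by omega
    rcases this with h | h
    · rw [h, add_zero] at hdvd
      exact h0 hdvd
    · rw [h] at hdvd
      exact h1 hdvd
  rw [coord_eq_of_dvd hn hdvd, coord_combination]
  have hα := angle_pos hn
  have hnα := mul_angle hn
  set α := 2 * π / n
  have hkR : (2 : ℝ) ≤ k := by exact_mod_cast hk2
  have hknR : (k : ℝ) + 1 ≤ n := by exact_mod_cast hkn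
  rw [max_eq_left, zero_div]
  -- At offset k from 2 to n - 1, one of the two heights is nonpositive; which one depends on the
  -- side of the half turn.
  rcases le_total (((k : ℝ) - 1) * α) π with h | h
  · refine (min_le_left _ _).trans ?_
    have s1 : 0 ≤ sin ((k - 1) * α) := sin_nonneg_of_nonneg_of_le_pi (by nlinarith) h
    have s2 : 0 ≤ sin ((k - 2) * α) := sin_nonneg_of_nonneg_of_le_pi (by nlinarith) (by nlinarith)
    have e1 : sin ((1 - k) * α) = -sin ((k - 1) * α) := by rw [← sin_neg]; ring_nf
    have e2 : sin ((2 - k) * α) = -sin ((k - 2) * α) := by rw [← sin_neg]; ring_nf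
    rw [e1, e2]
    nlinarith
  · refine (min_le_right _ _).trans ?_
    have s1 : sin ((k + 1) * α) ≤ 0 := by
      rw [← sin_sub_two_pi]
      exact sin_nonpos_of_nonpos_of_neg_pi_le (by nlinarith) (by nlinarith)
    have s2 : sin (k * α) ≤ 0 := by
      rw [← sin_sub_two_pi]
      exact sin_nonpos_of_nonpos_of_neg_pi_le (by nlinarith) (by nlinarith)
    nlinarith

/-- The sector is found by rounding down the argument, and the coefficients come from the sine rule
in the triangle on the two bounding rays. -/
theorem exists_combination (hn : 4 ≤ n) (x y : ℝ) : ∃ (i : ℤ) (a b : ℝ), 0 ≤ a ∧ 0 ≤ b ∧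
    x = a * cos (i * (2 * π / n)) + b * cos ((i + 1) * (2 * π / n)) ∧
    y = a * sin (i * (2 * π / n)) + b * sin ((i + 1) * (2 * π / n)) := by
  have hα := angle_pos hn
  have hαl := angle_le hn
  have hs := sin_angle_pos hn
  set α := 2 * π / n
  set z : ℂ := ⟨x, y⟩
  have hx : x = ‖z‖ * cos z.arg := (Complex.norm_mul_cos_arg z).symm
  have hy : y = ‖z‖ * sin z.arg := (Complex.norm_mul_sin_arg z).symm
  set i := ⌊z.arg / α⌋ with hi
  set φ := z.arg - i * α with hφ
  have h1 : (i : ℝ) * α ≤ z.arg := by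
    rw [← le_div_iff₀ hα]
    exact Int.floor_le _
  have h2 : z.arg < (i + 1) * α := by
    rw [← div_lt_iff₀ hα]
    exact Int.lt_floor_add_one _
  have hφ0 : 0 ≤ φ := by linarith
  have hφα : φ ≤ α := by nlinarith
  have harg : z.arg = i * α + φ := by rw [hφ]; ring
  refine ⟨i, ‖z‖ * sin (α - φ) / sin α, ‖z‖ * sin φ / sin α, ?_, ?_, ?_, ?_⟩
  · have := sin_nonneg_of_nonneg_of_le_pi (x := α - φ) (by linarith) (by linarith [pi_pos])
    positivity
  · have := sin_nonneg_of_nonneg_of_le_pi hφ0 (by linarith [pi_pos])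
    positivity
  · rw [hx, harg, add_mul, one_mul, cos_add, cos_add, sin_sub α φ]
    field_simp
    ring
  · rw [hy, harg, add_mul, one_mul, sin_add, sin_add, sin_sub α φ]
    field_simp
    ring

theorem exists_range_dvd (hn : 4 ≤ n) (i : ℤ) : ∃ j ∈ Finset.range n, (n : ℤ) ∣ (j : ℤ) - i := by
  have hn0 : (0 : ℤ) < n := by omega
  refine ⟨(i % n).toNat, ?_, ?_⟩
  · have := Int.emod_lt_of_pos i hn0
    have := Int.emod_nonneg i hn0.ne'
    rw [Finset.mem_range]
    omega
  · rw [Int.toNat_of_nonneg (Int.emod_nonneg i hn0.ne'), dvd_sub_comm]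
    exact Int.dvd_self_sub_emod

theorem eq_of_mem_range_of_dvd {j k : ℕ} (hj : j ∈ Finset.range n) (hk : k ∈ Finset.range n)
    (h : (n : ℤ) ∣ (j : ℤ) - k) : j = k := by
  rw [Finset.mem_range] at hj hk
  have := Int.eq_zero_of_abs_lt_dvd h (by rw [abs_lt]; omega)
  omega

theorem sum_range_periodic (hn : 4 ≤ n) {f : ℤ → ℝ} (hf : ∀ i j, (n : ℤ) ∣ i - j → f i = f j)
    (i : ℤ) (h0 : ∀ j, ¬ (n : ℤ) ∣ j - i → ¬ (n : ℤ) ∣ j - (i + 1) → f j = 0) :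
    ∑ j ∈ Finset.range n, f j = f i + f (i + 1) := by
  obtain ⟨j, hj, hji⟩ := exists_range_dvd hn i
  obtain ⟨k, hk, hki⟩ := exists_range_dvd hn (i + 1)
  rw [← hf _ _ hji, ← hf _ _ hki]
  refine Finset.sum_eq_add j k ?_ ?_ (fun h => absurd hj h) (fun h => absurd hk h)
  · rintro rfl
    have := dvd_sub hji hki
    rw [sub_sub_sub_cancel_left, add_sub_cancel_left] at this
    have := Int.le_of_dvd one_pos this
    omega
  · intro l hl hne
    refine h0 l (fun h => hne.1 ?_) fun h => hne.2 ?_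
    · exact eq_of_mem_range_of_dvd hl hj (by have := dvd_sub h hji; rwa [sub_sub_sub_cancel_right] at this)
    · exact eq_of_mem_range_of_dvd hl hk (by have := dvd_sub h hki; rwa [sub_sub_sub_cancel_right] at this)

/-- The left side extends u from the polygon vertices linearly over each sector. Taking the cosines
and sines of the vertex angles for u returns x and y, so the coordinates determine the point. -/
theorem sum_coord_mul (hn : 4 ≤ n) (x y : ℝ) {u : ℤ → ℝ} (hu : ∀ i j, (n : ℤ) ∣ i - j → u i = u j)
    {i : ℤ} {a b : ℝ} (ha : 0 ≤ a) (hb : 0 ≤ b)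
    (hx : x = a * cos (i * (2 * π / n)) + b * cos ((i + 1) * (2 * π / n)))
    (hy : y = a * sin (i * (2 * π / n)) + b * sin ((i + 1) * (2 * π / n))) :
    ∑ j ∈ Finset.range n, coord n j x y * u j = a * u i + b * u (i + 1) := by
  rw [sum_range_periodic hn (f := fun j => coord n j x y * u j) ?_ i ?_]
  · subst hx hy
    rw [coord_left hn ha hb, coord_right hn ha hb]
  · intro i j hij
    rw [coord_eq_of_dvd hn hij, hu i j hij]
  · intro j h0 h1
    subst hx hy
    rw [coord_other hn ha hb i j h0 h1, zero_mul]

theorem sum_coord_mul_cos (hn : 4 ≤ n) (x y : ℝ) :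
    ∑ j ∈ Finset.range n, coord n j x y * cos (j * (2 * π / n)) = x := by
  obtain ⟨i, a, b, ha, hb, hx, hy⟩ := exists_combination hn x y
  have h := sum_coord_mul hn x y (u := fun j => cos (j * (2 * π / n)))
    (fun i j hij => cos_eq_of_dvd hn hij) ha hb hx hy
  push_cast at h
  rw [h, ← hx]

theorem sum_coord_mul_sin (hn : 4 ≤ n) (x y : ℝ) :
    ∑ j ∈ Finset.range n, coord n j x y * sin (j * (2 * π / n)) = y := by
  obtain ⟨i, a, b, ha, hb, hx, hy⟩ := exists_combination hn x y
  have h := sum_coord_mul hn x y (u := fun j => sin (j * (2 * π / n)))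
    (fun i j hij => sin_eq_of_dvd hn hij) ha hb hx hy
  push_cast at h
  rw [h, ← hy]

/-! ### Coordinates on the cone over an abstract cycle. -/

variable {V : Type*} [DecidableEq V]

/-- The coordinates of a point of the plane, seen as the cone over the cycle `c` of length `n`. -/
def cycleCoord (n : ℕ) (c : ℤ → V) (x y : ℝ) (v : V) : ℝ :=
  ∑ j ∈ Finset.range n, if c (j : ℤ) = v then coord n j x y else 0

theorem cycleCoord_apply (hn : 4 ≤ n) {c : ℤ → V} (hc : ∀ i j, c i = c j ↔ (n : ℤ) ∣ i - j)
    (x y : ℝ) (i : ℤ) : cycleCoord n c x y (c i) = coord n i x y := by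
  obtain ⟨j, hj, hji⟩ := exists_range_dvd hn i
  have hcj : c j = c i := (hc _ _).2 hji
  rw [← coord_eq_of_dvd hn hji, ← hcj, cycleCoord, Finset.sum_eq_single j]
  · simp
  · intro k hk hkj
    rw [if_neg]
    exact fun h => hkj (eq_of_mem_range_of_dvd hk hj ((hc _ _).1 h))
  · exact fun h => absurd hj h

theorem cycleCoord_eq_zero (n : ℕ) {c : ℤ → V} (x y : ℝ) {v : V} (hv : ∀ i, v ≠ c i) :
    cycleCoord n c x y v = 0 :=
  Finset.sum_eq_zero fun j _ => if_neg fun h => hv j h.symm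

theorem cycleCoord_nonneg (hn : 4 ≤ n) (c : ℤ → V) (x y : ℝ) (v : V) : 0 ≤ cycleCoord n c x y v :=
  Finset.sum_nonneg fun j _ => by
    split_ifs
    exacts [coord_nonneg hn _ _ _, le_rfl]

theorem continuous_cycleCoord (n : ℕ) (c : ℤ → V) (v : V) :
    Continuous fun p : ℝ × ℝ => cycleCoord n c p.1 p.2 v :=
  continuous_finsetSum _ fun j _ => by
    split_ifs
    exacts [continuous_coord n j, continuous_const]

theorem mem_image_of_cycleCoord_ne_zero {c : ℤ → V} {x y : ℝ} {v : V}
    (hv : cycleCoord n c x y v ≠ 0) : v ∈ (Finset.range n).image fun j : ℕ => c j := by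
  by_contra h
  simp only [Finset.mem_image, not_exists, not_and] at h
  exact hv (Finset.sum_eq_zero fun j hj => if_neg (h j hj))

theorem exists_consecutive (hn : 4 ≤ n) {c : ℤ → V} (hc : ∀ i j, c i = c j ↔ (n : ℤ) ∣ i - j)
    (x y : ℝ) : ∃ i, ∀ v, cycleCoord n c x y v ≠ 0 → v = c i ∨ v = c (i + 1) := by
  obtain ⟨i, a, b, ha, hb, hx, hy⟩ := exists_combination hn x y
  refine ⟨i, fun v hv => ?_⟩
  by_contra! hne
  obtain ⟨j, -, rfl⟩ := Finset.mem_image.1 (mem_image_of_cycleCoord_ne_zero hv)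
  rw [cycleCoord_apply hn hc, hx, hy] at hv
  exact hv (coord_other hn ha hb i j (fun hd => hne.1 ((hc _ _).2 hd))
    fun hd => hne.2 ((hc _ _).2 hd))

end PolygonCone

end

noncomputable section

/-! ### Triangulated three-manifolds -/

namespace PreAbstractSimplicialComplex

open Topology Set

variable {V : Type*} {X : PreAbstractSimplicialComplex V}

/-- A family of points of the realization given by continuous homogeneous coordinates. -/
theorem exists_point_family {Z : Type*} [TopologicalSpace Z] (A : Finset V) (f : Z → V → ℝ)
    (h0 : ∀ z v, 0 ≤ f z v) (hA : ∀ z v, f z v ≠ 0 → v ∈ A) (hne : ∀ z, ∃ v, f z v ≠ 0)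
    (hface : ∀ z, ∃ σ ∈ X.faces, ∀ v, f z v ≠ 0 → v ∈ σ)
    (hcont : ∀ v ∈ A, Continuous fun z => f z v) :
    ∃ g : Z → X.Realization, Continuous g ∧ (∀ z v, v ∈ (g z).1.support ↔ f z v ≠ 0) ∧
      ∀ z v w, (g z).1 v / (g z).1 w = f z v / f z w := by
  have hmem : ∀ z v, v ∈ (Finsupp.onFinset A (f z) (hA z)).support ↔ f z v ≠ 0 := fun z v =>
    Finsupp.mem_support_iff
  have hX : ∀ z, (Finsupp.onFinset A (f z) (hA z)).support ∈ X.faces := by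
    intro z
    obtain ⟨σ, hσ, hsub⟩ := hface z
    obtain ⟨v, hv⟩ := hne z
    exact mem_faces_of_subset hσ (fun w hw => hsub w ((hmem z w).1 hw)) ⟨v, (hmem z v).2 hv⟩
  refine ⟨fun z => X.normalize (Finsupp.onFinset A (f z) (hA z)) (h0 z) (hX z), ?_, ?_, ?_⟩
  · exact continuous_normalize h0 hX A (fun z v hv => hA z v ((hmem z v).1 hv)) hcont
  · exact fun z v => (Finset.ext_iff.1 (support_normalize (h0 z) (hX z)) v).trans (hmem z v)
  · exact fun z v w => normalize_div _ _ v w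

theorem exists_point_support_eq {σ : Finset V} (hσ : σ ∈ X.faces) :
    ∃ p : X.Realization, p.1.support = σ := by
  classical
  obtain ⟨v₀, hv₀⟩ := nonempty_of_mem_faces hσ
  obtain ⟨g, -, hg, -⟩ := exists_point_family (X := X) (Z := Unit) σ
    (fun _ v => if v ∈ σ then 1 else 0) (fun _ v => by split_ifs <;> norm_num)
    (fun _ v hv => by by_contra h; simp [h] at hv) (fun _ => ⟨v₀, by simp [hv₀]⟩)
    (fun _ => ⟨σ, hσ, fun v hv => by by_contra h; simp [h] at hv⟩) fun v _ => continuous_const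
  exact ⟨g (), Finset.ext fun v => by rw [hg]; simp⟩

theorem coord_pos_iff (x : X.Realization) (v : V) : 0 < x.1 v ↔ v ∈ x.1.support := by
  rw [Finsupp.mem_support_iff]
  exact ⟨ne_of_gt, fun h => lt_of_le_of_ne (x.2.1 v) h.symm⟩

theorem sum_eq_one_of_subset (x : X.Realization) {A : Finset V} (h : x.1.support ⊆ A) :
    ∑ v ∈ A, x.1 v = 1 :=
  (Finsupp.sum_of_support_subset _ h _ fun _ _ => rfl).symm.trans x.2.2.1

/-- Euclidean three-space. -/
abbrev E3 := EuclideanSpace ℝ (Fin 3)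

/-! ### Local structure of triangulated 3-manifolds, by invariance of domain. -/

variable {N : Type*} [TopologicalSpace N] [ChartedSpace E3 N]

/-- By invariance of domain the image of g is open, so it enters the interior of every simplex
having g(x) in its closure. An explicit g with few supports thereby limits the simplices around a
given one. -/
theorem exists_support_eq_of_injective (h : X.Realization ≃ₜ N) {g : E3 → X.Realization} (hg : Continuous g)
    (hinj : Function.Injective g) (x : E3) {σ : Finset V} (hσ : σ ∈ X.faces)
    (hx : (g x).1.support ⊆ σ) : ∃ y, (g y).1.support = σ := by
  have hO : IsOpen (h ∘ g '' univ) := InvarianceOfDomain.isOpen_image_chartedSpace isOpen_univ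
    (h.continuous.comp hg).continuousOn (h.injective.comp hinj).injOn
  have hO' : IsOpen (range g) := by
    have := hO.preimage h.continuous
    rwa [image_univ, range_comp, h.preimage_image] at this
  obtain ⟨q, ⟨y, rfl⟩, hq⟩ := exists_mem_support_eq hO' ⟨x, rfl⟩ hσ hx
  exact ⟨y, hq⟩

/-- The image would be open in three-space by invariance of domain, but moving down from a boundary
point leaves the half-space. This excludes simplices with too few cofaces. -/
theorem false_of_injOn_halfspace (h : X.Realization ≃ₜ N) {U : Set X.Realization} (hU : IsOpen U) {F : X.Realization → E3}
    (hF : ContinuousOn F U) (hinj : InjOn F U) (hnn : ∀ x ∈ U, 0 ≤ F x 2) {p : X.Realization}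
    (hp : p ∈ U) (hp0 : F p 2 = 0) : False := by
  have hO : IsOpen (F ∘ h.symm '' (h.symm ⁻¹' U)) :=
    InvarianceOfDomain.isOpen_image_of_chartedSpace (hU.preimage h.symm.continuous)
      (hF.comp h.symm.continuous.continuousOn fun y hy => hy)
      (hinj.comp h.symm.injective.injOn fun y hy => hy)
  have hmem : F p ∈ F ∘ h.symm '' (h.symm ⁻¹' U) := ⟨h p, by simpa using hp, by simp⟩
  let γ : ℝ → E3 := fun ε => F p - ε • EuclideanSpace.single 2 (1 : ℝ)
  have hγ : Continuous γ := by fun_prop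
  have hev : ∀ᶠ ε in 𝓝[>] (0 : ℝ), γ ε ∈ F ∘ h.symm '' (h.symm ⁻¹' U) :=
    (hγ.tendsto 0).mono_left nhdsWithin_le_nhds (hO.mem_nhds (by simpa [γ] using hmem))
  obtain ⟨ε, ⟨y, hy, hyε⟩, hε⟩ := (hev.and self_mem_nhdsWithin).exists
  have h1 := hnn _ hy
  rw [Function.comp_apply] at hyε
  rw [hyε] at h1
  simp only [γ, PiLp.sub_apply, PiLp.smul_apply, PiLp.single_apply, hp0] at h1
  have hε' : 0 < ε := hε
  norm_num at h1
  linarith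

variable [DecidableEq V]

/-- The open tetrahedron is already a copy of three-space, hence open, and a larger simplex would
have interior points arbitrarily close to it. -/
theorem eq_of_subset_of_card_four (h : X.Realization ≃ₜ N) {τ σ : Finset V} (hτ : τ.card = 4) (hσ : σ ∈ X.faces)
    (hsub : τ ⊆ σ) : σ = τ := by
  have hτX : τ ∈ X.faces := mem_faces_of_subset hσ hsub (Finset.card_pos.1 (by omega))
  obtain ⟨a, b, c, d, hab, hac, had, hbc, hbd, hcd, rfl⟩ := Finset.card_eq_four.1 hτ
  obtain ⟨g, hg, hsupp, hdiv⟩ := exists_point_family (X := X) (Z := E3) {a, b, c, d}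
    -- Homogeneous coordinates with that of d normalized to 1: the logarithms of the other three are
    -- free.
    (fun x v => if v = a then Real.exp (x 0) else if v = b then Real.exp (x 1) else
      if v = c then Real.exp (x 2) else if v = d then 1 else 0)
    (fun x v => by split_ifs <;> positivity)
    (fun x v hv => by by_contra hv'; simp at hv'; simp [hv'] at hv)
    (fun x => ⟨a, by simp [Real.exp_ne_zero]⟩)
    (fun x => ⟨_, hτX, fun v hv => by by_contra hv'; simp at hv'; simp [hv'] at hv⟩)
    (fun v _ => by split_ifs <;> fun_prop)
  have hinj : Function.Injective g := by
    intro x y hxy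
    have e : ∀ v w, _ := fun v w => (hdiv x v w).symm.trans (hxy ▸ hdiv y v w)
    have e0 := e a d
    have e1 := e b d
    have e2 := e c d
    simp [hab.symm, hac.symm, had.symm, hbc.symm, hbd.symm, hcd.symm] at e0 e1 e2
    ext i
    fin_cases i <;> assumption
  obtain ⟨y, hy⟩ := exists_support_eq_of_injective h hg hinj 0 hσ
    (fun v hv => hsub (by
      rw [hsupp] at hv
      by_contra hv'
      simp at hv'
      simp [hv'] at hv))
  rw [← hy]
  refine Finset.Subset.antisymm (fun v hv => ?_) (hy ▸ hsub)
  rw [hsupp] at hv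
  by_contra hv'
  simp at hv'
  simp [hv'] at hv

theorem card_le_four (h : X.Realization ≃ₜ N) {σ : Finset V} (hσ : σ ∈ X.faces) : σ.card ≤ 4 := by
  by_contra! hlt
  obtain ⟨τ, hτσ, hτ⟩ := Finset.exists_subset_card_eq (show 4 ≤ σ.card by omega)
  have := eq_of_subset_of_card_four h hτ hσ hτσ
  rw [this] at hlt
  omega

/-- Two open tetrahedra glued along the open triangle already form a copy of three-space, which
leaves no room for a third one. -/
theorem eq_or_eq_of_triangle (h : X.Realization ≃ₜ N) {a b c : V} (hab : a ≠ b) (hac : a ≠ c) (hbc : b ≠ c) {d₁ d₂ d₃ : V}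
    (h12 : d₁ ≠ d₂)
    (h1 : d₁ ∉ ({a, b, c} : Finset V)) (h2 : d₂ ∉ ({a, b, c} : Finset V))
    (h3 : d₃ ∉ ({a, b, c} : Finset V)) (hd1 : insert d₁ ({a, b, c} : Finset V) ∈ X.faces)
    (hd2 : insert d₂ ({a, b, c} : Finset V) ∈ X.faces)
    (hd3 : insert d₃ ({a, b, c} : Finset V) ∈ X.faces) : d₃ = d₁ ∨ d₃ = d₂ := by
  simp only [Finset.mem_insert, Finset.mem_singleton, not_or] at h1 h2 h3
  by_contra hne
  rw [not_or] at hne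
  obtain ⟨g, hg, hsupp, hdiv⟩ := exists_point_family (X := X) (Z := E3) {a, b, c, d₁, d₂}
    -- The sign of the last coordinate selects the tetrahedron, and its absolute value is the weight
    -- of the fourth vertex.
    (fun x v => if v = a then Real.exp (x 0) else if v = b then Real.exp (x 1) else
      if v = c then 1 else if v = d₁ then max (x 2) 0 else if v = d₂ then max (-x 2) 0 else 0)
    (fun x v => by split_ifs <;> positivity)
    (fun x v hv => by by_contra hv'; simp at hv'; simp [hv'] at hv)
    (fun x => ⟨a, by simp [Real.exp_ne_zero]⟩)
    (fun x => by
      rcases le_total 0 (x 2) with hx | hx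
      · refine ⟨_, hd1, fun v hv => ?_⟩
        by_contra hv'
        simp at hv'
        simp [hv', hx] at hv
      · refine ⟨_, hd2, fun v hv => ?_⟩
        by_contra hv'
        simp at hv'
        simp [hv', hx] at hv)
    (fun v _ => by split_ifs <;> fun_prop)
  have hinj : Function.Injective g := by
    intro x y hxy
    have e : ∀ v w, _ := fun v w => (hdiv x v w).symm.trans (hxy ▸ hdiv y v w)
    have e0 := e a c
    have e1 := e b c
    have e2 := e d₁ c
    have e3 := e d₂ c
    simp [hab.symm, hac.symm, hbc.symm, h1.1, h1.2.1, h1.2.2, h2.1, h2.2.1, h2.2.2,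
      h12.symm] at e0 e1 e2 e3
    have e4 : x 2 = y 2 := by
      have hx := max_zero_sub_eq_self (x 2)
      have hy := max_zero_sub_eq_self (y 2)
      rw [max_comm, max_comm 0] at hx hy
      rw [← hx, ← hy, e2, e3]
    ext i
    fin_cases i <;> assumption
  obtain ⟨y, hy⟩ := exists_support_eq_of_injective h hg hinj 0 hd3
    (fun v hv => by
      rw [hsupp] at hv
      by_contra hv'
      simp at hv'
      simp [hv'] at hv)
  have : d₃ ∈ (g y).1.support := by rw [hy]; simp
  rw [hsupp] at this
  simp [h3, hne] at this

/-- If d were the only possible fourth vertex, the open star of the triangle would embed in a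
half-space with the triangle on the boundary. -/
theorem exists_two_of_triangle (h : X.Realization ≃ₜ N) {a b c : V} (hab : a ≠ b) (hac : a ≠ c) (hbc : b ≠ c)
    (hX : ({a, b, c} : Finset V) ∈ X.faces) (d : V) :
    ∃ d', d' ≠ d ∧ d' ∉ ({a, b, c} : Finset V) ∧ insert d' ({a, b, c} : Finset V) ∈ X.faces := by
  by_contra! hcon
  let U : Set X.Realization := {x | 0 < x.1 a ∧ 0 < x.1 b ∧ 0 < x.1 c}
  have hU : IsOpen U := (isOpen_lt continuous_const (continuous_coord a)).inter
    ((isOpen_lt continuous_const (continuous_coord b)).inter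
      (isOpen_lt continuous_const (continuous_coord c)))
  have hsub : ∀ x ∈ U, ({a, b, c} : Finset V) ⊆ x.1.support := by
    intro x hx v hv
    simp only [Finset.mem_insert, Finset.mem_singleton] at hv
    rw [← coord_pos_iff]
    rcases hv with rfl | rfl | rfl
    exacts [hx.1, hx.2.1, hx.2.2]
  have hsupp : ∀ x ∈ U, x.1.support ⊆ insert d {a, b, c} := by
    intro x hx v hv
    by_contra hv'
    rw [Finset.mem_insert, not_or] at hv'
    refine hcon v hv'.1 hv'.2 (mem_faces_of_subset x.2.2.2 ?_ ⟨v, Finset.mem_insert_self _ _⟩)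
    exact Finset.insert_subset hv (hsub x hx)
  have hrest : ∀ x ∈ U, d ∉ ({a, b, c} : Finset V) → x.1 d = 1 - x.1 a - x.1 b - x.1 c := by
    intro x hx hd
    have := sum_eq_one_of_subset x (hsupp x hx)
    rw [Finset.sum_insert hd, Finset.sum_insert (by simp [hab, hac]),
      Finset.sum_insert (by simp [hbc]), Finset.sum_singleton] at this
    linarith
  have hle : ∀ x : X.Realization, x.1 a + x.1 b + x.1 c ≤ 1 := by
    intro x
    have h1 := sum_eq_one_of_subset x (A := x.1.support ∪ {a, b, c}) Finset.subset_union_left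
    have := Finset.sum_le_sum_of_subset_of_nonneg (f := fun v => x.1 v)
      (Finset.subset_union_right (s₁ := x.1.support) (s₂ := {a, b, c})) fun v _ _ => x.2.1 v
    rw [Finset.sum_insert (by simp [hab, hac]), Finset.sum_insert (by simp [hbc]),
      Finset.sum_singleton] at this
    linarith
  let F : X.Realization → E3 := fun x =>
    -- The last entry measures the weight outside the triangle. On U this weight is all at d, or
    -- zero if d belongs to the triangle.
    !₂[x.1 a / x.1 c, x.1 b / x.1 c, (1 - x.1 a - x.1 b - x.1 c) / x.1 c]
  obtain ⟨p, hp⟩ := exists_point_support_eq hX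
  have hpU : p ∈ U := by
    refine ⟨?_, ?_, ?_⟩ <;> rw [coord_pos_iff, hp] <;> simp
  refine false_of_injOn_halfspace h hU (F := F) ?_ ?_ ?_ (p := p) hpU ?_
  · have hc0 : ∀ v, ContinuousOn (fun x : X.Realization => x.1 v / x.1 c) U := fun v =>
      (continuous_coord v).continuousOn.div (continuous_coord c).continuousOn fun x hx => hx.2.2.ne'
    have hc1 : ContinuousOn (fun x : X.Realization => (1 - x.1 a - x.1 b - x.1 c) / x.1 c) U :=
      ((((continuous_const.sub (continuous_coord a)).sub (continuous_coord b)).sub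
        (continuous_coord c)).continuousOn).div (continuous_coord c).continuousOn
          fun x hx => hx.2.2.ne'
    refine (PiLp.continuous_toLp 2 _).comp_continuousOn (continuousOn_pi.2 fun i => ?_)
    fin_cases i
    exacts [hc0 a, hc0 b, hc1]
  · intro x hx y hy hxy
    have e0 : x.1 a / x.1 c = y.1 a / y.1 c := congrArg (fun z : E3 => z 0) hxy
    have e1 : x.1 b / x.1 c = y.1 b / y.1 c := congrArg (fun z : E3 => z 1) hxy
    have e2 : (1 - x.1 a - x.1 b - x.1 c) / x.1 c = (1 - y.1 a - y.1 b - y.1 c) / y.1 c :=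
      congrArg (fun z : E3 => z 2) hxy
    have hxc := hx.2.2
    have hyc := hy.2.2
    have ec : x.1 c = y.1 c := by
      have h1 : 1 / x.1 c = 1 / y.1 c := by
        have hx1 : 1 / x.1 c = x.1 a / x.1 c + x.1 b / x.1 c + 1 +
            (1 - x.1 a - x.1 b - x.1 c) / x.1 c := by field_simp; ring
        have hy1 : 1 / y.1 c = y.1 a / y.1 c + y.1 b / y.1 c + 1 +
            (1 - y.1 a - y.1 b - y.1 c) / y.1 c := by field_simp; ring
        rw [hx1, hy1, e0, e1, e2]
      simpa using h1
    rw [ec, div_left_inj' hyc.ne'] at e0 e1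
    refine Realization.ext fun v => ?_
    by_cases hv : v ∈ ({a, b, c} : Finset V)
    · simp only [Finset.mem_insert, Finset.mem_singleton] at hv
      rcases hv with rfl | rfl | rfl
      exacts [e0, e1, ec]
    · by_cases hvd : v = d
      · subst hvd
        rw [hrest x hx hv, hrest y hy hv, e0, e1, ec]
      · have hzero : ∀ z ∈ U, z.1 v = 0 := fun z hz => by
          by_contra hne
          have := hsupp z hz (Finsupp.mem_support_iff.2 hne)
          rw [Finset.mem_insert] at this
          exact this.elim hvd hv
        rw [hzero x hx, hzero y hy]
  · intro x hx
    have := hle x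
    exact div_nonneg (by linarith) hx.2.2.le
  · have h1 := sum_eq_one_of_subset p hp.subset
    rw [Finset.sum_insert (by simp [hab, hac]), Finset.sum_insert (by simp [hbc]),
      Finset.sum_singleton] at h1
    have : (1 - p.1 a - p.1 b - p.1 c) / p.1 c = 0 := by
      rw [show 1 - p.1 a - p.1 b - p.1 c = 0 by linarith, zero_div]
    exact this

/-- A maximal edge would have an open star that injects into a line, again inside a half-space. -/
theorem exists_of_edge (h : X.Realization ≃ₜ N) {a b : V} (hab : a ≠ b)
    (hX : ({a, b} : Finset V) ∈ X.faces) :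
    ∃ d, d ≠ a ∧ d ≠ b ∧ ({a, b, d} : Finset V) ∈ X.faces := by
  by_contra! hcon
  let U : Set X.Realization := {x | 0 < x.1 a ∧ 0 < x.1 b}
  have hU : IsOpen U := (isOpen_lt continuous_const (continuous_coord a)).inter
    (isOpen_lt continuous_const (continuous_coord b))
  have hsupp : ∀ x ∈ U, x.1.support ⊆ {a, b} := by
    intro x hx v hv
    by_contra hv'
    simp only [Finset.mem_insert, Finset.mem_singleton, not_or] at hv'
    refine hcon v hv'.1 hv'.2 (mem_faces_of_subset x.2.2.2 ?_ ⟨a, Finset.mem_insert_self _ _⟩)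
    intro w hw
    simp only [Finset.mem_insert, Finset.mem_singleton] at hw
    rcases hw with rfl | rfl | rfl
    exacts [(coord_pos_iff _ _).1 hx.1, (coord_pos_iff _ _).1 hx.2, hv]
  have hsum : ∀ x ∈ U, x.1 a + x.1 b = 1 := by
    intro x hx
    have := sum_eq_one_of_subset x (hsupp x hx)
    rwa [Finset.sum_pair hab] at this
  let F : X.Realization → E3 := fun x => !₂[x.1 a, 0, 0]
  obtain ⟨p, hp⟩ := exists_point_support_eq hX
  have hpU : p ∈ U := by
    refine ⟨?_, ?_⟩ <;> rw [coord_pos_iff, hp] <;> simp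
  refine false_of_injOn_halfspace h hU (F := F) ?_ ?_ (fun _ _ => le_rfl) (p := p) hpU rfl
  · refine (PiLp.continuous_toLp 2 _).comp_continuousOn (continuousOn_pi.2 fun i => ?_)
    fin_cases i
    exacts [(continuous_coord a).continuousOn, continuousOn_const, continuousOn_const]
  · intro x hx y hy hxy
    have e0 : x.1 a = y.1 a := congrArg (fun z : E3 => z 0) hxy
    have hx1 := hsum x hx
    have hy1 := hsum y hy
    refine Realization.ext fun v => ?_
    by_cases hv : v ∈ ({a, b} : Finset V)
    · simp only [Finset.mem_insert, Finset.mem_singleton] at hv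
      rcases hv with rfl | rfl
      · exact e0
      · linarith
    · have hzero : ∀ z ∈ U, z.1 v = 0 := fun z hz => by
        by_contra hne
        exact hv (hsupp z hz (Finsupp.mem_support_iff.2 hne))
      rw [hzero x hx, hzero y hy]

/-- A cycle in the link of an edge is the whole link. -/
theorem mem_range_of_cycle (h : X.Realization ≃ₜ N) {s t : V} (hst : s ≠ t) {n : ℕ} (hn : 4 ≤ n)
    {c : ℤ → V} (hc : ∀ i j, c i = c j ↔ (n : ℤ) ∣ i - j) (hcs : ∀ i, c i ≠ s) (hct : ∀ i, c i ≠ t)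
    (hface : ∀ i, ({s, t, c i, c (i + 1)} : Finset V) ∈ X.faces) {w : V} (hws : w ≠ s) (hwt : w ≠ t)
    (hw : ({s, t, w} : Finset V) ∈ X.faces) : ∃ i, w = c i := by
  let q : E3 → V → ℝ := fun x => PolygonCone.cycleCoord n c (x 1) (x 2)
  have hq : ∀ x i, q x (c i) = PolygonCone.coord n i (x 1) (x 2) := fun x i =>
    PolygonCone.cycleCoord_apply hn hc _ _ i
  have hq0 : ∀ x v, (∀ i, v ≠ c i) → q x v = 0 := fun x v hv =>
    PolygonCone.cycleCoord_eq_zero n _ _ hv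
  have hqnn : ∀ x v, 0 ≤ q x v := fun x v => PolygonCone.cycleCoord_nonneg hn c _ _ v
  by_contra! hcon
  -- The join of the open edge with the cone over the cycle is a copy of three-space: one parameter
  -- along the edge, two for the plane subdivided into the sectors of the cycle.
  obtain ⟨g, hg, hsupp, hdiv⟩ := exists_point_family (X := X) (Z := E3)
    ({s, t} ∪ (Finset.range n).image fun j : ℕ => c j)
    (fun x v => if v = s then Real.exp (x 0) else if v = t then 1 else q x v)
    (fun x v => by
      have := hqnn x v
      split_ifs <;> positivity)
    (fun x v hv => by
      by_contra hv'
      rw [Finset.mem_union, not_or] at hv'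
      simp only [Finset.mem_insert, Finset.mem_singleton, not_or] at hv'
      simp only [hv'.1.1, hv'.1.2, if_false] at hv
      exact hv'.2 (PolygonCone.mem_image_of_cycleCoord_ne_zero hv))
    (fun x => ⟨s, by simp [Real.exp_ne_zero]⟩)
    (fun x => by
      obtain ⟨i, hi⟩ := PolygonCone.exists_consecutive hn hc (x 1) (x 2)
      refine ⟨_, hface i, fun v hv => ?_⟩
      by_contra hv'
      simp only [Finset.mem_insert, Finset.mem_singleton, not_or] at hv'
      simp only [hv'.1, hv'.2.1, if_false] at hv
      exact (hi v hv).elim hv'.2.2.1 hv'.2.2.2)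
    (fun v _ => by
      have hqc : Continuous fun x => q x v := (PolygonCone.continuous_cycleCoord n c v).comp
        (by fun_prop : Continuous fun x : E3 => (x 1, x 2))
      split_ifs <;> fun_prop)
  have hinj : Function.Injective g := by
    intro x y hxy
    have e : ∀ v w, _ := fun v w => (hdiv x v w).symm.trans (hxy ▸ hdiv y v w)
    have e0 := e s t
    have e1 : ∀ i, PolygonCone.coord n i (x 1) (x 2) = PolygonCone.coord n i (y 1) (y 2) := by
      intro i
      have := e (c i) t
      simpa [hcs, hct, hq, hst.symm] using this
    simp [hst.symm] at e0
    have e2 : x 1 = y 1 := by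
      rw [← PolygonCone.sum_coord_mul_cos hn (x 1) (x 2),
        ← PolygonCone.sum_coord_mul_cos hn (y 1) (y 2)]
      exact Finset.sum_congr rfl fun j _ => by rw [e1]
    have e3 : x 2 = y 2 := by
      rw [← PolygonCone.sum_coord_mul_sin hn (x 1) (x 2),
        ← PolygonCone.sum_coord_mul_sin hn (y 1) (y 2)]
      exact Finset.sum_congr rfl fun j _ => by rw [e1]
    ext i
    fin_cases i <;> assumption
  obtain ⟨y, hy⟩ := exists_support_eq_of_injective h hg hinj 0 hw
    (fun v hv => by
      rw [hsupp] at hv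
      by_contra hv'
      simp only [Finset.mem_insert, Finset.mem_singleton, not_or] at hv'
      simp only [hv'.1, hv'.2.1, if_false] at hv
      refine hv (Finset.sum_eq_zero fun j _ => ?_)
      have := PolygonCone.coord_left hn le_rfl le_rfl (j : ℤ)
      simp only [zero_mul, add_zero] at this
      simp [this])
  have : w ∈ (g y).1.support := by rw [hy]; simp
  rw [hsupp] at this
  simp [hws, hwt, hq0 y w hcon] at this

/-- Any two of the five vertices lie in one of the three tetrahedra, so for a flag complex a
triangle in the link of the edge {s, t} produces a simplex with five vertices. -/
theorem mem_of_mem_insert_three {i j s t a b c : V} (hi : i ∈ ({s, t, a, b, c} : Finset V))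
    (hj : j ∈ ({s, t, a, b, c} : Finset V)) :
    (i ∈ ({s, t, a, b} : Finset V) ∧ j ∈ ({s, t, a, b} : Finset V)) ∨
      (i ∈ ({s, t, b, c} : Finset V) ∧ j ∈ ({s, t, b, c} : Finset V)) ∨
      (i ∈ ({s, t, a, c} : Finset V) ∧ j ∈ ({s, t, a, c} : Finset V)) := by
  simp only [Finset.mem_insert, Finset.mem_singleton] at hi hj ⊢
  rcases hi with rfl | rfl | rfl | rfl | rfl <;> rcases hj with rfl | rfl | rfl | rfl | rfl <;> simp

/-- The link of an edge of a flag triangulation of a three-manifold is a cycle. -/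
theorem exists_cycle_link [Finite V] (h : X.Realization ≃ₜ N) (hflag : X.IsFlag) {s t : V}
    (hst : s ≠ t) (hX : ({s, t} : Finset V) ∈ X.faces) :
    ∃ n : ℕ, 4 ≤ n ∧ ∃ c : ℤ → V, (∀ i j, c i = c j ↔ (n : ℤ) ∣ i - j) ∧
      (∀ v, (v ≠ s ∧ v ≠ t ∧ ({s, t, v} : Finset V) ∈ X.faces) ↔ ∃ i, v = c i) ∧
      ∀ i w, (w ≠ s ∧ w ≠ t ∧ w ≠ c i ∧ ({s, t, c i, w} : Finset V) ∈ X.faces) ↔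
        w = c (i + 1) ∨ w = c (i - 1) := by
  let S : Set V := {v | v ≠ s ∧ v ≠ t ∧ ({s, t, v} : Finset V) ∈ X.faces}
  let adj : V → V → Prop := fun v w => v ≠ s ∧ v ≠ t ∧ w ≠ s ∧ w ≠ t ∧ w ≠ v ∧
    ({s, t, v, w} : Finset V) ∈ X.faces
  have hadjS : ∀ v w, adj v w → w ∈ S := by
    rintro v w ⟨-, -, h3, h4, -, h6⟩
    refine ⟨h3, h4, mem_faces_of_subset h6 ?_ ⟨s, by simp⟩⟩
    intro x hx
    simp only [Finset.mem_insert, Finset.mem_singleton] at hx ⊢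
    tauto
  obtain ⟨v₀, hv₀s, hv₀t, hv₀⟩ := exists_of_edge h hst hX
  have hsymm : ∀ a b, adj a b → adj b a := by
    rintro a b ⟨h1, h2, h3, h4, h5, h6⟩
    refine ⟨h3, h4, h1, h2, h5.symm, ?_⟩
    rwa [Finset.pair_comm b a]
  have htri : ∀ a b c, adj a b → adj b c → ¬ adj a c := by
    rintro a b c ⟨h1, h2, h3, h4, h5, h6⟩ ⟨-, -, k3, k4, k5, k6⟩ ⟨-, -, -, -, l5, l6⟩
    have hface : ({s, t, a, b, c} : Finset V) ∈ X.faces := by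
      refine hflag _ ⟨s, by simp⟩ fun i hi j hj => ?_
      have hmem : ∀ {σ : Finset V}, σ ∈ X.faces → i ∈ σ → j ∈ σ →
          (@insert V (Finset V) (@Finset.instInsert V fun a b => Classical.propDecidable (a = b)) i
            ({j} : Finset V)) ∈ X.faces := by
        intro σ hσ hi hj
        refine mem_faces_of_subset hσ (fun x hx => ?_) ⟨i, by simp⟩
        simp only [Finset.mem_insert, Finset.mem_singleton] at hx
        rcases hx with rfl | rfl <;> assumption
      have hor : (i ∈ ({s, t, a, b} : Finset V) ∧ j ∈ ({s, t, a, b} : Finset V)) ∨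
          (i ∈ ({s, t, b, c} : Finset V) ∧ j ∈ ({s, t, b, c} : Finset V)) ∨
          (i ∈ ({s, t, a, c} : Finset V) ∧ j ∈ ({s, t, a, c} : Finset V)) :=
        mem_of_mem_insert_three hi hj
      rcases hor with ⟨hi, hj⟩ | ⟨hi, hj⟩ | ⟨hi, hj⟩
      exacts [hmem h6 hi hj, hmem k6 hi hj, hmem l6 hi hj]
    have h4 := card_le_four h hface
    rw [Finset.card_insert_of_notMem (by simp [hst, h1.symm, h3.symm, k3.symm]),
      Finset.card_insert_of_notMem (by simp [h2.symm, ‹b ≠ t›.symm, k4.symm]),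
      Finset.card_insert_of_notMem (by simp [h5.symm, l5.symm]),
      Finset.card_insert_of_notMem (by simp [k5.symm]), Finset.card_singleton] at h4
    omega
  have hreg : ∀ v ∈ S, ∃ a ∈ S, ∃ b ∈ S, a ≠ b ∧ ∀ w, adj v w ↔ w = a ∨ w = b := by
    rintro v ⟨hvs, hvt, hv⟩
    have hadj : ∀ w, adj v w ↔ w ∉ ({s, t, v} : Finset V) ∧ insert w ({s, t, v} : Finset V) ∈ X.faces := by
      intro w
      have : insert w ({s, t, v} : Finset V) = {s, t, v, w} := by
        ext x
        simp only [Finset.mem_insert, Finset.mem_singleton]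
        tauto
      rw [this]
      simp only [adj, Finset.mem_insert, Finset.mem_singleton, not_or]
      tauto
    -- For the first choice the forbidden vertex v is already in the triangle and excludes nothing;
    -- for the second, a is forbidden.
    obtain ⟨a, -, ha, haX⟩ := exists_two_of_triangle h hst hvs.symm hvt.symm hv v
    obtain ⟨b, hba, hb, hbX⟩ := exists_two_of_triangle h hst hvs.symm hvt.symm hv a
    refine ⟨a, hadjS v a ((hadj a).2 ⟨ha, haX⟩), b, hadjS v b ((hadj b).2 ⟨hb, hbX⟩), hba.symm, ?_⟩
    intro w
    rw [hadj]
    constructor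
    · rintro ⟨hw, hwX⟩
      exact eq_or_eq_of_triangle h hst hvs.symm hvt.symm hba.symm ha hb hw haX hbX hwX
    · rintro (rfl | rfl)
      exacts [⟨ha, haX⟩, ⟨hb, hbX⟩]
  obtain ⟨n, hn, c, -, hcS, hc, hadj⟩ := exists_cycle_of_two_regular adj hsymm
    (fun a ha => ha.2.2.2.2.1 rfl) htri S (Set.toFinite S) hreg v₀ ⟨hv₀s, hv₀t, hv₀⟩
  have hface : ∀ i, ({s, t, c i, c (i + 1)} : Finset V) ∈ X.faces := fun i =>
    ((hadj i _).2 (Or.inl rfl)).2.2.2.2.2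
  refine ⟨n, hn, c, hc, fun v => ⟨fun hv => ?_, ?_⟩, fun i w => ?_⟩
  · exact mem_range_of_cycle h hst hn hc (fun i => (hcS i).1) (fun i => (hcS i).2.1) hface
      hv.1 hv.2.1 hv.2.2
  · rintro ⟨i, rfl⟩
    exact hcS i
  · rw [← hadj]
    exact ⟨fun hw => ⟨(hcS i).1, (hcS i).2.1, hw⟩, fun hw => hw.2.2⟩

end PreAbstractSimplicialComplex

end

noncomputable section

/-! ### Triangulated closed surfaces -/

namespace PreAbstractSimplicialComplex

open Topology Set
open scoped Classical

variable {V V' : Type*}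

/-- `a` and `b` are adjacent in the link of the vertex `v`. -/
def LinkAdj (X : PreAbstractSimplicialComplex V) (v a b : V) : Prop :=
  a ≠ v ∧ b ≠ v ∧ b ≠ a ∧ {v, a, b} ∈ X.faces

/-- `X` is a combinatorial surface without boundary whose vertex links have length at least `4`. -/
structure IsClosedSurface (X : PreAbstractSimplicialComplex V) : Prop where
  card_le : ∀ σ ∈ X.faces, σ.card ≤ 3
  exists_two : ∀ v a, a ≠ v → {v, a} ∈ X.faces → ∃ b₁ b₂, b₁ ≠ b₂ ∧
    ∀ b, X.LinkAdj v a b ↔ b = b₁ ∨ b = b₂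
  link_finite : ∀ v, {a | a ≠ v ∧ {v, a} ∈ X.faces}.Finite
  link_nonempty : ∀ v, {v} ∈ X.faces → ∃ a, a ≠ v ∧ {v, a} ∈ X.faces
  link_connected : ∀ v a b, a ≠ v → {v, a} ∈ X.faces → b ≠ v → {v, b} ∈ X.faces →
    Relation.ReflTransGen (X.LinkAdj v) a b
  no_triangle : ∀ v a b c, X.LinkAdj v a b → X.LinkAdj v b c → ¬ X.LinkAdj v a c

variable {X : PreAbstractSimplicialComplex V}

theorem LinkAdj.symm {v a b : V} (h : X.LinkAdj v a b) : X.LinkAdj v b a := by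
  refine ⟨h.2.1, h.1, h.2.2.1.symm, ?_⟩
  rw [Finset.pair_comm b a]
  exact h.2.2.2

theorem LinkAdj.edge_left {v a b : V} (h : X.LinkAdj v a b) : {v, a} ∈ X.faces :=
  mem_faces_of_subset h.2.2.2 (by intro x; simp only [Finset.mem_insert, Finset.mem_singleton]; tauto)
    ⟨v, by simp⟩

theorem LinkAdj.edge_right {v a b : V} (h : X.LinkAdj v a b) : {v, b} ∈ X.faces := h.symm.edge_left

theorem IsClosedSurface.exists_linkAdj (hX : X.IsClosedSurface) {v a : V} (hva : a ≠ v)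
    (h : {v, a} ∈ X.faces) : ∃ b, X.LinkAdj v a b := by
  obtain ⟨b, _, _, hb⟩ := hX.exists_two v a hva h
  exact ⟨b, (hb b).2 (Or.inl rfl)⟩

theorem mem_singleton_of_reachable {v w : V} (hv : {v} ∈ X.faces) (h : X.EdgeReachable v w) :
    {w} ∈ X.faces := by
  induction h with
  | refl => exact hv
  | tail _ hxy _ =>
    obtain ⟨σ, hσ, -, hy⟩ := hxy
    exact singleton_mem_of_mem hσ hy

/-- The link of a vertex of a closed surface is a cycle. -/
theorem IsClosedSurface.exists_cycle (hX : X.IsClosedSurface) {v : V} (hv : {v} ∈ X.faces) :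
    ∃ n : ℕ, 4 ≤ n ∧ ∃ c : ℤ → V, (∀ i j, c i = c j ↔ (n : ℤ) ∣ i - j) ∧
      (∀ a, (a ≠ v ∧ {v, a} ∈ X.faces) ↔ ∃ i, a = c i) ∧
      ∀ i w, X.LinkAdj v (c i) w ↔ w = c (i + 1) ∨ w = c (i - 1) := by
  obtain ⟨a₀, ha₀⟩ := hX.link_nonempty v hv
  obtain ⟨n, hn, c, -, hcS, hc, hadj⟩ := exists_cycle_of_two_regular (X.LinkAdj v)
    (fun _ _ h => h.symm) (fun a h => h.2.2.1 rfl) (hX.no_triangle v)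
    {a | a ≠ v ∧ ({v, a} : Finset V) ∈ X.faces} (hX.link_finite v) (by
      rintro a ⟨hav, ha⟩
      obtain ⟨b₁, b₂, hne, hb⟩ := hX.exists_two v a hav ha
      have h1 := (hb b₁).2 (Or.inl rfl)
      have h2 := (hb b₂).2 (Or.inr rfl)
      exact ⟨b₁, ⟨h1.2.1, h1.edge_right⟩, b₂, ⟨h2.2.1, h2.edge_right⟩, hne, hb⟩) a₀ ha₀
  refine ⟨n, hn, c, hc, fun a => ⟨fun ha => ?_, ?_⟩, hadj⟩
  · have h0 := hcS 0
    have hreach := hX.link_connected v (c 0) a h0.1 h0.2 ha.1 ha.2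
    induction hreach with
    | refl => exact ⟨0, rfl⟩
    | tail _ hxy ih =>
      obtain ⟨i, rfl⟩ := ih ⟨hxy.1, hxy.edge_left⟩
      rcases (hadj i _).1 hxy with h | h
      exacts [⟨_, h⟩, ⟨_, h⟩]
  · rintro ⟨i, rfl⟩
    exact hcS i

/-- The ratios to one positive coordinate fix the others up to a common factor, and the coordinates
sum to 1. -/
theorem Realization.ext_div {x y : X.Realization} {v : V} (hx : 0 < x.1 v) (hy : 0 < y.1 v)
    (h : ∀ w, x.1 w / x.1 v = y.1 w / y.1 v) : x = y := by
  have hw : ∀ w, x.1 w = x.1 v / y.1 v * y.1 w := by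
    intro w
    have := h w
    field_simp at this ⊢
    linarith
  have h1 := sum_eq_one_of_subset x (A := x.1.support ∪ y.1.support) Finset.subset_union_left
  have h2 := sum_eq_one_of_subset y (A := x.1.support ∪ y.1.support) Finset.subset_union_right
  rw [Finset.sum_congr rfl fun w _ => hw w, ← Finset.mul_sum, h2, mul_one] at h1
  exact Realization.ext fun w => by rw [hw w, h1, one_mul]

/-- Euclidean plane. -/
abbrev E2 := EuclideanSpace ℝ (Fin 2)

/-- The open star of a vertex of a closed surface is homeomorphic to the plane. -/
theorem IsClosedSurface.exists_chart (hX : X.IsClosedSurface) {v : V} (hv : {v} ∈ X.faces) :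
    ∃ φ : OpenPartialHomeomorph X.Realization E2, φ.source = {x | 0 < x.1 v} := by
  obtain ⟨n, hn, c, hc, hrange, hadj⟩ := hX.exists_cycle hv
  have hcv : ∀ i, c i ≠ v := fun i => ((hrange _).2 ⟨i, rfl⟩).1
  have hvc : ∀ i, v ≠ c i := fun i => (hcv i).symm
  let q : E2 → V → ℝ := fun z => PolygonCone.cycleCoord n c (z 0) (z 1)
  obtain ⟨G, hG, hGsupp, hGdiv⟩ := exists_point_family (X := X) (Z := E2)
    ({v} ∪ (Finset.range n).image fun j : ℕ => c j)
    (fun z w => if w = v then 1 else q z w)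
    (fun z w => by
      have := PolygonCone.cycleCoord_nonneg hn c (z 0) (z 1) w
      split_ifs
      exacts [zero_le_one, this])
    (fun z w hw => by
      by_contra hw'
      rw [Finset.mem_union, not_or, Finset.mem_singleton] at hw'
      simp only [hw'.1, if_false] at hw
      exact hw'.2 (PolygonCone.mem_image_of_cycleCoord_ne_zero hw))
    (fun z => ⟨v, by simp⟩)
    (fun z => by
      obtain ⟨i, hi⟩ := PolygonCone.exists_consecutive hn hc (z 0) (z 1)
      refine ⟨_, ((hadj i (c (i + 1))).2 (Or.inl rfl)).2.2.2, fun w hw => ?_⟩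
      by_contra hw'
      simp only [Finset.mem_insert, Finset.mem_singleton, not_or] at hw'
      simp only [hw'.1, if_false] at hw
      exact (hi w hw).elim hw'.2.1 hw'.2.2)
    (fun w _ => by
      have hqc : Continuous fun z => q z w := (PolygonCone.continuous_cycleCoord n c w).comp
        (by fun_prop : Continuous fun z : E2 => (z 0, z 1))
      split_ifs
      exacts [continuous_const, hqc])
  have hGv : ∀ z, 0 < (G z).1 v := fun z => (coord_pos_iff _ _).2 ((hGsupp z v).2 (by simp))
  have hGc : ∀ z i, (G z).1 (c i) / (G z).1 v = PolygonCone.coord n i (z 0) (z 1) := by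
    intro z i
    rw [hGdiv, if_neg (hcv i), if_pos rfl, div_one]
    exact PolygonCone.cycleCoord_apply hn hc _ _ i
  -- The inverse of G: place the link vertices at the vertices of a regular polygon, and take the
  -- combination with weights relative to that of v.
  let F : X.Realization → E2 := fun x =>
    !₂[∑ j ∈ Finset.range n, x.1 (c j) / x.1 v * Real.cos (j * (2 * Real.pi / n)),
      ∑ j ∈ Finset.range n, x.1 (c j) / x.1 v * Real.sin (j * (2 * Real.pi / n))]
  have hFG : ∀ z, F (G z) = z := by
    intro z
    ext i
    fin_cases i
    · change ∑ j ∈ Finset.range n, (G z).1 (c j) / (G z).1 v * Real.cos (j * (2 * Real.pi / n)) = z 0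
      simp only [hGc]
      exact PolygonCone.sum_coord_mul_cos hn _ _
    · change ∑ j ∈ Finset.range n, (G z).1 (c j) / (G z).1 v * Real.sin (j * (2 * Real.pi / n)) = z 1
      simp only [hGc]
      exact PolygonCone.sum_coord_mul_sin hn _ _
  -- A simplex containing v has at most two further vertices, and two of them are consecutive in the
  -- link cycle.
  have hsector : ∀ x : X.Realization, 0 < x.1 v →
      ∃ i, ∀ w, w ≠ v → x.1 w ≠ 0 → w = c i ∨ w = c (i + 1) := by
    intro x hx
    have hvx : v ∈ x.1.support := (coord_pos_iff _ _).1 hx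
    have hlink : ∀ w, w ≠ v → x.1 w ≠ 0 → ∃ i, w = c i := by
      intro w hwv hw
      refine (hrange w).1 ⟨hwv, mem_faces_of_subset x.2.2.2 ?_ ⟨v, by simp⟩⟩
      intro u hu
      simp only [Finset.mem_insert, Finset.mem_singleton] at hu
      rcases hu with rfl | rfl
      exacts [hvx, Finsupp.mem_support_iff.2 hw]
    by_cases h1 : ∃ w, w ≠ v ∧ x.1 w ≠ 0
    · obtain ⟨w, hwv, hw⟩ := h1
      obtain ⟨i, rfl⟩ := hlink w hwv hw
      by_cases h2 : ∃ u, u ≠ v ∧ u ≠ c i ∧ x.1 u ≠ 0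
      · obtain ⟨u, huv, hui, hu⟩ := h2
        have hsub : ({v, c i, u} : Finset V) ⊆ x.1.support := by
          intro y hy
          simp only [Finset.mem_insert, Finset.mem_singleton] at hy
          rcases hy with rfl | rfl | rfl
          exacts [hvx, Finsupp.mem_support_iff.2 hw, Finsupp.mem_support_iff.2 hu]
        have heq : ({v, c i, u} : Finset V) = x.1.support := by
          refine Finset.eq_of_subset_of_card_le hsub ?_
          rw [Finset.card_eq_three.2 ⟨v, c i, u, hwv.symm, huv.symm, hui.symm, rfl⟩]
          exact hX.card_le _ x.2.2.2
        have hmem : ∀ y, y ≠ v → x.1 y ≠ 0 → y = c i ∨ y = u := by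
          intro y hyv hy
          have : y ∈ ({v, c i, u} : Finset V) := by
            rw [heq]
            exact Finsupp.mem_support_iff.2 hy
          simp only [Finset.mem_insert, Finset.mem_singleton] at this
          tauto
        have hadj' : X.LinkAdj v (c i) u := ⟨hwv, huv, hui, by rw [heq]; exact x.2.2.2⟩
        rcases (hadj i u).1 hadj' with rfl | rfl
        · exact ⟨i, hmem⟩
        · refine ⟨i - 1, fun y hyv hy => ?_⟩
          rw [sub_add_cancel]
          exact (hmem y hyv hy).symm
      · push Not at h2
        refine ⟨i, fun y hyv hy => Or.inl ?_⟩
        by_contra hyi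
        exact hy (h2 y hyv hyi)
    · push Not at h1
      exact ⟨0, fun y hyv hy => absurd (h1 y hyv) hy⟩
  have hGF : ∀ x : X.Realization, 0 < x.1 v → G (F x) = x := by
    intro x hx
    obtain ⟨i, hi⟩ := hsector x hx
    have hnn : ∀ w, 0 ≤ x.1 w / x.1 v := fun w => div_nonneg (x.2.1 w) hx.le
    have hzero : ∀ j, ¬ (n : ℤ) ∣ j - i → ¬ (n : ℤ) ∣ j - (i + 1) → x.1 (c j) / x.1 v = 0 := by
      intro j h0 h1
      rw [div_eq_zero_iff]
      left
      by_contra hne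
      rcases hi (c j) (hcv j) hne with h | h
      exacts [h0 ((hc _ _).1 h), h1 ((hc _ _).1 h)]
    have hsum : ∀ u : ℤ → ℝ, (∀ i j, (n : ℤ) ∣ i - j → u i = u j) →
        ∑ j ∈ Finset.range n, x.1 (c j) / x.1 v * u j =
          x.1 (c i) / x.1 v * u i + x.1 (c (i + 1)) / x.1 v * u (i + 1) := by
      intro u hu
      refine PolygonCone.sum_range_periodic hn (f := fun j => x.1 (c j) / x.1 v * u j) ?_ i ?_
      · intro a b hab
        simp only [(hc a b).2 hab, hu a b hab]
      · intro j h0 h1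
        simp only [hzero j h0 h1, zero_mul]
    have hF0 := hsum (fun j => Real.cos (j * (2 * Real.pi / n)))
      fun a b hab => PolygonCone.cos_eq_of_dvd hn hab
    have hF1 := hsum (fun j => Real.sin (j * (2 * Real.pi / n)))
      fun a b hab => PolygonCone.sin_eq_of_dvd hn hab
    push_cast at hF0 hF1
    have hcoord : ∀ j, PolygonCone.coord n j (F x 0) (F x 1) = x.1 (c j) / x.1 v := by
      intro j
      change PolygonCone.coord n j
        (∑ j ∈ Finset.range n, x.1 (c j) / x.1 v * Real.cos (j * (2 * Real.pi / n)))
        (∑ j ∈ Finset.range n, x.1 (c j) / x.1 v * Real.sin (j * (2 * Real.pi / n))) = _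
      rw [hF0, hF1]
      by_cases h0 : (n : ℤ) ∣ j - i
      · rw [PolygonCone.coord_eq_of_dvd hn h0, PolygonCone.coord_left hn (hnn _) (hnn _),
          (hc j i).2 h0]
      by_cases h1 : (n : ℤ) ∣ j - (i + 1)
      · rw [PolygonCone.coord_eq_of_dvd hn h1, PolygonCone.coord_right hn (hnn _) (hnn _),
          (hc j (i + 1)).2 h1]
      · rw [PolygonCone.coord_other hn (hnn _) (hnn _) i j h0 h1, hzero j h0 h1]
    refine Realization.ext_div (hGv _) hx fun w => ?_
    by_cases hwv : w = v
    · rw [hwv, div_self hx.ne', div_self (hGv _).ne']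
    by_cases hwc : ∃ j, w = c j
    · obtain ⟨j, rfl⟩ := hwc
      rw [hGc, hcoord]
    · push Not at hwc
      have hxw : x.1 w = 0 := by
        by_contra hne
        rcases hi w hwv hne with h | h
        exacts [hwc _ h, hwc _ h]
      rw [hGdiv, if_neg hwv, hxw]
      have : q (F x) w = 0 := PolygonCone.cycleCoord_eq_zero n _ _ hwc
      rw [this, zero_div, zero_div]
  refine ⟨⟨⟨⟨F, G, {x | 0 < x.1 v}, univ, fun _ _ => mem_univ _, fun z _ => hGv z,
    fun x hx => hGF x hx, fun z _ => hFG z⟩, ?_, hG.continuousOn⟩,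
    isOpen_lt continuous_const (continuous_coord v), isOpen_univ⟩, rfl⟩
  change ContinuousOn F {x | 0 < x.1 v}
  have hdiv : ∀ w, ContinuousOn (fun x : X.Realization => x.1 w / x.1 v) {x | 0 < x.1 v} := fun w =>
    (continuous_coord w).continuousOn.div (continuous_coord v).continuousOn fun x hx => ne_of_gt hx
  have hsumc : ∀ u : ℕ → ℝ, ContinuousOn (fun x : X.Realization =>
      ∑ j ∈ Finset.range n, x.1 (c j) / x.1 v * u j) {x | 0 < x.1 v} := fun u =>
    continuousOn_finsetSum _ fun j _ => (hdiv (c j)).mul continuousOn_const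
  refine (PiLp.continuous_toLp 2 _).comp_continuousOn (continuousOn_pi.2 fun i => ?_)
  fin_cases i
  · exact hsumc fun j => Real.cos (j * (2 * Real.pi / n))
  · exact hsumc fun j => Real.sin (j * (2 * Real.pi / n))

/-- The open stars of the countably many vertices are planes and cover the realization. -/
theorem IsClosedSurface.isTopManifold [Countable V] (hX : X.IsClosedSurface) :
    IsTopManifold 2 X.Realization := by
  choose φ hφ using fun v (hv : {v} ∈ X.faces) => hX.exists_chart hv
  choose w hw using fun x : X.Realization => nonempty_of_mem_faces x.2.2.2
  have hwv : ∀ x, {w x} ∈ X.faces := fun x => singleton_mem_of_mem_support x (hw x)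
  let inst : ChartedSpace E2 X.Realization :=
    { atlas := range fun x => φ (w x) (hwv x)
      chartAt := fun x => φ (w x) (hwv x)
      mem_chart_source := fun x => by
        rw [hφ]
        exact (coord_pos_iff _ _).2 (hw x)
      chart_mem_atlas := fun x => ⟨x, rfl⟩ }
  refine ⟨inferInstance, ?_, ⟨inst⟩⟩
  let s : Set X.Realization := range fun v : {v : V // {v} ∈ X.faces} => X.vertexPoint v.1 v.2
  have hvert : ∀ v (hv : {v} ∈ X.faces), w (X.vertexPoint v hv) = v := by
    intro v hv
    have := hw (X.vertexPoint v hv)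
    have h2 : (X.vertexPoint v hv).1.support = {v} := Finsupp.support_single v (one_ne_zero (α := ℝ))
    rw [h2] at this
    exact Finset.mem_singleton.1 this
  refine ChartedSpace.secondCountable_of_countable_cover E2 (s := s) ?_ (countable_range _)
  refine eq_univ_of_forall fun x => ?_
  refine mem_iUnion₂.2 ⟨X.vertexPoint (w x) (hwv x), ⟨⟨w x, hwv x⟩, rfl⟩, ?_⟩
  change x ∈ (φ (w (X.vertexPoint (w x) (hwv x))) _).source
  rw [hφ]
  change 0 < x.1 (w (X.vertexPoint (w x) (hwv x)))
  rw [hvert]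
  exact (coord_pos_iff _ _).2 (hw x)

/-! ### Square-summable cycles on surfaces -/

section L2

variable {P : Type*} [PartialOrder P] {X : PreAbstractSimplicialComplex P}

theorem exists_erase_of_incidence_ne_zero {σ τ : Finset P} (h : incidence σ τ ≠ 0) :
    ∃ v ∈ σ, σ.erase v = τ := by
  by_contra! hne
  exact h (Finset.sum_eq_zero fun v hv => if_neg (hne v hv))

theorem abs_incidence_erase {σ : Finset P} {v : P} (hv : v ∈ σ) : |incidence σ (σ.erase v)| = 1 := by
  rw [incidence, Finset.sum_eq_single v]
  · simp
  · intro w hw hwv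
    rw [if_neg]
    intro h
    have : w ∈ σ.erase v := Finset.mem_erase.2 ⟨hwv, hw⟩
    rw [← h] at this
    exact Finset.notMem_erase w σ this
  · exact fun h => absurd hv h

/-- The absolute value of the coefficient of a triangle in a chain. -/
def absCoeff (f : X.L2Chain 2) (σ : Finset P) : ℝ :=
  if h : σ ∈ X.faces ∧ σ.card = 2 + 1 then |f ⟨σ, h⟩| else 0

/-- The boundary coefficient at the edge {v, a} has only two terms, each with incidence ±1. Absolute
values make a choice of orientation unnecessary. -/
theorem absCoeff_eq_of_cycle {f : X.L2Chain 2} (hf : f ∈ X.l2Cycles 2) {v a b₁ b₂ : P}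
    (hne : b₁ ≠ b₂) (hb : ∀ b, X.LinkAdj v a b ↔ b = b₁ ∨ b = b₂) :
    absCoeff f {v, a, b₁} = absCoeff f {v, a, b₂} := by
  have hcard : ∀ b, X.LinkAdj v a b → ({v, a, b} : Finset P).card = 2 + 1 := fun b h =>
    Finset.card_eq_three.2 ⟨v, a, b, h.1.symm, h.2.1.symm, h.2.2.1.symm, rfl⟩
  have herase : ∀ b, X.LinkAdj v a b → ({v, a, b} : Finset P).erase b = {v, a} := by
    intro b h
    ext x
    simp only [Finset.mem_erase, Finset.mem_insert, Finset.mem_singleton]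
    have := h.2.1
    have := h.2.2.1
    constructor
    · tauto
    · rintro (rfl | rfl)
      · exact ⟨h.2.1.symm, Or.inl rfl⟩
      · exact ⟨h.2.2.1.symm, Or.inr (Or.inl rfl)⟩
  have h1 := (hb b₁).2 (Or.inl rfl)
  have h2 := (hb b₂).2 (Or.inr rfl)
  let σ₁ : X.Simplex 2 := ⟨{v, a, b₁}, h1.2.2.2, hcard _ h1⟩
  let σ₂ : X.Simplex 2 := ⟨{v, a, b₂}, h2.2.2.2, hcard _ h2⟩
  have hσ : σ₁ ≠ σ₂ := by
    intro h
    have h' : ({v, a, b₁} : Finset P) = {v, a, b₂} := congrArg Subtype.val h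
    have hmem : b₁ ∈ ({v, a, b₂} : Finset P) := by
      rw [← h']
      simp
    simp only [Finset.mem_insert, Finset.mem_singleton] at hmem
    exact hmem.elim h1.2.1 fun h => h.elim h1.2.2.1 hne
  have hsum := hf {v, a} h1.edge_left
  -- A triangle with nonzero incidence contains the edge, so it is one of σ₁ and σ₂ and the series
  -- is a finite sum.
  have hsum2 : HasSum (fun σ : X.Simplex 2 => incidence σ.1 {v, a} * f σ)
      (∑ σ ∈ {σ₁, σ₂}, incidence σ.1 {v, a} * f σ) := by
    refine hasSum_sum_of_ne_finset_zero fun σ hσ' => ?_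
    by_contra hne0
    obtain ⟨b, hbσ, hbe⟩ := exists_erase_of_incidence_ne_zero (left_ne_zero_of_mul hne0)
    have hσb : σ.1 = {v, a, b} := by
      rw [← Finset.insert_erase hbσ, hbe]
      ext x
      simp only [Finset.mem_insert, Finset.mem_singleton]
      tauto
    have hbn : b ∉ ({v, a} : Finset P) := by
      rw [← hbe]
      exact Finset.notMem_erase _ _
    simp only [Finset.mem_insert, Finset.mem_singleton, not_or] at hbn
    have hadj : X.LinkAdj v a b := ⟨h1.1, hbn.1, hbn.2, hσb ▸ σ.2.1⟩
    apply hσ'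
    rw [Finset.mem_insert, Finset.mem_singleton]
    rcases (hb b).1 hadj with rfl | rfl
    · exact Or.inl (Subtype.ext hσb)
    · exact Or.inr (Subtype.ext hσb)
  have heq := hsum2.unique hsum
  rw [Finset.sum_pair hσ] at heq
  have i1 : |incidence σ₁.1 {v, a}| = 1 := by
    rw [← herase _ h1]
    exact abs_incidence_erase (by simp [σ₁])
  have i2 : |incidence σ₂.1 {v, a}| = 1 := by
    rw [← herase _ h2]
    exact abs_incidence_erase (by simp [σ₂])
  have habs : |incidence σ₁.1 {v, a} * f σ₁| = |incidence σ₂.1 {v, a} * f σ₂| := by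
    rw [eq_neg_of_add_eq_zero_left heq, abs_neg]
  rw [abs_mul, abs_mul, i1, i2, one_mul, one_mul] at habs
  rw [absCoeff, absCoeff, dif_pos σ₁.2, dif_pos σ₂.2]
  exact habs

theorem absCoeff_eq_of_edge (hX : X.IsClosedSurface) {f : X.L2Chain 2} (hf : f ∈ X.l2Cycles 2)
    {v a b b' : P} (h : X.LinkAdj v a b) (h' : X.LinkAdj v a b') :
    absCoeff f {v, a, b} = absCoeff f {v, a, b'} := by
  obtain ⟨b₁, b₂, hne, hb⟩ := hX.exists_two v a h.1 h.edge_left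
  have key := absCoeff_eq_of_cycle hf hne hb
  rcases (hb b).1 h with rfl | rfl <;> rcases (hb b').1 h' with rfl | rfl
  exacts [rfl, key, key.symm, rfl]

theorem absCoeff_eq_of_link (hX : X.IsClosedSurface) {f : X.L2Chain 2} (hf : f ∈ X.l2Cycles 2)
    {v a b a' b' : P} (h : X.LinkAdj v a b) (h' : X.LinkAdj v a' b') :
    absCoeff f {v, a, b} = absCoeff f {v, a', b'} := by
  have hreach := hX.link_connected v a a' h.1 h.edge_left h'.1 h'.edge_left
  induction hreach generalizing b' with
  | refl => exact absCoeff_eq_of_edge hX hf h h'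
  | @tail x y _ hxy ih =>
    rw [ih hxy, Finset.pair_comm x y]
    exact absCoeff_eq_of_edge hX hf hxy.symm h'

/-- The value is constant around each vertex, and passes from one endpoint of an edge to the other
through a triangle containing both. -/
theorem absCoeff_eq_of_reachable (hX : X.IsClosedSurface) {f : X.L2Chain 2}
    (hf : f ∈ X.l2Cycles 2) {v a b w a' b' : P} (h : X.LinkAdj v a b) (hw : X.EdgeReachable v w)
    (h' : X.LinkAdj w a' b') : absCoeff f {v, a, b} = absCoeff f {w, a', b'} := by
  induction hw generalizing a' b' with
  | refl => exact absCoeff_eq_of_link hX hf h h'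
  | @tail x y _ hxy ih =>
    obtain ⟨σ, hσ, hx, hy⟩ := hxy
    by_cases hne : y = x
    · subst hne
      exact ih h'
    · have hedge : {x, y} ∈ X.faces := mem_faces_of_subset hσ (by
        intro z hz
        simp only [Finset.mem_insert, Finset.mem_singleton] at hz
        rcases hz with rfl | rfl <;> assumption) ⟨x, by simp⟩
      obtain ⟨b, hb⟩ := hX.exists_linkAdj hne hedge
      rw [ih hb, Finset.insert_comm x y]
      refine absCoeff_eq_of_link hX hf ⟨hb.1.symm, hb.2.2.1, hb.2.1, ?_⟩ h'
      rw [Finset.insert_comm]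
      exact hb.2.2.2

/-- A square-summable cycle on a surface without compact components vanishes. -/
theorem IsClosedSurface.eq_zero_of_mem_l2Cycles (hX : X.IsClosedSurface)
    (hinf : ∀ v, {v} ∈ X.faces → {w | X.EdgeReachable v w}.Infinite) {f : X.L2Chain 2}
    (hf : f ∈ X.l2Cycles 2) : f = 0 := by
  ext σ
  by_contra hne
  have hne : f σ ≠ 0 := hne
  obtain ⟨v, a, b, hva, hvb, hab, hσ⟩ := Finset.card_eq_three.1 σ.2.2
  have hadj : X.LinkAdj v a b := ⟨hva.symm, hvb.symm, hab.symm, hσ ▸ σ.2.1⟩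
  have hval : absCoeff f {v, a, b} = |f σ| := by
    rw [absCoeff, dif_pos (hσ ▸ σ.2)]
    have heq : (⟨{v, a, b}, hσ ▸ σ.2⟩ : X.Simplex 2) = σ := Subtype.ext hσ.symm
    rw [heq]
  have hv : {v} ∈ X.faces := singleton_mem_of_mem hadj.2.2.2 (by simp)
  have hsummable : Summable fun τ : X.Simplex 2 => ‖f τ‖ ^ (2 : ℝ) := by
    have := (lp.memℓp f).summable (by norm_num)
    simpa using this
  -- Square-summability allows only finitely many coefficients at least as large as that of σ.
  have hfin : {τ : X.Simplex 2 | |f σ| ≤ |f τ|}.Finite := by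
    have h0 := hsummable.tendsto_cofinite_zero
    have hev := h0.eventually (gt_mem_nhds (show (0 : ℝ) < |f σ| ^ (2 : ℝ) by positivity))
    refine (Filter.eventually_cofinite.1 hev).subset fun τ hτ => ?_
    simp only [Set.mem_ofPred_eq, not_lt, Real.norm_eq_abs] at hτ ⊢
    gcongr
  -- Each vertex reachable from v lies in a triangle with the same absolute coefficient, so the
  -- component would have finitely many vertices.
  refine hinf v hv ((hfin.biUnion fun τ _ => (τ.1 : Finset P).finite_toSet).subset fun w hw => ?_)
  obtain ⟨a', ha'w, ha'⟩ := hX.link_nonempty w (mem_singleton_of_reachable hv hw)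
  obtain ⟨b', hb'⟩ := hX.exists_linkAdj ha'w ha'
  have hτ : ({w, a', b'} : Finset P) ∈ X.faces ∧ ({w, a', b'} : Finset P).card = 2 + 1 :=
    ⟨hb'.2.2.2, Finset.card_eq_three.2 ⟨w, a', b', hb'.1.symm, hb'.2.1.symm, hb'.2.2.1.symm, rfl⟩⟩
  have heq := absCoeff_eq_of_reachable hX hf hadj hw hb'
  rw [hval, absCoeff, dif_pos hτ] at heq
  exact Set.mem_iUnion₂.2 ⟨⟨_, hτ⟩, heq.le, by simp⟩

/-- The cycles themselves vanish, so the closure of the boundaries plays no role. -/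
theorem IsClosedSurface.subsingleton_reducedL2Homology (hX : X.IsClosedSurface)
    (hinf : ∀ v, {v} ∈ X.faces → {w | X.EdgeReachable v w}.Infinite) :
    Subsingleton (X.ReducedL2Homology 2) := by
  have : Subsingleton (X.l2Cycles 2) := ⟨fun f g => Subtype.ext (by
    rw [hX.eq_zero_of_mem_l2Cycles hinf f.2, hX.eq_zero_of_mem_l2Cycles hinf g.2])⟩
  exact Function.Surjective.subsingleton (Submodule.mkQ_surjective _)

end L2

end PreAbstractSimplicialComplex

end

noncomputable section

/-! ### Parabolic subgroups of even Coxeter systems -/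

namespace CoxeterSystem

open scoped Pointwise

variable {B W : Type*} [Group W] {M : CoxeterMatrix B} (cs : CoxeterSystem M W)

theorem simple_mem_parabolic {T : Set B} {i : B} (hi : i ∈ T) : cs.simple i ∈ cs.parabolic T :=
  Subgroup.subset_closure (Set.mem_image_of_mem _ hi)

theorem parabolic_mono {T R : Set B} (h : T ⊆ R) : cs.parabolic T ≤ cs.parabolic R :=
  Subgroup.closure_mono (Set.image_mono h)

theorem parabolic_le_iff_forall {T : Set B} {H : Subgroup W} :
    cs.parabolic T ≤ H ↔ ∀ i ∈ T, cs.simple i ∈ H := by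
  rw [parabolic, Subgroup.closure_le]
  exact ⟨fun h i hi => h ⟨i, hi, rfl⟩, by rintro h _ ⟨i, hi, rfl⟩; exact h i hi⟩

theorem parabolic_empty : cs.parabolic ∅ = ⊥ := by
  rw [parabolic, Set.image_empty, Subgroup.closure_empty]

theorem parabolic_univ : cs.parabolic Set.univ = ⊤ := by
  rw [parabolic, Set.image_univ, cs.subgroup_closure_range_simple]

theorem simple_ne_one (i : B) : cs.simple i ≠ 1 := by
  intro h
  have := cs.length_simple i
  rw [h, cs.length_one] at this
  exact zero_ne_one this

theorem mem_parabolic_singleton {i : B} {w : W} :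
    w ∈ cs.parabolic {i} ↔ w = 1 ∨ w = cs.simple i := by
  constructor
  · intro h
    induction h using Subgroup.closure_induction with
    | mem x hx =>
      rw [Set.image_singleton] at hx
      exact Or.inr hx
    | one => exact Or.inl rfl
    | mul x y _ _ hx hy => rcases hx with rfl | rfl <;> rcases hy with rfl | rfl <;> simp
    | inv x _ hx => rcases hx with rfl | rfl <;> simp
  · rintro (rfl | rfl)
    exacts [one_mem _, cs.simple_mem_parabolic rfl]

theorem retraction_simple_of_mem (hM : M.IsEven) {T : Set B} {i : B} (hi : i ∈ T) :
    (cs.retraction hM T (cs.simple i) : W) = cs.simple i :=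
  (congrArg Subtype.val (cs.lift_apply_simple _ i)).trans (by rw [dif_pos hi])

theorem retraction_simple_of_notMem (hM : M.IsEven) {T : Set B} {i : B} (hi : i ∉ T) :
    cs.retraction hM T (cs.simple i) = 1 :=
  (cs.lift_apply_simple _ i).trans (dif_neg hi)

theorem retraction_of_mem (hM : M.IsEven) {T : Set B} {w : W} (hw : w ∈ cs.parabolic T) :
    (cs.retraction hM T w : W) = w := by
  induction hw using Subgroup.closure_induction with
  | mem x hx =>
    obtain ⟨i, hi, rfl⟩ := hx
    exact cs.retraction_simple_of_mem hM hi
  | one => simp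
  | mul x y _ _ hx hy => rw [map_mul, Subgroup.coe_mul, hx, hy]
  | inv x _ hx => rw [map_inv, Subgroup.coe_inv, hx]

/-- Each generator is fixed or killed by g_T, so generators of W_R go to generators in T ∩ R or to
the identity. This is how evenness replaces the usual theory of parabolic subgroups. -/
theorem retraction_mem_inter (hM : M.IsEven) (T : Set B) {R : Set B} {w : W}
    (hw : w ∈ cs.parabolic R) : (cs.retraction hM T w : W) ∈ cs.parabolic (T ∩ R) := by
  induction hw using Subgroup.closure_induction with
  | mem x hx =>
    obtain ⟨i, hi, rfl⟩ := hx
    by_cases hiT : i ∈ T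
    · rw [cs.retraction_simple_of_mem hM hiT]
      exact cs.simple_mem_parabolic ⟨hiT, hi⟩
    · rw [cs.retraction_simple_of_notMem hM hiT]
      exact one_mem _
  | one => simp
  | mul x y _ _ hx hy =>
    rw [map_mul, Subgroup.coe_mul]
    exact mul_mem hx hy
  | inv x _ hx =>
    rw [map_inv, Subgroup.coe_inv]
    exact inv_mem hx

theorem retraction_eq_one (hM : M.IsEven) {T R : Set B} (h : Disjoint T R) {w : W}
    (hw : w ∈ cs.parabolic R) : cs.retraction hM T w = 1 := by
  have := cs.retraction_mem_inter hM T hw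
  rw [h.inter_eq, parabolic_empty, Subgroup.mem_bot] at this
  exact Subtype.ext this

/-- An element of W_T is fixed by g_T, and g_T maps W_R into the parabolic subgroup of the
intersection. -/
theorem parabolic_inf (hM : M.IsEven) (T R : Set B) :
    cs.parabolic T ⊓ cs.parabolic R = cs.parabolic (T ∩ R) := by
  refine le_antisymm ?_ (le_inf (cs.parabolic_mono Set.inter_subset_left)
    (cs.parabolic_mono Set.inter_subset_right))
  rintro w ⟨hT, hR⟩
  rw [← cs.retraction_of_mem hM hT]
  exact cs.retraction_mem_inter hM T hR

theorem simple_mem_parabolic_iff (hM : M.IsEven) {T : Set B} {i : B} :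
    cs.simple i ∈ cs.parabolic T ↔ i ∈ T := by
  refine ⟨fun h => ?_, cs.simple_mem_parabolic⟩
  by_contra hi
  have h1 := cs.retraction_eq_one hM (Set.disjoint_singleton_left.2 hi) h
  have h2 := cs.retraction_simple_of_mem hM (Set.mem_singleton i)
  rw [h1] at h2
  exact cs.simple_ne_one i h2.symm

theorem parabolic_le_iff (hM : M.IsEven) {T R : Set B} :
    cs.parabolic T ≤ cs.parabolic R ↔ T ⊆ R := by
  rw [cs.parabolic_le_iff_forall]
  exact forall₂_congr fun i _ => cs.simple_mem_parabolic_iff hM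

/-! ### Cosets -/

theorem smul_parabolic_subset_iff (hM : M.IsEven) {T R : Set B} {x y : W} :
    x • (cs.parabolic T : Set W) ⊆ y • (cs.parabolic R : Set W) ↔
      T ⊆ R ∧ y⁻¹ * x ∈ cs.parabolic R := by
  constructor
  · intro h
    have hx : y⁻¹ * x ∈ cs.parabolic R := by
      have := h (Set.mem_smul_set.2 ⟨1, one_mem _, by simp⟩ : x ∈ x • (cs.parabolic T : Set W))
      rwa [Set.mem_smul_set_iff_inv_smul_mem, smul_eq_mul] at this
    refine ⟨(cs.parabolic_le_iff hM).1 fun z hz => ?_, hx⟩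
    have := h (Set.smul_mem_smul_set (a := x) hz)
    rw [Set.mem_smul_set_iff_inv_smul_mem, smul_eq_mul, smul_eq_mul, ← mul_assoc] at this
    exact (Subgroup.mul_mem_cancel_left _ hx).1 this
  · rintro ⟨hTR, hx⟩ _ ⟨z, hz, rfl⟩
    rw [Set.mem_smul_set_iff_inv_smul_mem]
    simp only [smul_eq_mul, ← mul_assoc]
    exact mul_mem hx (cs.parabolic_mono hTR hz)

theorem smul_parabolic_eq_iff (hM : M.IsEven) {T R : Set B} {x y : W} :
    x • (cs.parabolic T : Set W) = y • (cs.parabolic R : Set W) ↔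
      T = R ∧ y⁻¹ * x ∈ cs.parabolic R := by
  constructor
  · intro h
    have h1 := (cs.smul_parabolic_subset_iff hM).1 h.subset
    have h2 := (cs.smul_parabolic_subset_iff hM).1 h.symm.subset
    exact ⟨h1.1.antisymm h2.1, h1.2⟩
  · rintro ⟨rfl, hx⟩
    refine Set.Subset.antisymm ((cs.smul_parabolic_subset_iff hM).2 ⟨subset_rfl, hx⟩)
      ((cs.smul_parabolic_subset_iff hM).2 ⟨subset_rfl, ?_⟩)
    have := inv_mem hx
    simpa using this

theorem coset_le_iff (hM : M.IsEven) {T R : Set B} {x y : W} {hT : cs.IsSpherical T}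
    {hR : cs.IsSpherical R} :
    cs.coset x T hT ≤ cs.coset y R hR ↔ T ⊆ R ∧ y⁻¹ * x ∈ cs.parabolic R :=
  cs.smul_parabolic_subset_iff hM

theorem coset_eq_iff (hM : M.IsEven) {T R : Set B} {x y : W} {hT : cs.IsSpherical T}
    {hR : cs.IsSpherical R} :
    cs.coset x T hT = cs.coset y R hR ↔ T = R ∧ y⁻¹ * x ∈ cs.parabolic R :=
  Subtype.ext_iff.trans (cs.smul_parabolic_eq_iff hM)

theorem exists_eq_coset (C : cs.SphericalCoset) :
    ∃ (w : W) (T : Set B) (hT : cs.IsSpherical T), C = cs.coset w T hT := by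
  obtain ⟨C, T, hT, w, rfl⟩ := C
  exact ⟨w, T, hT, rfl⟩

theorem mem_coset_iff {T : Set B} {hT : cs.IsSpherical T} {x w : W} :
    x ∈ (cs.coset w T hT).1 ↔ w⁻¹ * x ∈ cs.parabolic T := by
  change x ∈ w • (cs.parabolic T : Set W) ↔ _
  rw [Set.mem_smul_set_iff_inv_smul_mem]
  rfl

theorem coset_eq_of_mem {T : Set B} {hT : cs.IsSpherical T} {x w : W}
    (hx : x ∈ (cs.coset w T hT).1) : cs.coset w T hT = cs.coset x T hT := by
  rw [mem_coset_iff] at hx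
  refine Subtype.ext (Set.Subset.antisymm ?_ ?_)
  · rintro _ ⟨z, hz, rfl⟩
    exact cs.mem_coset_iff.2 (by
      have := mul_mem (inv_mem hx) hz
      simpa [mul_assoc] using this)
  · rintro _ ⟨z, hz, rfl⟩
    exact cs.mem_coset_iff.2 (by
      have := mul_mem hx hz
      simpa [mul_assoc] using this)

theorem coset_le_of_subset {T R : Set B} {hT : cs.IsSpherical T} {hR : cs.IsSpherical R} {w : W}
    (h : T ⊆ R) : cs.coset w T hT ≤ cs.coset w R hR :=
  Set.smul_set_mono (cs.parabolic_mono h)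

theorem translate_coset (w x : W) {T : Set B} (hT : cs.IsSpherical T) :
    cs.translate w (cs.coset x T hT) = cs.coset (w * x) T hT :=
  Subtype.ext (smul_smul w x _)

/-! ### Commuting generators -/

theorem commute_simple {i j : B} (h : M i j = 2) : Commute (cs.simple i) (cs.simple j) := by
  have h1 := cs.simple_mul_simple_pow i j
  rw [h, pow_two] at h1
  have := eq_inv_of_mul_eq_one_left h1
  rw [mul_inv_rev, cs.inv_simple, cs.inv_simple] at this
  exact this

theorem commute_parabolic {T R : Set B} (h : ∀ i ∈ T, ∀ j ∈ R, M i j = 2) {x y : W}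
    (hx : x ∈ cs.parabolic T) (hy : y ∈ cs.parabolic R) : Commute x y := by
  have h1 : ∀ i ∈ T, Commute (cs.simple i) y := by
    intro i hi
    have : cs.parabolic R ≤ Subgroup.centralizer {cs.simple i} :=
      cs.parabolic_le_iff_forall.2 fun j hj => Subgroup.mem_centralizer_singleton_iff.2
        (cs.commute_simple (h i hi j hj)).symm
    exact (Subgroup.mem_centralizer_singleton_iff.1 (this hy)).symm
  have : cs.parabolic T ≤ Subgroup.centralizer {y} :=
    cs.parabolic_le_iff_forall.2 fun i hi => Subgroup.mem_centralizer_singleton_iff.2 (h1 i hi)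
  exact Subgroup.mem_centralizer_singleton_iff.1 (this hx)

theorem exists_mul_of_mem_parabolic_union {T R : Set B} (h : ∀ i ∈ T, ∀ j ∈ R, M i j = 2) {w : W}
    (hw : w ∈ cs.parabolic (T ∪ R)) :
    ∃ x ∈ cs.parabolic T, ∃ y ∈ cs.parabolic R, w = x * y := by
  induction hw using Subgroup.closure_induction with
  | mem x hx =>
    obtain ⟨i, hi | hi, rfl⟩ := hx
    · exact ⟨_, cs.simple_mem_parabolic hi, 1, one_mem _, by simp⟩
    · exact ⟨1, one_mem _, _, cs.simple_mem_parabolic hi, by simp⟩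
  | one => exact ⟨1, one_mem _, 1, one_mem _, by simp⟩
  | mul a b _ _ ha hb =>
    obtain ⟨x, hx, y, hy, rfl⟩ := ha
    obtain ⟨x', hx', y', hy', rfl⟩ := hb
    refine ⟨x * x', mul_mem hx hx', y * y', mul_mem hy hy', ?_⟩
    rw [mul_assoc, ← mul_assoc y, ← (cs.commute_parabolic h hx' hy).eq]
    simp only [mul_assoc]
  | inv a _ ha =>
    obtain ⟨x, hx, y, hy, rfl⟩ := ha
    refine ⟨x⁻¹, inv_mem hx, y⁻¹, inv_mem hy, ?_⟩
    rw [mul_inv_rev, ((cs.commute_parabolic h hx hy).inv_inv).eq]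

/-! ### The Coxeter system of a parabolic subgroup -/

/-- A parabolic subgroup of an even Coxeter system is presented by the restricted matrix. -/
theorem exists_restrict (hM : M.IsEven) (T : Set B) :
    ∃ cs' : CoxeterSystem (M.restrict T) (cs.parabolic T),
      ∀ i, (cs'.simple i : W) = cs.simple i := by
  classical
  let cT := (M.restrict T).toCoxeterSystem
  -- The retraction onto the abstractly presented group. A relation with one killed generator holds
  -- because its exponent is even, the code 0 for ∞ included.
  let f : W →* (M.restrict T).Group := cs.lift ⟨fun i => if h : i ∈ T then cT.simple ⟨i, h⟩ else 1, by
    intro i j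
    by_cases hi : i ∈ T <;> by_cases hj : j ∈ T
    · simp only [hi, hj, dif_pos]
      exact cT.simple_mul_simple_pow ⟨i, hi⟩ ⟨j, hj⟩
    · obtain ⟨k, hk⟩ := hM i j fun h => hj (h ▸ hi)
      simp [hi, hj, hk, ← two_mul, pow_mul]
    · obtain ⟨k, hk⟩ := hM i j fun h => hi (h ▸ hj)
      simp [hi, hj, hk, ← two_mul, pow_mul]
    · simp [hi, hj]⟩
  have hf : ∀ i (hi : i ∈ T), f (cs.simple i) = cT.simple ⟨i, hi⟩ :=
    fun i hi => (cs.lift_apply_simple _ i).trans (dif_pos hi)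
  let g : (M.restrict T).Group →* cs.parabolic T := cT.lift
    ⟨fun i => ⟨cs.simple i, cs.simple_mem_parabolic i.2⟩, fun i j => Subtype.ext
      (cs.simple_mul_simple_pow i j)⟩
  have hg : ∀ i : T, g (cT.simple i) = ⟨cs.simple i, cs.simple_mem_parabolic i.2⟩ :=
    fun i => cT.lift_apply_simple _ i
  have hfg : ∀ x, f (g x) = x := by
    have : (f.comp (cs.parabolic T).subtype).comp g = MonoidHom.id _ :=
      cT.ext_simple fun i => by
        change f (g (cT.simple i)) = cT.simple i
        rw [hg]
        exact hf i i.2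
    exact fun x => DFunLike.congr_fun this x
  have hgf : ∀ w : cs.parabolic T, g (f w) = w := by
    rintro ⟨w, hw⟩
    apply Subtype.ext
    change (g (f w) : W) = w
    induction hw using Subgroup.closure_induction with
    | mem x hx =>
      obtain ⟨i, hi, rfl⟩ := hx
      rw [hf i hi, hg]
    | one => simp
    | mul x y _ _ hx hy => rw [map_mul, map_mul, Subgroup.coe_mul, hx, hy]
    | inv x _ hx => rw [map_inv, map_inv, Subgroup.coe_inv, hx]
  let e : (M.restrict T).Group ≃* cs.parabolic T :=
    { toFun := g, invFun := fun w => f w, left_inv := hfg, right_inv := hgf, map_mul' := map_mul g }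
  exact ⟨cT.map e, fun i => congrArg Subtype.val (hg i)⟩

theorem map_parabolic_restrict {T : Set B} {cs' : CoxeterSystem (M.restrict T) (cs.parabolic T)}
    (hcs' : ∀ i, (cs'.simple i : W) = cs.simple i) (R : Set T) :
    (cs'.parabolic R).map (cs.parabolic T).subtype = cs.parabolic (Subtype.val '' R) := by
  refine (MonoidHom.map_closure _ _).trans (congrArg Subgroup.closure ?_)
  rw [Set.image_image, Set.image_image]
  exact Set.image_congr fun i _ => hcs' i

theorem coe_mem_parabolic_iff {T : Set B} {cs' : CoxeterSystem (M.restrict T) (cs.parabolic T)}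
    (hcs' : ∀ i, (cs'.simple i : W) = cs.simple i) {R : Set T} {w : cs.parabolic T} :
    (w : W) ∈ cs.parabolic (Subtype.val '' R) ↔ w ∈ cs'.parabolic R := by
  rw [← cs.map_parabolic_restrict hcs' R]
  exact Subgroup.mem_map_iff_mem (cs.parabolic T).subtype_injective

theorem isSpherical_restrict_iff {T : Set B}
    {cs' : CoxeterSystem (M.restrict T) (cs.parabolic T)}
    (hcs' : ∀ i, (cs'.simple i : W) = cs.simple i) {R : Set T} :
    cs'.IsSpherical R ↔ cs.IsSpherical (Subtype.val '' R) := by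
  rw [IsSpherical, IsSpherical, ← cs.map_parabolic_restrict hcs' R]
  exact ((cs'.parabolic R).equivMapOfInjective _
    (cs.parabolic T).subtype_injective).toEquiv.finite_iff

theorem isEven_restrict (hM : M.IsEven) (T : Set B) : (M.restrict T).IsEven :=
  fun i j h => hM i j fun h' => h (Subtype.ext h')

/-! ### Spherical subsets of even Coxeter systems -/

theorem isSpherical_union {T R : Set B} (h : ∀ i ∈ T, ∀ j ∈ R, M i j = 2)
    (hT : cs.IsSpherical T) (hR : cs.IsSpherical R) : cs.IsSpherical (T ∪ R) := by
  have : (cs.parabolic (T ∪ R) : Set W) ⊆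
      Set.image2 (· * ·) (cs.parabolic T : Set W) (cs.parabolic R) := by
    intro w hw
    obtain ⟨x, hx, y, hy, rfl⟩ := cs.exists_mul_of_mem_parabolic_union h hw
    exact ⟨x, hx, y, hy, rfl⟩
  exact (Set.Finite.image2 _ (s := (cs.parabolic T : Set W)) hT hR).subset this

end CoxeterSystem

end

noncomputable section

/-! ### Spherical subsets of even Coxeter systems -/

namespace CoxeterSystem

open scoped Classical
open Polynomial.Chebyshev

variable {B W : Type*} [Group W] {M : CoxeterMatrix B} (cs : CoxeterSystem M W)

/-- The powers of the rotation st, together with their products with s, are closed under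
multiplication by both generators. -/
theorem isSpherical_pair {s t : B} (h : M s t ≠ 0) : cs.IsSpherical {s, t} := by
  let z := Subgroup.zpowers (cs.simple s * cs.simple t)
  have hz : (z : Set W).Finite := by
    have : IsOfFinOrder (cs.simple s * cs.simple t) :=
      isOfFinOrder_iff_pow_eq_one.2 ⟨M s t, Nat.pos_of_ne_zero h, cs.simple_mul_simple_pow s t⟩
    exact this.finite_zpowers
  refine (hz.union (hz.image (· * cs.simple s))).subset fun w hw => ?_
  have key : ∀ x y : W, y ∈ cs.simple '' {s, t} → x ∈ (z : Set W) ∪ (· * cs.simple s) '' (z : Set W) →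
      x * y ∈ (z : Set W) ∪ (· * cs.simple s) '' (z : Set W) := by
    rintro x _ ⟨i, hi, rfl⟩ (hx | ⟨x, hx, rfl⟩)
    · rcases hi with rfl | rfl
      · exact Or.inr ⟨x, hx, rfl⟩
      · refine Or.inr ⟨x * (cs.simple s * cs.simple i)⁻¹,
          mul_mem hx (inv_mem (Subgroup.mem_zpowers _)), ?_⟩
        simp [mul_assoc]
    · rcases hi with rfl | rfl
      · exact Or.inl (by simpa using hx)
      · refine Or.inl ?_
        rw [mul_assoc]
        exact mul_mem hx (Subgroup.mem_zpowers _)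
  induction hw using Subgroup.closure_induction_right with
  | one => exact Or.inl (one_mem z)
  | mul_right x _ y hy h => exact key x y hy h
  | mul_inv_cancel x _ y hy h =>
    obtain ⟨i, hi, rfl⟩ := hy
    rw [cs.inv_simple]
    exact key x _ ⟨i, hi, rfl⟩ h

/-- When m_st is infinite, killing the other generators maps W to the infinite dihedral group, where
the image of st has infinite order. -/
theorem isSpherical_pair_iff (hM : M.IsEven) {s t : B} : cs.IsSpherical {s, t} ↔ M s t ≠ 0 := by
  refine ⟨fun hfin h0 => ?_, cs.isSpherical_pair⟩
  have hst : s ≠ t := by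
    rintro rfl
    rw [M.diagonal] at h0
    exact one_ne_zero h0
  let g : B → DihedralGroup 0 := fun i =>
    if i = s then DihedralGroup.sr 0 else if i = t then DihedralGroup.sr 1 else 1
  have hg2 : ∀ i, g i * g i = 1 := by
    intro i
    by_cases h1 : i = s
    · simp [g, h1]
    · by_cases h2 : i = t
      · simp [g, h2, hst.symm]
      · simp [g, h1, h2]
  have hone : ∀ i, i ≠ s → i ≠ t → g i = 1 := fun i h1 h2 => by simp [g, h1, h2]
  have hlift : M.IsLiftable g := by
    intro i j
    by_cases hij : i = j
    · subst hij
      rw [M.diagonal, pow_one, hg2]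
    obtain ⟨k, hk⟩ := hM i j hij
    by_cases hi : i ≠ s ∧ i ≠ t
    · rw [hone i hi.1 hi.2, one_mul, hk, ← two_mul, pow_mul, pow_two, hg2, one_pow]
    by_cases hj : j ≠ s ∧ j ≠ t
    · rw [hone j hj.1 hj.2, mul_one, hk, ← two_mul, pow_mul, pow_two, hg2, one_pow]
    have : M i j = 0 := by
      have h0' : M t s = 0 := by rw [M.symmetric]; exact h0
      have hi' : i = s ∨ i = t := by tauto
      have hj' : j = s ∨ j = t := by tauto
      rcases hi' with rfl | rfl <;> rcases hj' with rfl | rfl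
      exacts [absurd rfl hij, h0, h0', absurd rfl hij]
    rw [this, pow_zero]
  let f : W →* DihedralGroup 0 := cs.lift ⟨g, hlift⟩
  have hf : f (cs.simple s * cs.simple t) = DihedralGroup.r 1 := by
    rw [map_mul, show f (cs.simple s) = g s from cs.lift_apply_simple hlift s,
      show f (cs.simple t) = g t from cs.lift_apply_simple hlift t]
    simp [g, hst.symm]
  have hmem : cs.simple s * cs.simple t ∈ cs.parabolic {s, t} :=
    mul_mem (cs.simple_mem_parabolic (Or.inl rfl)) (cs.simple_mem_parabolic (Or.inr rfl))
  have : Finite (cs.parabolic {s, t}) := hfin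
  have hfo : IsOfFinOrder (cs.simple s * cs.simple t) :=
    Submonoid.isOfFinOrder_coe.2 (isOfFinOrder_of_finite (⟨_, hmem⟩ : cs.parabolic {s, t}))
  have := f.isOfFinOrder hfo
  rw [hf, ← orderOf_pos_iff, DihedralGroup.orderOf_r_one] at this
  exact lt_irrefl _ this

end CoxeterSystem

namespace RankThree

open Module Polynomial.Chebyshev

/-- The order of a product of two reflections whose axes make the angle `π / m`. -/
theorem reflection_mul_reflection_pow_eq_one {V : Type*} [AddCommGroup V] [Module ℝ V] {x y : V}
    {f g : Dual ℝ V} (hf : f x = 2) (hg : g y = 2) {k : ℕ} (hk : 2 ≤ k)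
    (hxy : f y = -2 * Real.cos (Real.pi / (2 * k : ℕ)))
    (hyx : g x = -2 * Real.cos (Real.pi / (2 * k : ℕ))) :
    (reflection hf * reflection hg) ^ (2 * k) = 1 := by
  ext z
  have hk0 : (0 : ℝ) < k := by positivity
  have ht : f y * g x - 2 = 2 * Real.cos (Real.pi / k) := by
    have : Real.pi / k = 2 * (Real.pi / (2 * k : ℕ)) := by
      push_cast
      field_simp
    rw [hxy, hyx, this, Real.cos_two_mul]
    ring
  have hsin : Real.sin (Real.pi / k) ≠ 0 := by
    have hk2 : (2 : ℝ) ≤ k := by exact_mod_cast hk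
    refine (Real.sin_pos_of_pos_of_lt_pi (by positivity) ?_).ne'
    rw [div_lt_iff₀ hk0]
    nlinarith [Real.pi_pos]
  -- The formula for the power of exponent 2k involves only this Chebyshev polynomial, since (2k -
  -- 2)/2 and (2k - 1)/2 both round down to k - 1.
  have hS : (S ℝ ((k : ℤ) - 1)).eval (2 * Real.cos (Real.pi / k)) = 0 := by
    have := S_two_mul_real_cos (Real.pi / k) ((k : ℤ) - 1)
    have h2 : (((k : ℤ) - 1 : ℤ) + 1 : ℝ) * (Real.pi / k) = Real.pi := by
      push_cast
      field_simp
      ring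
    rw [h2, Real.sin_pi] at this
    exact (mul_eq_zero.1 this).resolve_right hsin
  rw [reflection_mul_reflection_pow_apply hf hg (2 * k) z, ht]
  have h1 : (((2 * k : ℕ) : ℤ) - 2) / 2 = (k : ℤ) - 1 := by push_cast; omega
  have h2 : (((2 * k : ℕ) : ℤ) - 1) / 2 = (k : ℤ) - 1 := by push_cast; omega
  rw [h1, h2, hS]
  simp

/-! ### A rank three reflection representation. -/

variable (p q : ℝ)

/-- The functionals `2 B(eᵢ, ·)` of the rank three form with `B(e₀, e₁) = -p`, `B(e₁, e₂) = -q` and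
`B(e₀, e₂) = 0`. -/
def root : Fin 3 → Dual ℝ (Fin 3 → ℝ)
  | 0 => 2 • LinearMap.proj 0 - (2 * p) • LinearMap.proj 1
  | 1 => 2 • LinearMap.proj 1 - (2 * p) • LinearMap.proj 0 - (2 * q) • LinearMap.proj 2
  | 2 => 2 • LinearMap.proj 2 - (2 * q) • LinearMap.proj 1

theorem root_self (i : Fin 3) : root p q i (Pi.single i 1) = 2 := by
  fin_cases i <;> simp [root]

/-- The generating reflections of the rank three group. -/
def gen (i : Fin 3) : (Fin 3 → ℝ) ≃ₗ[ℝ] (Fin 3 → ℝ) := reflection (root_self p q i)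

theorem gen_apply (i : Fin 3) (x : Fin 3 → ℝ) :
    gen p q i x = x - root p q i x • Pi.single i 1 := reflection_apply ..

theorem gen_mul_self (i : Fin 3) : gen p q i * gen p q i = 1 := by
  ext x : 1
  exact involutive_reflection (root_self p q i) x

theorem gen_zero_two : gen p q 0 * gen p q 2 = gen p q 2 * gen p q 0 := by
  ext x : 1
  simp only [LinearEquiv.mul_apply, gen_apply]
  ext i
  fin_cases i <;> simp [root]

/-- The vector with coordinates `a` on `e₁` and `b` on `p e₀ + q e₂`. -/
def planeVec (a b : ℝ) : Fin 3 → ℝ := ![b * p, a, b * q]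

/-- The Coxeter element preserves this plane, which reduces the order question to a two by two
matrix. -/
theorem coxeterElement_planeVec (a b : ℝ) :
    (gen p q 1 * gen p q 0 * gen p q 2) (planeVec p q a b) =
      planeVec p q ((4 * (p ^ 2 + q ^ 2) - 1) * a - 2 * (p ^ 2 + q ^ 2) * b) (2 * a - b) := by
  have h0 : planeVec p q a b 0 = b * p := rfl
  have h1 : planeVec p q a b 1 = a := rfl
  have h2 : planeVec p q a b 2 = b * q := rfl
  generalize planeVec p q a b = x at h0 h1 h2 ⊢
  simp only [LinearEquiv.mul_apply, gen_apply]
  ext i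
  fin_cases i <;> simp [root, planeVec, h0, h1, h2] <;> ring

/-- If the form is not positive definite, the Coxeter element has infinite order. -/
theorem not_isOfFinOrder_coxeterElement (hp : 0 < p) (hpq : 1 ≤ p ^ 2 + q ^ 2) :
    ¬ IsOfFinOrder (gen p q 1 * gen p q 0 * gen p q 2) := by
  rw [isOfFinOrder_iff_pow_eq_one]
  rintro ⟨n, hn, h⟩
  -- When p² + q² ≥ 1 the inequality a - b ≥ 1 persists, and each step increases b by 2(a - b) ≥ 2.
  have key : ∀ m : ℕ, ∃ a b : ℝ, ((gen p q 1 * gen p q 0 * gen p q 2) ^ m) (planeVec p q 1 0) =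
      planeVec p q a b ∧ 1 ≤ a - b ∧ 2 * m ≤ b := by
    intro m
    induction m with
    | zero => exact ⟨1, 0, rfl, by norm_num, by simp⟩
    | succ m ih =>
      obtain ⟨a, b, hab, h1, h2⟩ := ih
      have hb : 0 ≤ b := le_trans (by positivity) h2
      refine ⟨_, _, by rw [pow_succ', LinearEquiv.mul_apply, hab, coxeterElement_planeVec], ?_, ?_⟩
      · nlinarith [mul_nonneg (sub_nonneg.2 hpq) (sub_nonneg.2 h1), mul_nonneg (sub_nonneg.2 hpq) hb]
      · push_cast
        linarith
  obtain ⟨a, b, hab, -, hb⟩ := key n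
  rw [h] at hab
  have := congrFun hab 0
  simp only [LinearEquiv.coe_one, id_eq, planeVec, Matrix.cons_val_zero, zero_mul] at this
  have hbp : 0 < b * p := mul_pos (lt_of_lt_of_le (by positivity) hb) hp
  linarith

end RankThree

namespace CoxeterSystem

open scoped Classical
open RankThree

variable {B W : Type*} [Group W] {M : CoxeterMatrix B} (cs : CoxeterSystem M W)

/-- In a spherical subset of an even Coxeter system a generator fails to commute with at most one
other generator. -/
theorem eq_two_or_eq_two_of_isSpherical (hM : M.IsEven) {r s t : B} (hrs : r ≠ s) (hst : s ≠ t)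
    (hrt : r ≠ t) (h : cs.IsSpherical {r, s, t}) : M r s = 2 ∨ M s t = 2 := by
  by_contra! hne
  have hfin : ∀ {i j}, i ∈ ({r, s, t} : Set B) → j ∈ ({r, s, t} : Set B) → M i j ≠ 0 :=
    fun {i j} hi hj => (cs.isSpherical_pair_iff hM).1 (h.mono (by
      rintro x (rfl | rfl) <;> assumption))
  have hhalf : ∀ {i j}, i ≠ j → M i j ≠ 2 → M i j ≠ 0 → ∃ k : ℕ, 2 ≤ k ∧ M i j = 2 * k := by
    intro i j hij h2 h0
    obtain ⟨k, hk⟩ := hM i j hij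
    exact ⟨k, by omega, by omega⟩
  obtain ⟨k, hk, hMk⟩ := hhalf hrs hne.1 (hfin (by simp) (by simp))
  obtain ⟨l, hl, hMl⟩ := hhalf hst hne.2 (hfin (by simp) (by simp))
  -- An even label different from 2 is at least 4, so both cosines are at least √2/2 and their
  -- squares add up to at least 1.
  have hcos : ∀ k : ℕ, 2 ≤ k → Real.sqrt 2 / 2 ≤ Real.cos (Real.pi / (2 * k : ℕ)) := by
    intro k hk
    rw [← Real.cos_pi_div_four]
    have hk2 : (2 : ℝ) ≤ k := by exact_mod_cast hk
    have : Real.pi / (2 * k : ℕ) ≤ Real.pi / 4 := by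
      refine div_le_div_of_nonneg_left Real.pi_pos.le (by norm_num) ?_
      push_cast
      linarith
    exact Real.cos_le_cos_of_nonneg_of_le_pi (by positivity) (by linarith [Real.pi_pos]) this
  set p := Real.cos (Real.pi / (2 * k : ℕ)) with hp
  set q := Real.cos (Real.pi / (2 * l : ℕ)) with hq
  have hsq : (0 : ℝ) < Real.sqrt 2 := by positivity
  have hsq2 : Real.sqrt 2 ^ 2 = 2 := Real.sq_sqrt (by norm_num)
  have hpk := hcos k hk
  have hql := hcos l hl
  have hpq : 1 ≤ p ^ 2 + q ^ 2 := by nlinarith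
  let g : B → ((Fin 3 → ℝ) ≃ₗ[ℝ] (Fin 3 → ℝ)) := fun i =>
    if i = r then gen p q 0 else if i = s then gen p q 1 else if i = t then gen p q 2 else 1
  have hgr : g r = gen p q 0 := by simp [g]
  have hgs : g s = gen p q 1 := by simp [g, hrs.symm]
  have hgt : g t = gen p q 2 := by simp [g, hrt.symm, hst.symm]
  have hone : ∀ i, i ∉ ({r, s, t} : Set B) → g i = 1 := by
    intro i hi
    simp only [Set.mem_insert_iff, Set.mem_singleton_iff, not_or] at hi
    simp [g, hi]
  have hg2 : ∀ i, g i * g i = 1 := by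
    intro i
    by_cases hi : i ∈ ({r, s, t} : Set B)
    · rcases hi with rfl | rfl | rfl
      · rw [hgr, gen_mul_self]
      · rw [hgs, gen_mul_self]
      · rw [hgt, gen_mul_self]
    · rw [hone i hi, one_mul]
  have hswap : ∀ {i j : B} {n : ℕ}, (g i * g j) ^ n = 1 → (g j * g i) ^ n = 1 := by
    intro i j n hij
    have : g j * g i = (g i * g j)⁻¹ := by
      rw [eq_inv_iff_mul_eq_one, mul_assoc, ← mul_assoc (g i), hg2, one_mul, hg2]
    rw [this, inv_pow, hij, inv_one]
  have hrs' : (g r * g s) ^ M r s = 1 := by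
    rw [hgr, hgs, hMk]
    exact reflection_mul_reflection_pow_eq_one _ _ hk (by simp [root, hp]) (by simp [root, hp])
  have hst' : (g s * g t) ^ M s t = 1 := by
    rw [hgs, hgt, hMl]
    exact reflection_mul_reflection_pow_eq_one _ _ hl (by simp [root, hq]) (by simp [root, hq])
  -- The matrices for r and t commute, so their product squares to 1; any even label is compatible
  -- with this, infinite ones included.
  have hrt' : (g r * g t) ^ M r t = 1 := by
    obtain ⟨m, hm⟩ := hM r t hrt
    have : (g r * g t) ^ 2 = 1 := by
      have hc : g r * g t = g t * g r := by rw [hgr, hgt, gen_zero_two]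
      rw [pow_two]
      nth_rw 2 [hc]
      rw [mul_assoc, ← mul_assoc (g t), hg2, one_mul, hg2]
    rw [hm, ← two_mul, pow_mul, this, one_pow]
  have hlift : M.IsLiftable g := by
    intro i j
    by_cases hij : i = j
    · subst hij
      rw [M.diagonal, pow_one, hg2]
    obtain ⟨m, hm⟩ := hM i j hij
    by_cases hi : i ∈ ({r, s, t} : Set B)
    · by_cases hj : j ∈ ({r, s, t} : Set B)
      · rcases hi with rfl | rfl | rfl <;> rcases hj with rfl | rfl | rfl
        · exact absurd rfl hij
        · exact hrs'
        · exact hrt'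
        · rw [M.symmetric]; exact hswap hrs'
        · exact absurd rfl hij
        · exact hst'
        · rw [M.symmetric]; exact hswap hrt'
        · rw [M.symmetric]; exact hswap hst'
        · exact absurd rfl hij
      · rw [hone j hj, mul_one, hm, ← two_mul, pow_mul, pow_two, hg2, one_pow]
    · rw [hone i hi, one_mul, hm, ← two_mul, pow_mul, pow_two, hg2, one_pow]
  let f : W →* ((Fin 3 → ℝ) ≃ₗ[ℝ] (Fin 3 → ℝ)) := cs.lift ⟨g, hlift⟩
  have hf : ∀ i, f (cs.simple i) = g i := cs.lift_apply_simple hlift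
  have hmem : cs.simple s * cs.simple r * cs.simple t ∈ cs.parabolic {r, s, t} :=
    mul_mem (mul_mem (cs.simple_mem_parabolic (by simp)) (cs.simple_mem_parabolic (by simp)))
      (cs.simple_mem_parabolic (by simp))
  have : Finite (cs.parabolic {r, s, t}) := h
  have hfo := f.isOfFinOrder (Submonoid.isOfFinOrder_coe.2
    (isOfFinOrder_of_finite (⟨_, hmem⟩ : cs.parabolic {r, s, t})))
  rw [map_mul, map_mul, hf, hf, hf, hgr, hgs, hgt] at hfo
  exact not_isOfFinOrder_coxeterElement p q (by linarith) hpq hfo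

/-- If the nerve is flag, a set of generators is spherical as soon as its pairs are. -/
theorem isSpherical_of_isFlag [Finite B] (hflag : cs.nerve.IsFlag) {T : Set B}
    (h : ∀ i ∈ T, ∀ j ∈ T, M i j ≠ 0) : cs.IsSpherical T := by
  rcases T.eq_empty_or_nonempty with rfl | hT
  · exact cs.isSpherical_empty
  have hfin := T.toFinite
  have := (hflag hfin.toFinset (by simpa using hT) fun i hi j hj => ⟨⟨i, by simp⟩, by
    simpa using cs.isSpherical_pair (h i (by simpa using hi) j (by simpa using hj))⟩).2
  simpa using this

theorem isSpherical_iff [Finite B] (hM : M.IsEven) (hflag : cs.nerve.IsFlag) {T : Set B} :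
    cs.IsSpherical T ↔ ∀ i ∈ T, ∀ j ∈ T, M i j ≠ 0 :=
  ⟨fun h _ hi _ hj => (cs.isSpherical_pair_iff hM).1 (h.mono (by
    rintro x (rfl | rfl) <;> assumption)), cs.isSpherical_of_isFlag hflag⟩

end CoxeterSystem

end

noncomputable section

/-! ### Embeddings onto unions of components -/

namespace PreAbstractSimplicialComplex

open scoped Classical

section

variable {V V' : Type*}

/-- `φ` identifies `Y` with a union of components of `X`. -/
structure IsComponentEmbedding (Y : PreAbstractSimplicialComplex V')
    (X : PreAbstractSimplicialComplex V) (φ : V' → V) : Prop where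
  injective : Function.Injective φ
  image_mem_iff : ∀ τ : Finset V', τ.image φ ∈ X.faces ↔ τ ∈ Y.faces
  mem_range : ∀ σ ∈ X.faces, ∀ y, φ y ∈ σ → ∀ v ∈ σ, v ∈ Set.range φ

variable {X : PreAbstractSimplicialComplex V} {Y : PreAbstractSimplicialComplex V'} {φ : V' → V}

namespace IsComponentEmbedding

theorem singleton_mem_iff (h : IsComponentEmbedding Y X φ) {y : V'} :
    {φ y} ∈ X.faces ↔ {y} ∈ Y.faces := by
  rw [← h.image_mem_iff, Finset.image_singleton]

theorem pair_mem_iff (h : IsComponentEmbedding Y X φ) {y z : V'} :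
    {φ y, φ z} ∈ X.faces ↔ {y, z} ∈ Y.faces := by
  rw [← h.image_mem_iff, Finset.image_insert, Finset.image_singleton]

theorem linkAdj_iff (h : IsComponentEmbedding Y X φ) {v a b : V'} :
    X.LinkAdj (φ v) (φ a) (φ b) ↔ Y.LinkAdj v a b := by
  rw [LinkAdj, LinkAdj, h.injective.ne_iff, h.injective.ne_iff, h.injective.ne_iff,
    ← h.image_mem_iff, Finset.image_insert, Finset.image_insert, Finset.image_singleton]

theorem exists_of_pair_mem (h : IsComponentEmbedding Y X φ) {v : V'} {a : V}
    (ha : {φ v, a} ∈ X.faces) : ∃ b, φ b = a :=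
  h.mem_range _ ha v (by simp) a (by simp)

theorem edgeReachable (h : IsComponentEmbedding Y X φ) {x y : V'} (hxy : Y.EdgeReachable x y) :
    X.EdgeReachable (φ x) (φ y) := by
  induction hxy with
  | refl => exact Relation.ReflTransGen.refl
  | tail _ hyz ih =>
    obtain ⟨σ, hσ, hy, hz⟩ := hyz
    exact ih.tail ⟨σ.image φ, (h.image_mem_iff σ).2 hσ, Finset.mem_image_of_mem _ hy,
      Finset.mem_image_of_mem _ hz⟩

theorem infinite_setOf_edgeReachable (h : IsComponentEmbedding Y X φ) {y : V'}
    (hy : {z | Y.EdgeReachable y z}.Infinite) : {w | X.EdgeReachable (φ y) w}.Infinite :=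
  (hy.image h.injective.injOn).mono (by
    rintro _ ⟨z, hz, rfl⟩
    exact h.edgeReachable hz)

theorem nonempty_iso (h : IsComponentEmbedding Y X φ)
    (hsurj : ∀ v, {v} ∈ X.faces → v ∈ Set.range φ) : Nonempty (Iso X Y) := by
  let f : Y.Vertex → X.Vertex := fun y => ⟨φ y.1, h.singleton_mem_iff.2 y.2⟩
  have hf : Function.Bijective f := by
    refine ⟨fun y z hyz => Subtype.ext (h.injective (congrArg Subtype.val hyz)), ?_⟩
    rintro ⟨v, hv⟩
    obtain ⟨y, rfl⟩ := hsurj v hv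
    exact ⟨⟨y, h.singleton_mem_iff.1 hv⟩, rfl⟩
  have hiso : Iso Y X :=
    { toEquiv := Equiv.ofBijective f hf
      map_faces := fun σ => by
        rw [← h.image_mem_iff]
        refine iff_of_eq (congrArg (· ∈ X.faces) ?_)
        ext v
        constructor
        · intro hv
          obtain ⟨x, hx, rfl⟩ := Finset.mem_image.1 hv
          obtain ⟨y, hy, rfl⟩ := Finset.mem_map.1 hx
          exact Finset.mem_map.2 ⟨f y, Finset.mem_map.2 ⟨y, hy, rfl⟩, rfl⟩
        · intro hv
          obtain ⟨x, hx, rfl⟩ := Finset.mem_map.1 hv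
          obtain ⟨y, hy, rfl⟩ := Finset.mem_map.1 hx
          exact Finset.mem_image.2 ⟨y.1, Finset.mem_map.2 ⟨y, hy, rfl⟩, rfl⟩ }
  exact ⟨hiso.symm⟩

end IsComponentEmbedding

/-- A complex covered by unions of components that are closed surfaces is a closed surface. -/
theorem isClosedSurface_of_cover {X : PreAbstractSimplicialComplex V}
    (h : ∀ v, {v} ∈ X.faces → ∃ (V' : Type*) (Y : PreAbstractSimplicialComplex V') (φ : V' → V),
      Y.IsClosedSurface ∧ IsComponentEmbedding Y X φ ∧ v ∈ Set.range φ) :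
    X.IsClosedSurface where
  card_le := by
    intro σ hσ
    obtain ⟨v, hv⟩ := nonempty_of_mem_faces hσ
    obtain ⟨V', Y, φ, hY, hφ, y, rfl⟩ := h v (singleton_mem_of_mem hσ hv)
    have hsub : (σ : Set V) ⊆ Set.range φ := hφ.mem_range σ hσ y hv
    obtain ⟨τ, rfl⟩ : ∃ τ : Finset V', τ.image φ = σ := by
      obtain ⟨τ, -, hτ⟩ := Finset.subset_set_image_iff.1 (Set.image_univ ▸ hsub)
      exact ⟨τ, hτ⟩
    rw [Finset.card_image_of_injective _ hφ.injective]
    exact hY.card_le τ ((hφ.image_mem_iff τ).1 hσ)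
  exists_two := by
    intro v a hav hva
    obtain ⟨V', Y, φ, hY, hφ, v, rfl⟩ := h v (singleton_mem_of_mem hva (by simp))
    obtain ⟨a, rfl⟩ := hφ.exists_of_pair_mem hva
    obtain ⟨b₁, b₂, hne, hb⟩ := hY.exists_two v a (hφ.injective.ne_iff.1 hav)
      (hφ.pair_mem_iff.1 hva)
    refine ⟨φ b₁, φ b₂, hφ.injective.ne hne, fun b => ⟨fun hadj => ?_, ?_⟩⟩
    · obtain ⟨b, rfl⟩ := hφ.exists_of_pair_mem hadj.edge_right
      rw [hφ.linkAdj_iff, hb] at hadj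
      exact hadj.imp (congrArg φ) (congrArg φ)
    · rintro (rfl | rfl)
      · exact hφ.linkAdj_iff.2 ((hb _).2 (Or.inl rfl))
      · exact hφ.linkAdj_iff.2 ((hb _).2 (Or.inr rfl))
  link_finite := by
    intro v
    by_cases hv : {v} ∈ X.faces
    · obtain ⟨V', Y, φ, hY, hφ, v, rfl⟩ := h v hv
      refine ((hY.link_finite v).image φ).subset ?_
      rintro a ⟨hav, hva⟩
      obtain ⟨a, rfl⟩ := hφ.exists_of_pair_mem hva
      exact ⟨a, ⟨hφ.injective.ne_iff.1 hav, hφ.pair_mem_iff.1 hva⟩, rfl⟩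
    · refine Set.finite_empty.subset ?_
      rintro a ⟨-, hva⟩
      exact hv (singleton_mem_of_mem hva (by simp))
  link_nonempty := by
    intro v hv
    obtain ⟨V', Y, φ, hY, hφ, v, rfl⟩ := h v hv
    obtain ⟨a, hav, hva⟩ := hY.link_nonempty v (hφ.singleton_mem_iff.1 hv)
    exact ⟨φ a, hφ.injective.ne hav, hφ.pair_mem_iff.2 hva⟩
  link_connected := by
    intro v a b hav hva hbv hvb
    obtain ⟨V', Y, φ, hY, hφ, v, rfl⟩ := h v (singleton_mem_of_mem hva (by simp))
    obtain ⟨a, rfl⟩ := hφ.exists_of_pair_mem hva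
    obtain ⟨b, rfl⟩ := hφ.exists_of_pair_mem hvb
    exact (hY.link_connected v a b (hφ.injective.ne_iff.1 hav) (hφ.pair_mem_iff.1 hva)
      (hφ.injective.ne_iff.1 hbv) (hφ.pair_mem_iff.1 hvb)).lift φ fun _ _ => hφ.linkAdj_iff.2
  no_triangle := by
    intro v a b c hab hbc hac
    obtain ⟨V', Y, φ, hY, hφ, v, rfl⟩ := h v (singleton_mem_of_mem hab.edge_left (by simp))
    obtain ⟨a, rfl⟩ := hφ.exists_of_pair_mem hab.edge_left
    obtain ⟨b, rfl⟩ := hφ.exists_of_pair_mem hab.edge_right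
    obtain ⟨c, rfl⟩ := hφ.exists_of_pair_mem hbc.edge_right
    exact hY.no_triangle v a b c (hφ.linkAdj_iff.1 hab) (hφ.linkAdj_iff.1 hbc)
      (hφ.linkAdj_iff.1 hac)

end

/-! ### Order complexes -/

variable {P P' : Type*} [PartialOrder P] [PartialOrder P']

theorem mem_faces_orderComplex {σ : Finset P} :
    σ ∈ (orderComplex P).faces ↔ σ.Nonempty ∧ ∀ a ∈ σ, ∀ b ∈ σ, a ≤ b ∨ b ≤ a := by
  refine and_congr_right fun _ => ⟨fun h a ha b hb => ?_, fun h a ha b hb _ => h a ha b hb⟩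
  exact h.total ha hb

theorem pair_mem_faces_orderComplex {_ : DecidableEq P} {a b : P} :
    {a, b} ∈ (orderComplex P).faces ↔ a ≤ b ∨ b ≤ a := by
  rw [mem_faces_orderComplex]
  refine ⟨fun h => h.2 a (by simp) b (by simp), fun h => ⟨⟨a, by simp⟩, ?_⟩⟩
  simp only [Finset.mem_insert, Finset.mem_singleton]
  rintro _ (rfl | rfl) _ (rfl | rfl)
  exacts [Or.inl le_rfl, h, h.symm, Or.inl le_rfl]

theorem triple_mem_faces_orderComplex {_ : DecidableEq P} {a b c : P} :
    {a, b, c} ∈ (orderComplex P).faces ↔ (a ≤ b ∨ b ≤ a) ∧ (a ≤ c ∨ c ≤ a) ∧ (b ≤ c ∨ c ≤ b) := by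
  rw [mem_faces_orderComplex]
  refine ⟨fun h => ⟨h.2 a (by simp) b (by simp), h.2 a (by simp) c (by simp),
    h.2 b (by simp) c (by simp)⟩, fun h => ⟨⟨a, by simp⟩, ?_⟩⟩
  obtain ⟨h1, h2, h3⟩ := h
  simp only [Finset.mem_insert, Finset.mem_singleton]
  rintro _ (rfl | rfl | rfl) _ (rfl | rfl | rfl)
  exacts [Or.inl le_rfl, h1, h2, h1.symm, Or.inl le_rfl, h3, h2.symm, h3.symm, Or.inl le_rfl]

/-- Simplices are chains, so it suffices that the image is closed under comparability inside Z. -/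
theorem isComponentEmbedding_orderComplex {Z : Set P} (φ : P' ↪o P) (hZ : ∀ x, φ x ∈ Z)
    (hcl : ∀ q ∈ Z, ∀ x, q ≤ φ x ∨ φ x ≤ q → q ∈ Set.range φ) :
    IsComponentEmbedding (orderComplex P') ((orderComplex P).restrictTo Z) φ where
  injective := φ.injective
  image_mem_iff := by
    intro τ
    change (τ.image φ ∈ (orderComplex P).faces ∧ ∀ v ∈ τ.image φ, v ∈ Z) ↔ _
    rw [mem_faces_orderComplex, mem_faces_orderComplex, Finset.image_nonempty]
    simp only [Finset.forall_mem_image, φ.le_iff_le]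
    exact ⟨fun h => h.1, fun h => ⟨h, fun x _ => hZ x⟩⟩
  mem_range := by
    rintro σ ⟨hσ, hσZ⟩ y hy v hv
    exact hcl v (hσZ v hv) y ((mem_faces_orderComplex.1 hσ).2 v hv _ hy)

theorem linkAdj_orderComplex {v a b : P} : (orderComplex P).LinkAdj v a b ↔
    a ≠ v ∧ b ≠ v ∧ b ≠ a ∧ (v ≤ a ∨ a ≤ v) ∧ (v ≤ b ∨ b ≤ v) ∧ (a ≤ b ∨ b ≤ a) := by
  rw [LinkAdj, triple_mem_faces_orderComplex]

/-- In an order complex without simplices of dimension `3` vertex links contain no triangle. -/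
theorem not_linkAdj_of_card_le (h : ∀ σ ∈ (orderComplex P).faces, σ.card ≤ 3) {v a b c : P}
    (hab : (orderComplex P).LinkAdj v a b) (hbc : (orderComplex P).LinkAdj v b c) :
    ¬ (orderComplex P).LinkAdj v a c := by
  intro hac
  rw [linkAdj_orderComplex] at hab hbc hac
  obtain ⟨a1, a2, a3, a4, a5, a6⟩ := hab
  obtain ⟨b1, b2, b3, b4, b5, b6⟩ := hbc
  obtain ⟨c1, c2, c3, c4, c5, c6⟩ := hac
  have hface : ({v, a, b, c} : Finset P) ∈ (orderComplex P).faces := by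
    rw [mem_faces_orderComplex]
    refine ⟨⟨v, by simp⟩, ?_⟩
    simp only [Finset.mem_insert, Finset.mem_singleton]
    rintro _ (rfl | rfl | rfl | rfl) _ (rfl | rfl | rfl | rfl)
    exacts [Or.inl le_rfl, a4, a5, b5, a4.symm, Or.inl le_rfl, a6, c6, a5.symm, a6.symm,
      Or.inl le_rfl, b6, b5.symm, c6.symm, b6.symm, Or.inl le_rfl]
  have hcard : ({v, a, b, c} : Finset P).card = 4 :=
    Finset.card_eq_of_equiv_fin (Fintype.equivFinOfCardEq (by
      rw [Fintype.card_coe, Finset.card_insert_of_notMem, Finset.card_insert_of_notMem,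
        Finset.card_pair b3.symm] <;>
      simp [a1.symm, a2.symm, a3.symm, b2.symm, c3.symm]))
  have := h _ hface
  omega

end PreAbstractSimplicialComplex

end

noncomputable section

/-! ### Davis complexes of dimension two -/

namespace CoxeterSystem

open PreAbstractSimplicialComplex
open scoped Classical

variable {B W : Type*} [Group W] {M : CoxeterMatrix B} (cs : CoxeterSystem M W)

theorem reflTransGen_symm {α : Type*} {r : α → α → Prop} (hr : ∀ a b, r a b → r b a) {a b : α}
    (h : Relation.ReflTransGen r a b) : Relation.ReflTransGen r b a :=
  Relation.ReflTransGen.mono (fun a b h => hr b a h) _ _ (Relation.ReflTransGen.swap _ _ h)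

theorem exists_of_coset_le {w : W} {T : Set B} {hT : cs.IsSpherical T} {C : cs.SphericalCoset}
    (h : cs.coset w T hT ≤ C) : ∃ (R : Set B) (hR : cs.IsSpherical R), C = cs.coset w R hR := by
  obtain ⟨x, R, hR, rfl⟩ := cs.exists_eq_coset C
  exact ⟨R, hR, cs.coset_eq_of_mem (h (cs.mem_coset_iff.2 (by simp)))⟩

theorem exists_of_le_coset (hM : M.IsEven) {w : W} {T : Set B} {hT : cs.IsSpherical T}
    {C : cs.SphericalCoset} (h : C ≤ cs.coset w T hT) :
    ∃ y ∈ cs.parabolic T, ∃ (R : Set B) (hR : cs.IsSpherical R), R ⊆ T ∧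
      C = cs.coset (w * y) R hR := by
  obtain ⟨x, R, hR, rfl⟩ := cs.exists_eq_coset C
  rw [cs.coset_le_iff hM] at h
  exact ⟨w⁻¹ * x, h.2, R, hR, h.1, by rw [mul_inv_cancel_left]⟩

theorem coset_le_coset_iff_subset (hM : M.IsEven) {w : W} {T R : Set B} {hT : cs.IsSpherical T}
    {hR : cs.IsSpherical R} : cs.coset w T hT ≤ cs.coset w R hR ↔ T ⊆ R := by
  rw [cs.coset_le_iff hM]
  simp

theorem coset_inj (hM : M.IsEven) {w : W} {T R : Set B} {hT : cs.IsSpherical T}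
    {hR : cs.IsSpherical R} : cs.coset w T hT = cs.coset w R hR ↔ T = R := by
  rw [cs.coset_eq_iff hM]
  simp

theorem vertex_injective : Function.Injective cs.vertex := by
  intro x y h
  have : x ∈ (cs.coset y ∅ cs.isSpherical_empty).1 := by
    rw [show cs.coset y ∅ cs.isSpherical_empty = cs.coset x ∅ cs.isSpherical_empty from h.symm]
    exact cs.mem_coset_iff.2 (by simp)
  rw [mem_coset_iff, parabolic_empty, Subgroup.mem_bot, inv_mul_eq_one] at this
  exact this.symm

/-- An expression in the generators of Q is an edge path in the Coxeter cellulation; in the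
barycentric subdivision each step passes through the coset of type {i}. -/
theorem edgeReachable_vertex {Z : Set cs.SphericalCoset} {Q : Set B} {v : W}
    (hv : ∀ y ∈ cs.parabolic Q, cs.vertex (v * y) ∈ Z)
    (he : ∀ y ∈ cs.parabolic Q, ∀ i ∈ Q, ∃ hi, cs.coset (v * y) {i} hi ∈ Z) {y : W}
    (hy : y ∈ cs.parabolic Q) :
    (cs.davisComplex.restrictTo Z).EdgeReachable (cs.vertex v) (cs.vertex (v * y)) := by
  have step : ∀ y ∈ cs.parabolic Q, ∀ i ∈ Q, (cs.davisComplex.restrictTo Z).EdgeReachable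
      (cs.vertex v) (cs.vertex (v * y)) → (cs.davisComplex.restrictTo Z).EdgeReachable
      (cs.vertex v) (cs.vertex (v * (y * cs.simple i))) := by
    intro y hy i hi h
    obtain ⟨hi', hmem⟩ := he y hy i hi
    refine (h.tail (b := cs.vertex (v * y)) (c := cs.coset (v * y) {i} hi')
      ⟨{cs.vertex (v * y), cs.coset (v * y) {i} hi'}, ⟨?_, ?_⟩, by simp, by simp⟩).tail
      ⟨{cs.coset (v * y) {i} hi', cs.vertex (v * (y * cs.simple i))}, ⟨?_, ?_⟩, by simp, by simp⟩
    · exact pair_mem_faces_orderComplex.2 (Or.inl (cs.coset_le_of_subset (Set.empty_subset _)))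
    · simp only [Finset.mem_insert, Finset.mem_singleton]
      rintro _ (rfl | rfl)
      exacts [hv y hy, hmem]
    · refine pair_mem_faces_orderComplex.2 (Or.inr ?_)
      rw [cs.coset_eq_of_mem (x := v * (y * cs.simple i)) (w := v * y) (cs.mem_coset_iff.2 ?_)]
      · exact cs.coset_le_of_subset (Set.empty_subset _)
      · rw [← mul_assoc v, inv_mul_cancel_left]
        exact cs.simple_mem_parabolic rfl
    · simp only [Finset.mem_insert, Finset.mem_singleton]
      rintro _ (rfl | rfl)
      exacts [hmem, hv _ (mul_mem hy (cs.simple_mem_parabolic hi))]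
  induction hy using Subgroup.closure_induction_right with
  | one => rw [mul_one]; exact Relation.ReflTransGen.refl
  | mul_right x hx y hy h =>
    obtain ⟨i, hi, rfl⟩ := hy
    exact step x hx i hi h
  | mul_inv_cancel x hx y hy h =>
    obtain ⟨i, hi, rfl⟩ := hy
    rw [cs.inv_simple]
    exact step x hx i hi h

theorem isSpherical_singleton (i : B) : cs.IsSpherical {i} := by
  have := cs.isSpherical_pair (s := i) (t := i) (by rw [M.diagonal]; exact one_ne_zero)
  rwa [Set.pair_eq_singleton] at this

theorem edgeReachable_davisComplex (C : cs.SphericalCoset) :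
    cs.davisComplex.EdgeReachable (cs.vertex 1) C := by
  obtain ⟨w, T, hT, rfl⟩ := cs.exists_eq_coset C
  have h := cs.edgeReachable_vertex (Z := Set.univ) (Q := Set.univ) (v := 1) (fun _ _ => trivial)
    (fun _ _ i _ => ⟨cs.isSpherical_singleton i, trivial⟩) (y := w)
    (by rw [parabolic_univ]; trivial)
  rw [one_mul] at h
  refine Relation.ReflTransGen.tail (b := cs.vertex w)
    (Relation.ReflTransGen.mono (fun _ _ ⟨σ, hσ, h⟩ => ⟨σ, hσ.1, h⟩) _ _ h)
    ⟨{cs.vertex w, cs.coset w T hT}, ?_, by simp, by simp⟩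
  exact pair_mem_faces_orderComplex.2 (Or.inl (cs.coset_le_of_subset (Set.empty_subset _)))

theorem infinite_setOf_edgeReachable_davisComplex [Infinite W] (C : cs.SphericalCoset) :
    {D | cs.davisComplex.EdgeReachable C D}.Infinite := by
  have hsymm : ∀ {C D}, cs.davisComplex.EdgeReachable C D → cs.davisComplex.EdgeReachable D C :=
    fun h => reflTransGen_symm (fun _ _ ⟨σ, hσ, hx, hy⟩ => ⟨σ, hσ, hy, hx⟩) h
  refine (Set.infinite_range_of_injective cs.vertex_injective).mono ?_
  rintro _ ⟨w, rfl⟩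
  exact (hsymm (cs.edgeReachable_davisComplex C)).trans (cs.edgeReachable_davisComplex _)

theorem countable_of_finite [Finite B] (cs : CoxeterSystem M W) : Countable W :=
  Function.Surjective.countable cs.wordProd_surjective

instance [Finite B] [Countable W] : Countable cs.SphericalCoset := by
  have : Function.Surjective fun p : W × {T : Set B // cs.IsSpherical T} =>
      cs.coset p.1 p.2.1 p.2.2 := by
    intro C
    obtain ⟨w, T, hT, rfl⟩ := cs.exists_eq_coset C
    exact ⟨(w, ⟨T, hT⟩), rfl⟩
  exact this.countable

/-- The nerve is a cycle graph. -/
structure HasCycleNerve : Prop where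
  nonempty : Nonempty B
  eq_or : ∀ T, cs.IsSpherical T → T = ∅ ∨ (∃ i, T = {i}) ∨ ∃ i j, i ≠ j ∧ T = {i, j}
  exists_two : ∀ i, ∃ j₁ j₂, j₁ ≠ j₂ ∧ ∀ j, (j ≠ i ∧ cs.IsSpherical {i, j}) ↔ j = j₁ ∨ j = j₂
  connected : ∀ i j, Relation.ReflTransGen (fun a b => b ≠ a ∧ cs.IsSpherical {a, b}) i j

/-! ### Cosets when the nerve is a cycle. -/

variable {cs}

theorem HasCycleNerve.eq_pair_of_subset (h : cs.HasCycleNerve) {i j : B} (hij : i ≠ j) {T : Set B}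
    (hT : cs.IsSpherical T) (hsub : {i, j} ⊆ T) : T = {i, j} := by
  have hi : i ∈ T := hsub (by simp)
  have hj : j ∈ T := hsub (by simp)
  rcases h.eq_or T hT with rfl | ⟨k, rfl⟩ | ⟨k, l, hkl, rfl⟩
  · exact absurd hi (by simp)
  · exact absurd (hi.trans hj.symm) hij
  · simp only [Set.mem_insert_iff, Set.mem_singleton_iff] at hi hj
    rcases hi with rfl | rfl <;> rcases hj with rfl | rfl
    exacts [absurd rfl hij, rfl, Set.pair_comm _ _, absurd rfl hij]

theorem HasCycleNerve.exists_eq_pair (h : cs.HasCycleNerve) {i : B} {T : Set B}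
    (hT : cs.IsSpherical T) (hi : i ∈ T) (hne : T ≠ {i}) : ∃ j, j ≠ i ∧ T = {i, j} := by
  rcases h.eq_or T hT with rfl | ⟨k, rfl⟩ | ⟨k, l, hkl, rfl⟩
  · exact absurd hi (by simp)
  · exact absurd (by rw [Set.mem_singleton_iff.1 hi]) hne
  · rcases hi with rfl | rfl
    exacts [⟨l, hkl.symm, rfl⟩, ⟨k, hkl, Set.pair_comm _ _⟩]

/-- Along a chain of cosets the types strictly increase, and their cardinalities can only be 0, 1
and 2. -/
theorem HasCycleNerve.card_le (h : cs.HasCycleNerve) (hM : M.IsEven) {σ : Finset cs.SphericalCoset}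
    (hσ : σ ∈ (orderComplex cs.SphericalCoset).faces) : σ.card ≤ 3 := by
  choose w T hT hC using cs.exists_eq_coset
  have hfin : ∀ C, (T C).Finite ∧ (T C).ncard < 3 := by
    intro C
    rcases h.eq_or (T C) (hT C) with h | ⟨i, h⟩ | ⟨i, j, hij, h⟩ <;> rw [h]
    · simp
    · simp
    · exact ⟨Set.toFinite _, by rw [Set.ncard_pair hij]; norm_num⟩
  have hlt : ∀ C D : cs.SphericalCoset, C ≤ D → C ≠ D → (T C).ncard < (T D).ncard := by
    intro C D hle hne
    refine Set.ncard_lt_ncard (Set.ssubset_iff_subset_ne.2 ⟨?_, fun heq => hne ?_⟩) (hfin D).1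
    · have h1 := hle
      rw [hC C, hC D, cs.coset_le_iff hM] at h1
      exact h1.1
    · have h1 := hle
      rw [hC C, hC D, cs.coset_le_iff hM] at h1
      rw [hC C, hC D, cs.coset_eq_iff hM]
      exact ⟨heq, h1.2⟩
  rw [← Finset.card_range 3]
  refine Finset.card_le_card_of_injOn (fun C => (T C).ncard)
    (fun C _ => Finset.mem_coe.2 (Finset.mem_range.2 (hfin C).2)) fun C hC' D hD heq => ?_
  by_contra hne
  rcases (mem_faces_orderComplex.1 hσ).2 C hC' D hD with hle | hle
  · exact (hlt C D hle hne).ne heq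
  · exact (hlt D C hle (Ne.symm hne)).ne heq.symm

theorem linkAdj_coset_iff (hM : M.IsEven) {w : W} {T R Q : Set B} {hT : cs.IsSpherical T}
    {hR : cs.IsSpherical R} {hQ : cs.IsSpherical Q} :
    (orderComplex cs.SphericalCoset).LinkAdj (cs.coset w T hT) (cs.coset w R hR)
      (cs.coset w Q hQ) ↔ R ≠ T ∧ Q ≠ T ∧ Q ≠ R ∧ (T ⊆ R ∨ R ⊆ T) ∧ (T ⊆ Q ∨ Q ⊆ T) ∧
        (R ⊆ Q ∨ Q ⊆ R) := by
  simp only [linkAdj_orderComplex, ne_eq, cs.coset_inj hM, cs.coset_le_coset_iff_subset hM]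

theorem exists_of_comparable_vertex (hM : M.IsEven) {w : W} {hT : cs.IsSpherical ∅}
    {C : cs.SphericalCoset} (h : cs.coset w ∅ hT ≤ C ∨ C ≤ cs.coset w ∅ hT) :
    ∃ (R : Set B) (hR : cs.IsSpherical R), C = cs.coset w R hR := by
  rcases h with h | h
  · exact cs.exists_of_coset_le h
  · obtain ⟨y, hy, Q, hQ, hsub, rfl⟩ := cs.exists_of_le_coset hM h
    rw [parabolic_empty, Subgroup.mem_bot] at hy
    exact ⟨Q, hQ, by rw [hy, mul_one]⟩

/-- The third member of a chain is one of two: above a vertex and an edge, the two nerve neighbors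
of i; between a vertex and a polygon, the two sides at that vertex; below an edge and a polygon, the
two ends of the edge. -/
theorem HasCycleNerve.exists_two_of_le (h : cs.HasCycleNerve) (hM : M.IsEven)
    {C D : cs.SphericalCoset} (hne : D ≠ C) (hle : C ≤ D) : ∃ b₁ b₂, b₁ ≠ b₂ ∧
      ∀ b, (orderComplex cs.SphericalCoset).LinkAdj C D b ↔ b = b₁ ∨ b = b₂ := by
  obtain ⟨w, T, hT, rfl⟩ := cs.exists_eq_coset C
  obtain ⟨R, hR, rfl⟩ := cs.exists_of_coset_le hle
  have hTR := (cs.coset_le_coset_iff_subset hM).1 hle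
  rw [ne_eq, cs.coset_inj hM] at hne
  have hpair : ∀ {i j : B}, i ≠ j → ∀ k, ({k} : Set B) ≠ {i, j} := fun {i j} hij k he =>
    hij ((he.symm.subset (by simp : i ∈ ({i, j} : Set B))).trans
      (he.symm.subset (by simp : j ∈ ({i, j} : Set B))).symm)
  rcases h.eq_or R hR with rfl | ⟨i, rfl⟩ | ⟨i, j, hij, rfl⟩
  · exact absurd (Set.subset_empty_iff.1 hTR).symm hne
  · obtain rfl | rfl := Set.subset_singleton_iff_eq.1 hTR
    swap
    · exact absurd rfl hne
    obtain ⟨j₁, j₂, hj, hj'⟩ := h.exists_two i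
    have h1 := (hj' j₁).2 (Or.inl rfl)
    have h2 := (hj' j₂).2 (Or.inr rfl)
    have hup : ∀ j, j ≠ i → ∀ hj : cs.IsSpherical {i, j}, (orderComplex cs.SphericalCoset).LinkAdj
        (cs.coset w ∅ hT) (cs.coset w {i} hR) (cs.coset w {i, j} hj) := fun j hj hs =>
      (linkAdj_coset_iff hM).2 ⟨hne, (Set.insert_nonempty _ _).ne_empty, (hpair hj.symm i).symm,
        Or.inl (by simp), Or.inl (by simp), Or.inl (by simp)⟩
    refine ⟨cs.coset w _ h1.2, cs.coset w _ h2.2, ?_, fun b => ⟨fun hb => ?_, ?_⟩⟩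
    · rw [ne_eq, cs.coset_inj hM]
      intro he
      have : j₁ ∈ ({i, j₂} : Set B) := he.subset (by simp)
      rcases this with h | h
      exacts [h1.1 h, hj h]
    · obtain ⟨Q, hQ, rfl⟩ := exists_of_comparable_vertex hM (linkAdj_orderComplex.1 hb).2.2.2.2.1
      obtain ⟨-, hb1, hb2, -, -, hb4⟩ := (linkAdj_coset_iff hM).1 hb
      have hiQ : i ∈ Q := by
        rcases hb4 with h' | h'
        · exact h' rfl
        · rcases Set.subset_singleton_iff_eq.1 h' with h'' | h''
          exacts [absurd h'' hb1, absurd h'' hb2]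
      obtain ⟨j, hji, rfl⟩ := h.exists_eq_pair hQ hiQ hb2
      rcases (hj' j).1 ⟨hji, hQ⟩ with rfl | rfl
      exacts [Or.inl rfl, Or.inr rfl]
    · rintro (rfl | rfl)
      exacts [hup _ h1.1 h1.2, hup _ h2.1 h2.2]
  -- The edge of type {i} at w has exactly the vertices w and ws_i; rewriting both cosets over the
  -- second vertex reduces it to the first.
  · have hdown : ∀ i j : B, i ≠ j → ∀ (hi : cs.IsSpherical {i}) (hij : cs.IsSpherical {i, j}),
        ∃ b₁ b₂, b₁ ≠ b₂ ∧ ∀ b, (orderComplex cs.SphericalCoset).LinkAdj (cs.coset w {i} hi)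
          (cs.coset w {i, j} hij) b ↔ b = b₁ ∨ b = b₂ := by
      intro i j hij hi hs
      have hcos : cs.coset (w * cs.simple i) {i} hi = cs.coset w {i} hi :=
        (cs.coset_eq_iff hM).2 ⟨rfl, by simpa using cs.simple_mem_parabolic (Set.mem_singleton i)⟩
      have hcos2 : cs.coset (w * cs.simple i) {i, j} hs = cs.coset w {i, j} hs :=
        (cs.coset_eq_iff hM).2 ⟨rfl, by
          simpa using cs.simple_mem_parabolic (Set.mem_insert i {j})⟩
      have hadj : ∀ x, (orderComplex cs.SphericalCoset).LinkAdj (cs.coset x {i} hi)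
          (cs.coset x {i, j} hs) (cs.vertex x) := fun x => (linkAdj_coset_iff hM).2
        ⟨(hpair hij i).symm, (Set.singleton_nonempty i).ne_empty.symm,
          (Set.insert_nonempty _ _).ne_empty.symm, Or.inl (by simp), Or.inr (by simp),
          Or.inr (by simp)⟩
      refine ⟨cs.vertex w, cs.vertex (w * cs.simple i), fun he => ?_, fun b => ⟨fun hb => ?_, ?_⟩⟩
      · exact cs.simple_ne_one i (by simpa using (cs.vertex_injective he).symm)
      · rcases (linkAdj_orderComplex.1 hb).2.2.2.2.1 with h' | h'
        · obtain ⟨Q, hQ, rfl⟩ := cs.exists_of_coset_le h'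
          obtain ⟨-, hb1, hb2, -, -, hb4⟩ := (linkAdj_coset_iff hM).1 hb
          have hiQ : i ∈ Q := (cs.coset_le_coset_iff_subset hM).1 h' rfl
          obtain ⟨k, hk, rfl⟩ := h.exists_eq_pair hQ hiQ hb1
          rcases hb4 with h'' | h''
          · exact absurd (h.eq_pair_of_subset hij hQ h'') hb2
          · exact absurd (h.eq_pair_of_subset hk.symm hs h'').symm hb2
        · obtain ⟨y, hy, Q, hQ, hsub, rfl⟩ := cs.exists_of_le_coset hM h'
          rcases Set.subset_singleton_iff_eq.1 hsub with rfl | rfl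
          · rcases cs.mem_parabolic_singleton.1 hy with rfl | rfl
            · exact Or.inl (by rw [mul_one]; rfl)
            · exact Or.inr rfl
          · refine absurd ?_ (linkAdj_orderComplex.1 hb).2.1
            exact (cs.coset_eq_iff hM).2 ⟨rfl, by simpa using hy⟩
      · rintro (rfl | rfl)
        · exact hadj w
        · have := hadj (w * cs.simple i)
          rwa [hcos, hcos2] at this
    rcases Set.subset_pair_iff_eq.1 hTR with rfl | rfl | rfl | rfl
    · have hup : ∀ k, k = i ∨ k = j → (orderComplex cs.SphericalCoset).LinkAdj
          (cs.coset w ∅ hT) (cs.coset w {i, j} hR)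
          (cs.coset w {k} (cs.isSpherical_singleton k)) := fun k hk =>
        (linkAdj_coset_iff hM).2 ⟨hne, (Set.singleton_nonempty _).ne_empty, hpair hij k,
          Or.inl (by simp), Or.inl (by simp), Or.inr (by rcases hk with rfl | rfl <;> simp)⟩
      refine ⟨cs.coset w {i} (cs.isSpherical_singleton i),
        cs.coset w {j} (cs.isSpherical_singleton j), ?_, fun b => ⟨fun hb => ?_, ?_⟩⟩
      · rw [ne_eq, cs.coset_inj hM, Set.singleton_eq_singleton_iff]
        exact hij
      · obtain ⟨Q, hQ, rfl⟩ := exists_of_comparable_vertex hM (linkAdj_orderComplex.1 hb).2.2.2.2.1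
        obtain ⟨-, hb1, hb2, -, -, hb4⟩ := (linkAdj_coset_iff hM).1 hb
        rcases hb4 with h' | h'
        · exact absurd (h.eq_pair_of_subset hij hQ h') hb2
        · rcases Set.subset_pair_iff_eq.1 h' with rfl | rfl | rfl | rfl
          exacts [absurd rfl hb1, Or.inl rfl, Or.inr rfl, absurd rfl hb2]
      · rintro (rfl | rfl)
        exacts [hup _ (Or.inl rfl), hup _ (Or.inr rfl)]
    · exact hdown i j hij hT hR
    · have hcos : cs.coset w {i, j} hR = cs.coset w {j, i} (by rwa [Set.pair_comm]) :=
        (cs.coset_inj hM).2 (Set.pair_comm i j)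
      rw [hcos]
      exact hdown j i hij.symm hT _
    · exact absurd rfl hne

/-- The link of a vertex is the subdivided nerve; the link of an edge joins its ends to the polygons
above it; the link of a polygon is its boundary, traversed by multiplying with the two generators.
-/
theorem HasCycleNerve.exists_linkAdj_base (h : cs.HasCycleNerve) (hM : M.IsEven)
    (C : cs.SphericalCoset) : ∃ a₀, (a₀ ≠ C ∧ (C ≤ a₀ ∨ a₀ ≤ C)) ∧
      ∀ a, a ≠ C → C ≤ a ∨ a ≤ C →
        Relation.ReflTransGen ((orderComplex cs.SphericalCoset).LinkAdj C) a₀ a := by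
  obtain ⟨w, T, hT, rfl⟩ := cs.exists_eq_coset C
  have hne0 : ∀ {i : B}, ({i} : Set B) ≠ ∅ := fun {i} => (Set.singleton_nonempty i).ne_empty
  have hne2 : ∀ {i j : B}, ({i, j} : Set B) ≠ ∅ := (Set.insert_nonempty _ _).ne_empty
  have hpair : ∀ {i j : B}, i ≠ j → ∀ k, ({k} : Set B) ≠ {i, j} := fun {i j} hij k he =>
    hij ((he.symm.subset (by simp : i ∈ ({i, j} : Set B))).trans
      (he.symm.subset (by simp : j ∈ ({i, j} : Set B))).symm)
  have hs1 := cs.isSpherical_singleton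
  rcases h.eq_or T hT with rfl | ⟨i, rfl⟩ | ⟨i, j, hij, rfl⟩
  · obtain ⟨i⟩ := h.nonempty
    have hadj : ∀ {a b : B}, b ≠ a → ∀ hab : cs.IsSpherical {a, b},
        (orderComplex cs.SphericalCoset).LinkAdj (cs.coset w ∅ hT) (cs.coset w {a} (hs1 a))
          (cs.coset w {a, b} hab) := fun {a b} hne hab => (linkAdj_coset_iff hM).2
      ⟨hne0, hne2, (hpair hne.symm a).symm, Or.inl (by simp), Or.inl (by simp), Or.inl (by simp)⟩
    have hadj' : ∀ {a b : B}, b ≠ a → ∀ hab : cs.IsSpherical {a, b},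
        (orderComplex cs.SphericalCoset).LinkAdj (cs.coset w ∅ hT) (cs.coset w {a, b} hab)
          (cs.coset w {b} (hs1 b)) := fun {a b} hne hab => (linkAdj_coset_iff hM).2
      ⟨hne2, hne0, hpair hne.symm b, Or.inl (by simp), Or.inl (by simp), Or.inr (by simp)⟩
    have hsing : ∀ j, Relation.ReflTransGen ((orderComplex cs.SphericalCoset).LinkAdj
        (cs.coset w ∅ hT)) (cs.coset w {i} (hs1 i)) (cs.coset w {j} (hs1 j)) := by
      intro j
      induction h.connected i j with
      | refl => exact Relation.ReflTransGen.refl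
      | tail _ hbc ih => exact (ih.tail (hadj hbc.1 hbc.2)).tail (hadj' hbc.1 hbc.2)
    refine ⟨cs.coset w {i} (hs1 i), ⟨fun he => hne0 ((cs.coset_inj hM).1 he),
      Or.inl (cs.coset_le_of_subset (Set.empty_subset _))⟩, fun a ha hle => ?_⟩
    obtain ⟨R, hR, rfl⟩ := exists_of_comparable_vertex hM hle
    rcases h.eq_or R hR with rfl | ⟨j, rfl⟩ | ⟨j, k, hjk, rfl⟩
    · exact absurd rfl ha
    · exact hsing j
    · exact (hsing j).tail (hadj hjk.symm hR)
  · obtain ⟨j, _, -, hj⟩ := h.exists_two i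
    obtain ⟨hji, hjs⟩ := (hj j).2 (Or.inl rfl)
    have hlow : ∀ {a b : cs.SphericalCoset}, a ≠ cs.coset w {i} hT → b ≠ cs.coset w {i} hT →
        a ≤ cs.coset w {i} hT → cs.coset w {i} hT ≤ b →
        (orderComplex cs.SphericalCoset).LinkAdj (cs.coset w {i} hT) a b := fun ha hb hle hle' =>
      linkAdj_orderComplex.2 ⟨ha, hb, fun he => ha (le_antisymm hle (he ▸ hle')), Or.inr hle,
        Or.inl hle', Or.inl (hle.trans hle')⟩
    have hl : cs.vertex w ≠ cs.coset w {i} hT := fun he => hne0 ((cs.coset_inj hM).1 he).symm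
    have hl' : cs.vertex w ≤ cs.coset w {i} hT := cs.coset_le_of_subset (Set.empty_subset _)
    have hu : cs.coset w {i, j} hjs ≠ cs.coset w {i} hT :=
      fun he => hpair hji.symm i ((cs.coset_inj hM).1 he).symm
    have hu' : cs.coset w {i} hT ≤ cs.coset w {i, j} hjs := cs.coset_le_of_subset (by simp)
    refine ⟨cs.vertex w, ⟨hl, Or.inr hl'⟩, fun a ha hle => ?_⟩
    rcases hle with hle | hle
    · exact Relation.ReflTransGen.single (hlow hl ha hl' hle)
    · exact (Relation.ReflTransGen.single (hlow hl hu hl' hu')).tail (hlow ha hu hle hu').symm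
  · have hcos : ∀ {y}, y ∈ cs.parabolic {i, j} → cs.coset (w * y) {i, j} hT = cs.coset w {i, j} hT :=
      fun hy => (cs.coset_eq_iff hM).2 ⟨rfl, by simpa using hy⟩
    have hadj : ∀ {y}, y ∈ cs.parabolic {i, j} → ∀ k ∈ ({i, j} : Set B),
        (orderComplex cs.SphericalCoset).LinkAdj (cs.coset w {i, j} hT) (cs.vertex (w * y))
          (cs.coset (w * y) {k} (hs1 k)) := by
      intro y hy k hk
      rw [← hcos hy]
      exact (linkAdj_coset_iff hM).2 ⟨hne2.symm, hpair hij k, hne0, Or.inr (by simp),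
        Or.inr (by simpa using hk), Or.inl (by simp)⟩
    have hstep : ∀ {y}, y ∈ cs.parabolic {i, j} → ∀ k ∈ ({i, j} : Set B),
        Relation.ReflTransGen ((orderComplex cs.SphericalCoset).LinkAdj (cs.coset w {i, j} hT))
          (cs.vertex w) (cs.vertex (w * y)) →
        Relation.ReflTransGen ((orderComplex cs.SphericalCoset).LinkAdj (cs.coset w {i, j} hT))
          (cs.vertex w) (cs.vertex (w * (y * cs.simple k))) := by
      intro y hy k hk hreach
      have h2 := (hadj (mul_mem hy (cs.simple_mem_parabolic hk)) k hk).symm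
      have : cs.coset (w * (y * cs.simple k)) {k} (hs1 k) = cs.coset (w * y) {k} (hs1 k) :=
        (cs.coset_eq_iff hM).2 ⟨rfl, by
          simpa [mul_assoc] using cs.simple_mem_parabolic (Set.mem_singleton k)⟩
      rw [this] at h2
      exact (hreach.tail (hadj hy k hk)).tail h2
    have hvert : ∀ {y}, y ∈ cs.parabolic {i, j} →
        Relation.ReflTransGen ((orderComplex cs.SphericalCoset).LinkAdj (cs.coset w {i, j} hT))
          (cs.vertex w) (cs.vertex (w * y)) := by
      intro y hy
      induction hy using Subgroup.closure_induction_right with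
      | one => rw [mul_one]
      | mul_right x hx y hy h =>
        obtain ⟨k, hk, rfl⟩ := hy
        exact hstep hx k hk h
      | mul_inv_cancel x hx y hy h =>
        obtain ⟨k, hk, rfl⟩ := hy
        rw [cs.inv_simple]
        exact hstep hx k hk h
    refine ⟨cs.vertex w, ⟨fun he => hne2 ((cs.coset_inj hM).1 he).symm,
      Or.inr (cs.coset_le_of_subset (Set.empty_subset _))⟩, fun a ha hle => ?_⟩
    rcases hle with hle | hle
    · obtain ⟨R, hR, rfl⟩ := cs.exists_of_coset_le hle
      exact absurd ((cs.coset_inj hM).2 (h.eq_pair_of_subset hij hR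
        ((cs.coset_le_coset_iff_subset hM).1 hle))) ha
    · obtain ⟨y, hy, R, hR, hsub, rfl⟩ := cs.exists_of_le_coset hM hle
      rcases Set.subset_pair_iff_eq.1 hsub with rfl | rfl | rfl | rfl
      · exact hvert hy
      · exact (hvert hy).tail (hadj hy _ (by simp))
      · exact (hvert hy).tail (hadj hy _ (by simp))
      · exact absurd (hcos hy) ha

/-- The Davis complex of a Coxeter system whose nerve is a cycle is a surface. -/
theorem HasCycleNerve.isClosedSurface [Finite B] (h : cs.HasCycleNerve) (hM : M.IsEven) :
    cs.davisComplex.IsClosedSurface where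
  card_le _ hσ := h.card_le hM hσ
  exists_two := by
    intro C D hne hCD
    rcases pair_mem_faces_orderComplex.1 hCD with hle | hle
    · exact h.exists_two_of_le hM hne hle
    · obtain ⟨b₁, b₂, hb, hb'⟩ := h.exists_two_of_le hM hne.symm hle
      refine ⟨b₁, b₂, hb, fun b => Iff.trans ?_ (hb' b)⟩
      rw [show cs.davisComplex = orderComplex cs.SphericalCoset from rfl, linkAdj_orderComplex,
        linkAdj_orderComplex]
      have : D ≠ C ↔ C ≠ D := ne_comm
      tauto
  link_finite := by
    intro C
    obtain ⟨w, T, hT, rfl⟩ := cs.exists_eq_coset C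
    have h1 : {D | cs.coset w T hT ≤ D}.Finite := by
      refine (Set.finite_range fun R : {R : Set B // cs.IsSpherical R} =>
        cs.coset w R.1 R.2).subset fun D hD => ?_
      obtain ⟨R, hR, rfl⟩ := cs.exists_of_coset_le hD
      exact ⟨⟨R, hR⟩, rfl⟩
    have h2 : {D | D ≤ cs.coset w T hT}.Finite := by
      have hfin : (cs.coset w T hT).1.Finite := Set.Finite.image _ hT
      exact hfin.finite_subsets.preimage Subtype.val_injective.injOn
    refine (h1.union h2).subset ?_
    rintro D ⟨-, hD⟩
    exact pair_mem_faces_orderComplex.1 hD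
  link_nonempty := by
    intro C _
    obtain ⟨a, ⟨ha, ha'⟩, -⟩ := h.exists_linkAdj_base hM C
    exact ⟨a, ha, pair_mem_faces_orderComplex.2 ha'⟩
  link_connected := by
    intro C a b ha hCa hb hCb
    obtain ⟨a₀, -, hreach⟩ := h.exists_linkAdj_base hM C
    exact (reflTransGen_symm (fun _ _ h => h.symm) (hreach a ha
      (pair_mem_faces_orderComplex.1 hCa))).trans (hreach b hb (pair_mem_faces_orderComplex.1 hCb))
  no_triangle _ _ _ _ hab hbc := not_linkAdj_of_card_le (fun _ => h.card_le hM) hab hbc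

end CoxeterSystem

end

noncomputable section

/-! ### Boundary collars and colors -/

namespace PreAbstractSimplicialComplex

variable {V : Type*}

theorem mem_faces_iSup {ι : Sort*} {X : ι → PreAbstractSimplicialComplex V} {σ : Finset V} :
    σ ∈ (⨆ i, X i).faces ↔ ∃ i, σ ∈ (X i).faces := by
  change σ ∈ ⋃ K ∈ Set.range X, K.faces ↔ _
  simp

theorem mem_faces_biSup {ι : Type*} {S : Set ι} {X : ι → PreAbstractSimplicialComplex V}
    {σ : Finset V} : σ ∈ (⨆ i ∈ S, X i).faces ↔ ∃ i ∈ S, σ ∈ (X i).faces := by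
  simp only [mem_faces_iSup, exists_prop]

theorem restrictTo_inf_restrictTo (X : PreAbstractSimplicialComplex V) (A A' : Set V) :
    X.restrictTo A ⊓ X.restrictTo A' = X.restrictTo (A ∩ A') := by
  ext σ
  change (σ ∈ X.faces ∧ _) ∧ (σ ∈ X.faces ∧ _) ↔ σ ∈ X.faces ∧ _
  exact ⟨fun h => ⟨h.1.1, fun v hv => ⟨h.1.2 v hv, h.2.2 v hv⟩⟩,
    fun h => ⟨⟨h.1, fun v hv => (h.2 v hv).1⟩, h.1, fun v hv => (h.2 v hv).2⟩⟩

variable {P : Type*} [PartialOrder P]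

theorem exists_forall_le_of_mem_faces {σ : Finset P} (hσ : σ ∈ (orderComplex P).faces) :
    ∃ m ∈ σ, ∀ C ∈ σ, m ≤ C := by
  rw [mem_faces_orderComplex] at hσ
  obtain ⟨m, hm⟩ := σ.exists_minimal hσ.1
  exact ⟨m, hm.1, fun C hC => (hσ.2 m hm.1 C hC).elim id fun h => hm.2 hC h⟩

theorem exists_forall_ge_of_mem_faces {σ : Finset P} (hσ : σ ∈ (orderComplex P).faces) :
    ∃ m ∈ σ, ∀ C ∈ σ, C ≤ m := by
  rw [mem_faces_orderComplex] at hσ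
  obtain ⟨m, hm⟩ := σ.exists_maximal hσ.1
  exact ⟨m, hm.1, fun C hC => (hσ.2 m hm.1 C hC).elim (fun h => hm.2 hC h) id⟩

end PreAbstractSimplicialComplex

namespace CoxeterSystem

open PreAbstractSimplicialComplex
open scoped Classical Pointwise

variable {B W : Type*} [Group W] {M : CoxeterMatrix B} (cs : CoxeterSystem M W)

/-- The cosets `w W_T` with `w ∈ A` and `T ⊆ Q` spherical. -/
def cosetsOver (A : Set W) (Q : Set B) : Set cs.SphericalCoset :=
  {C | ∃ w ∈ A, ∃ (T : Set B) (hT : cs.IsSpherical T), T ⊆ Q ∧ C = cs.coset w T hT}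

/-! ### The subcomplexes described by sets of cosets. -/

variable {cs}

theorem coset_mem_cosetsOver {A : Set W} {Q T : Set B} {hT : cs.IsSpherical T} {w : W} (hw : w ∈ A)
    (h : T ⊆ Q) : cs.coset w T hT ∈ cs.cosetsOver A Q := ⟨w, hw, T, hT, h, rfl⟩

theorem subset_of_coset_mem_cosetsOver (hM : M.IsEven) {A : Set W} {Q T : Set B}
    {hT : cs.IsSpherical T} {w : W} (h : cs.coset w T hT ∈ cs.cosetsOver A Q) : T ⊆ Q := by
  obtain ⟨x, -, R, hR, hRQ, he⟩ := h
  rw [((cs.coset_eq_iff hM).1 he).1]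
  exact hRQ

theorem cosetsOver_mono {A A' : Set W} {Q Q' : Set B} (h : A ⊆ A') (h' : Q ⊆ Q') :
    cs.cosetsOver A Q ⊆ cs.cosetsOver A' Q' := by
  rintro _ ⟨w, hw, T, hT, hTQ, rfl⟩
  exact coset_mem_cosetsOver (h hw) (hTQ.trans h')

theorem mem_cosetsOver_of_le_univ (hM : M.IsEven) {Q : Set B} {C D : cs.SphericalCoset}
    (h : D ≤ C) (hC : C ∈ cs.cosetsOver Set.univ Q) : D ∈ cs.cosetsOver Set.univ Q := by
  obtain ⟨w, -, T, hT, hTQ, rfl⟩ := hC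
  obtain ⟨y, -, R, hR, hRT, rfl⟩ := cs.exists_of_le_coset hM h
  exact coset_mem_cosetsOver trivial (hRT.trans hTQ)

theorem mem_cosetsOver_of_le (hM : M.IsEven) {v : W} {Q : Set B} {C D : cs.SphericalCoset}
    (h : D ≤ C) (hC : C ∈ cs.cosetsOver (v • (cs.parabolic Q : Set W)) Q) :
    D ∈ cs.cosetsOver (v • (cs.parabolic Q : Set W)) Q := by
  obtain ⟨_, ⟨w, hw, rfl⟩, T, hT, hTQ, rfl⟩ := hC
  obtain ⟨y, hy, R, hR, hRT, rfl⟩ := cs.exists_of_le_coset hM h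
  refine coset_mem_cosetsOver ⟨w * y, mul_mem hw (cs.parabolic_mono hTQ hy), ?_⟩ (hRT.trans hTQ)
  exact (mul_assoc v w y).symm

theorem mem_cosetsOver_of_ge (hM : M.IsEven) {A : Set W} {Q : Set B} {C D : cs.SphericalCoset}
    (h : C ≤ D) (hC : C ∈ cs.cosetsOver A Q) (hD : D ∈ cs.cosetsOver Set.univ Q) :
    D ∈ cs.cosetsOver A Q := by
  obtain ⟨w, hw, T, hT, hTQ, rfl⟩ := hC
  obtain ⟨R, hR, rfl⟩ := cs.exists_of_coset_le h
  exact coset_mem_cosetsOver hw (subset_of_coset_mem_cosetsOver hM hD)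

/-- The members of a chain of cosets meeting `A` have a common element in `A`. -/
theorem mem_restrictTo_cosetsOver_iff (hM : M.IsEven) {A : Set W} {Q : Set B}
    {σ : Finset cs.SphericalCoset} : σ ∈ (cs.davisComplex.restrictTo (cs.cosetsOver A Q)).faces ↔
      σ ∈ cs.davisComplex.faces ∧ ∃ w ∈ A, ∀ C ∈ σ, C ∈ cs.cosetsOver {w} Q := by
  refine and_congr_right fun hσ => ⟨fun h => ?_, fun ⟨w, hw, h⟩ C hC =>
    cosetsOver_mono (Set.singleton_subset_iff.2 hw) subset_rfl (h C hC)⟩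
  obtain ⟨m, hm, hle⟩ := exists_forall_le_of_mem_faces hσ
  obtain ⟨w, hw, T, hT, hTQ, hmeq⟩ := h m hm
  refine ⟨w, hw, fun C hC => ?_⟩
  have hmC := hle C hC
  rw [hmeq] at hmC
  obtain ⟨R, hR, rfl⟩ := cs.exists_of_coset_le hmC
  exact coset_mem_cosetsOver rfl (subset_of_coset_mem_cosetsOver hM (h _ hC))

/-- Passing to a larger coset keeps a representative, and passing to a smaller one changes it by an
element of W_Q, so no chain leaves the cosets over vW_Q. Conversely, generators in Q give edge
paths. -/
theorem component_restrictTo (hM : M.IsEven) {v : W} {Q : Set B} {Z : Set cs.SphericalCoset}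
    (h1 : cs.cosetsOver (v • (cs.parabolic Q : Set W)) Q ⊆ Z) (h2 : Z ⊆ cs.cosetsOver Set.univ Q) :
    (cs.davisComplex.restrictTo Z).component (cs.vertex v) =
      cs.davisComplex.restrictTo (cs.cosetsOver (v • (cs.parabolic Q : Set W)) Q) := by
  have hiff : ∀ C, C ∈ Z → ((cs.davisComplex.restrictTo Z).EdgeReachable (cs.vertex v) C ↔
      C ∈ cs.cosetsOver (v • (cs.parabolic Q : Set W)) Q) := by
    intro C hC
    constructor
    · intro h
      induction h with
      | refl => exact coset_mem_cosetsOver ⟨1, one_mem _, by simp⟩ (Set.empty_subset _)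
      | @tail x y _ hxy ih =>
        obtain ⟨σ, ⟨hσ, hσZ⟩, hx, hy⟩ := hxy
        rcases (mem_faces_orderComplex.1 hσ).2 x hx y hy with hle | hle
        · exact mem_cosetsOver_of_ge hM hle (ih (hσZ x hx)) (h2 hC)
        · exact mem_cosetsOver_of_le hM hle (ih (hσZ x hx))
    · rintro ⟨_, ⟨y, hy, rfl⟩, T, hT, hTQ, rfl⟩
      have hmem : ∀ y ∈ cs.parabolic Q, v * y ∈ v • (cs.parabolic Q : Set W) :=
        fun y hy => ⟨y, hy, rfl⟩
      refine (cs.edgeReachable_vertex (fun y hy => h1 (coset_mem_cosetsOver (hmem y hy)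
        (Set.empty_subset _))) (fun y hy i hi => ⟨cs.isSpherical_singleton i,
        h1 (coset_mem_cosetsOver (hmem y hy) (Set.singleton_subset_iff.2 hi))⟩) hy).tail
        ⟨{cs.vertex (v * y), cs.coset (v * y) T hT}, ⟨pair_mem_faces_orderComplex.2
          (Or.inl (cs.coset_le_of_subset (Set.empty_subset _))), ?_⟩, by simp, by simp⟩
      intro D hD
      rcases Finset.mem_insert.1 hD with rfl | hD
      · exact h1 (coset_mem_cosetsOver (hmem y hy) (Set.empty_subset _))
      · rw [Finset.mem_singleton.1 hD]
        exact hC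
  ext σ
  constructor
  · rintro ⟨⟨hσ, hσZ⟩, hreach⟩
    exact ⟨hσ, fun C hC => (hiff C (hσZ C hC)).1 (hreach C hC)⟩
  · rintro ⟨hσ, hσZ⟩
    exact ⟨⟨hσ, fun C hC => h1 (hσZ C hC)⟩, fun C hC => (hiff C (h1 (hσZ C hC))).2 (hσZ C hC)⟩

theorem singleton_mem_davisComplex (C : cs.SphericalCoset) : {C} ∈ cs.davisComplex.faces :=
  mem_faces_orderComplex.2 ⟨⟨C, by simp⟩, fun a ha b hb => Or.inl (by
    rw [Finset.mem_singleton.1 ha, Finset.mem_singleton.1 hb])⟩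

theorem singleton_mem_restrictTo {Z : Set cs.SphericalCoset} {C : cs.SphericalCoset} :
    {C} ∈ (cs.davisComplex.restrictTo Z).faces ↔ C ∈ Z :=
  ⟨fun h => h.2 C (by simp), fun h => ⟨singleton_mem_davisComplex C, fun D hD => by
    rwa [Finset.mem_singleton.1 hD]⟩⟩

theorem ruin_eq [Finite B] (hM : M.IsEven) (hflag : cs.nerve.IsFlag) (t : B) : cs.ruin t =
    cs.davisComplex.restrictTo (cs.cosetsOver Set.univ (M.finiteNeighbors t)) := by
  ext σ
  rw [ruin, mem_faces_biSup]
  constructor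
  · rintro ⟨C, ⟨T, hT, htT, w, hw⟩, hσ, hσC⟩
    obtain rfl : C = cs.coset w T hT := Subtype.ext hw
    exact ⟨hσ, fun D hD => mem_cosetsOver_of_le_univ hM (hσC D hD) (coset_mem_cosetsOver trivial
      fun i hi => (cs.isSpherical_iff hM hflag).1 hT i hi t htT)⟩
  · rintro ⟨hσ, hσC⟩
    obtain ⟨m, hm, hle⟩ := exists_forall_ge_of_mem_faces hσ
    obtain ⟨w, -, T, hT, hTU, rfl⟩ := hσC m hm
    -- Flagness: t has finite label with every member of T, so all pairs in the enlarged set are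
    -- spherical.
    have hTt : cs.IsSpherical (insert t T) := by
      have h := (cs.isSpherical_iff hM hflag).1 hT
      rw [cs.isSpherical_iff hM hflag]
      rintro i (rfl | hi) j (rfl | hj)
      · rw [M.diagonal]; exact one_ne_zero
      · rw [M.symmetric]; exact hTU hj
      · exact hTU hi
      · exact h i hi j hj
    exact ⟨cs.coset w _ hTt, ⟨_, hTt, Set.mem_insert _ _, w, rfl⟩, hσ, fun D hD =>
      (hle D hD).trans (cs.coset_le_of_subset (Set.subset_insert _ _))⟩

theorem ruinBoundary_eq [Finite B] (hM : M.IsEven) (hflag : cs.nerve.IsFlag) (t : B) : cs.ruinBoundary t =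
    cs.davisComplex.restrictTo (cs.cosetsOver Set.univ (M.finiteNeighbors t \ {t})) := by
  ext σ
  rw [ruinBoundary, mem_faces_biSup]
  constructor
  · rintro ⟨C, ⟨hC, T, hT, htT, w, hw⟩, hσ, hσC⟩
    obtain rfl : C = cs.coset w T hT := Subtype.ext hw
    have hmem : {cs.coset w T hT} ∈ (cs.ruin t).faces :=
      hC ⟨singleton_mem_davisComplex _, fun D hD => (Finset.mem_singleton.1 hD).le⟩
    rw [ruin_eq hM hflag, singleton_mem_restrictTo] at hmem
    exact ⟨hσ, fun D hD => mem_cosetsOver_of_le_univ hM (hσC D hD) (coset_mem_cosetsOver trivial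
      fun i hi => ⟨subset_of_coset_mem_cosetsOver hM hmem hi, fun h => htT (h ▸ hi)⟩)⟩
  · rintro ⟨hσ, hσC⟩
    obtain ⟨m, hm, hle⟩ := exists_forall_ge_of_mem_faces hσ
    obtain ⟨w, -, T, hT, hTU, rfl⟩ := hσC m hm
    refine ⟨cs.coset w _ hT, ⟨?_, _, hT, fun h => (hTU h).2 rfl, w, rfl⟩, hσ, hle⟩
    rw [ruin_eq hM hflag]
    rintro τ ⟨hτ, hτC⟩
    exact ⟨hτ, fun D hD => mem_cosetsOver_of_le_univ hM (hτC D hD)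
      (coset_mem_cosetsOver trivial fun i hi => (hTU hi).1)⟩

theorem Omega_eq [Finite B] (hM : M.IsEven) (hflag : cs.nerve.IsFlag) (t : B) : cs.Omega t =
    cs.davisComplex.restrictTo (cs.cosetsOver (cs.parabolic (M.finiteNeighbors t))
      (M.finiteNeighbors t)) := by
  rw [Omega, ruin_eq hM hflag, component_restrictTo hM (cosetsOver_mono (Set.subset_univ _)
    subset_rfl) subset_rfl, one_smul]

theorem OmegaBoundary_eq [Finite B] (hM : M.IsEven) (hflag : cs.nerve.IsFlag) (t : B) : cs.OmegaBoundary t =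
    cs.davisComplex.restrictTo (cs.cosetsOver (cs.parabolic (M.finiteNeighbors t))
      (M.finiteNeighbors t \ {t})) := by
  rw [OmegaBoundary, Omega_eq hM hflag, ruinBoundary_eq hM hflag, restrictTo_inf_restrictTo]
  congr 1
  ext C
  constructor
  · rintro ⟨⟨w, hw, T, hT, -, rfl⟩, h⟩
    exact coset_mem_cosetsOver hw (subset_of_coset_mem_cosetsOver hM h)
  · exact fun h => ⟨cosetsOver_mono subset_rfl Set.sdiff_subset h,
      cosetsOver_mono (Set.subset_univ _) subset_rfl h⟩

theorem vertex_mem_cosetsOver_iff {A : Set W} {Q : Set B} {w : W} (hM : M.IsEven) :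
    cs.vertex w ∈ cs.cosetsOver A Q ↔ w ∈ A := by
  refine ⟨?_, fun h => coset_mem_cosetsOver h (Set.empty_subset _)⟩
  rintro ⟨x, hx, T, hT, -, he⟩
  obtain ⟨rfl, hm⟩ := (cs.coset_eq_iff hM).1 he
  rw [parabolic_empty, Subgroup.mem_bot, inv_mul_eq_one] at hm
  exact hm ▸ hx

theorem chamberU_eq [Finite B] (hM : M.IsEven) (hflag : cs.nerve.IsFlag) (t : B) : cs.chamberU t =
    cs.davisComplex.restrictTo (cs.cosetsOver {1} (M.finiteNeighbors t)) := by
  rw [chamberU, chamber, Omega_eq hM hflag, restrictTo_inf_restrictTo]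
  congr 1
  ext C
  constructor
  · rintro ⟨⟨T, hT, rfl⟩, h⟩
    exact coset_mem_cosetsOver rfl (subset_of_coset_mem_cosetsOver hM h)
  · rintro ⟨_, rfl, T, hT, hTU, rfl⟩
    exact ⟨⟨T, hT, rfl⟩, coset_mem_cosetsOver (one_mem _) hTU⟩

theorem translate_mono (w : W) {C D : cs.SphericalCoset} (h : C ≤ D) :
    cs.translate w C ≤ cs.translate w D := Set.smul_set_mono h

theorem map_translate_restrictTo_cosetsOver {w : W} {Q : Set B} :
    (cs.davisComplex.restrictTo (cs.cosetsOver {1} Q)).map (cs.translate w) =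
      cs.davisComplex.restrictTo (cs.cosetsOver {w} Q) := by
  have key : ∀ (w x : W) (τ : Finset cs.SphericalCoset),
      τ ∈ (cs.davisComplex.restrictTo (cs.cosetsOver {x} Q)).faces →
      τ.image (cs.translate w) ∈ (cs.davisComplex.restrictTo (cs.cosetsOver {w * x} Q)).faces := by
    rintro w x τ ⟨hτ, hτC⟩
    have hτ' := mem_faces_orderComplex.1 hτ
    refine ⟨mem_faces_orderComplex.2 ⟨hτ'.1.image _, ?_⟩, ?_⟩
    · simp only [Finset.forall_mem_image]
      exact fun a ha b hb => (hτ'.2 a ha b hb).imp (translate_mono w) (translate_mono w)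
    · simp only [Finset.forall_mem_image]
      intro C hC
      obtain ⟨_, rfl, T, hT, hTQ, rfl⟩ := hτC C hC
      rw [translate_coset]
      exact coset_mem_cosetsOver rfl hTQ
  ext σ
  constructor
  · rintro ⟨τ, hτ, rfl⟩
    simpa using key w 1 τ hτ
  · intro hσ
    refine ⟨σ.image (cs.translate w⁻¹), by simpa using key w⁻¹ w σ hσ, ?_⟩
    dsimp only
    rw [Finset.image_image]
    refine (Finset.image_congr fun C _ => ?_).trans Finset.image_id
    exact Subtype.ext (smul_inv_smul w C.1)

/-- The vertices of the component of ∂Ω through v form the coset of v by the subgroup generated by U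
- t, and translating K(U) replaces the representative 1 by each of them. -/
theorem collar_eq [Finite B] (hM : M.IsEven) (hflag : cs.nerve.IsFlag) (t : B) {v : W}
    (hv : v ∈ cs.parabolic (M.finiteNeighbors t)) : cs.collar t v =
      cs.davisComplex.restrictTo (cs.cosetsOver
        (v • (cs.parabolic (M.finiteNeighbors t \ {t}) : Set W)) (M.finiteNeighbors t)) := by
  have hsub : v • (cs.parabolic (M.finiteNeighbors t \ {t}) : Set W) ⊆
      cs.parabolic (M.finiteNeighbors t) := by
    rintro _ ⟨y, hy, rfl⟩
    exact mul_mem hv (cs.parabolic_mono Set.sdiff_subset hy)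
  ext σ
  rw [collar, mem_faces_biSup, OmegaBoundary_eq hM hflag, component_restrictTo hM
    (cosetsOver_mono hsub subset_rfl) (cosetsOver_mono (Set.subset_univ _) subset_rfl),
    mem_restrictTo_cosetsOver_iff hM]
  simp only [chamberU_eq hM hflag, map_translate_restrictTo_cosetsOver]
  constructor
  · rintro ⟨w, hw, hσ⟩
    exact ⟨hσ.1, w, (vertex_mem_cosetsOver_iff hM).1 (singleton_mem_restrictTo.1 hw), hσ.2⟩
  · rintro ⟨hσ, w, hw, hσC⟩
    exact ⟨w, singleton_mem_restrictTo.2 ((vertex_mem_cosetsOver_iff hM).2 hw), hσ, hσC⟩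

/-- Each g_T sends y into the subgroup generated by T ∩ Q, which is contained in the one divided out
because t is not in Q. -/
theorem color_mul_of_mem (hM : M.IsEven) {t : B} {Q : Set B} (hQ : t ∉ Q) {v y : W}
    (hy : y ∈ cs.parabolic Q) : cs.color hM t (v * y) = cs.color hM t v := by
  funext T
  refine QuotientGroup.eq.2 (Subgroup.mem_subgroupOf.2 ?_)
  rw [map_mul, mul_inv_rev, mul_assoc, inv_mul_cancel, mul_one, Subgroup.coe_inv]
  refine inv_mem (cs.parabolic_mono ?_ (cs.retraction_mem_inter hM T.1 hy))
  exact fun i hi => ⟨hi.1, fun h => hQ (h ▸ hi.2)⟩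

theorem colorComplex_eq [Finite B] (hM : M.IsEven) (hflag : cs.nerve.IsFlag) (t : B) (a : cs.Color t) :
    cs.colorComplex hM t a = cs.davisComplex.restrictTo (cs.cosetsOver
      {w | w ∈ cs.parabolic (M.finiteNeighbors t) ∧ cs.color hM t w = a}
      (M.finiteNeighbors t)) := by
  ext σ
  rw [colorComplex, mem_faces_biSup, OmegaBoundary_eq hM hflag, mem_restrictTo_cosetsOver_iff hM]
  constructor
  · rintro ⟨v, ⟨hv, hva⟩, hσ⟩
    have hv' := (vertex_mem_cosetsOver_iff hM).1 (singleton_mem_restrictTo.1 hv)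
    rw [collar_eq hM hflag t hv', mem_restrictTo_cosetsOver_iff hM] at hσ
    obtain ⟨hσ, _, ⟨y, hy, rfl⟩, h⟩ := hσ
    refine ⟨hσ, v * y, ⟨mul_mem hv' (cs.parabolic_mono Set.sdiff_subset hy), ?_⟩, h⟩
    rw [color_mul_of_mem hM (fun h => h.2 rfl) hy, hva]
  · rintro ⟨hσ, w, ⟨hw, hwa⟩, h⟩
    refine ⟨w, ⟨singleton_mem_restrictTo.2 ((vertex_mem_cosetsOver_iff hM).2 hw), hwa⟩, ?_⟩
    rw [collar_eq hM hflag t hw, mem_restrictTo_cosetsOver_iff hM]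
    exact ⟨hσ, w, ⟨1, one_mem _, by simp⟩, h⟩

theorem iSup_colorComplex_eq [Finite B] (hM : M.IsEven) (hflag : cs.nerve.IsFlag) (t : B) {ι : Type*}
    (a : ι → cs.Color t) :
    ⨆ j, cs.colorComplex hM t (a j) = cs.davisComplex.restrictTo (cs.cosetsOver
      {w | w ∈ cs.parabolic (M.finiteNeighbors t) ∧ ∃ j, cs.color hM t w = a j}
      (M.finiteNeighbors t)) := by
  ext σ
  simp only [mem_faces_iSup, colorComplex_eq hM hflag, mem_restrictTo_cosetsOver_iff hM]
  constructor
  · rintro ⟨j, hσ, w, ⟨hw, hwa⟩, h⟩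
    exact ⟨hσ, w, ⟨hw, j, hwa⟩, h⟩
  · rintro ⟨hσ, w, ⟨hw, j, hwa⟩, h⟩
    exact ⟨j, hσ, w, ⟨hw, hwa⟩, h⟩

end CoxeterSystem

end

noncomputable section

/-! ### Intersections of collars as Davis complexes -/

namespace CoxeterSystem

open PreAbstractSimplicialComplex
open scoped Classical Pointwise

variable {B W : Type*} [Group W] {M : CoxeterMatrix B} {cs : CoxeterSystem M W}

theorem ne_of_two_lt {s t : B} (h : 2 < M s t) : s ≠ t := by
  rintro rfl
  rw [M.diagonal] at h
  omega

theorem notMem_commonCommuting_left {s t : B} : s ∉ M.commonCommuting s t := fun h => by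
  have := h.2
  rw [M.diagonal] at this
  omega

theorem notMem_commonCommuting_right {s t : B} : t ∉ M.commonCommuting s t := fun h => by
  have := h.1
  rw [M.diagonal] at this
  omega

theorem eq_two_of_mem_commonCommuting {s t : B} :
    ∀ i ∈ ({s, t} : Set B), ∀ j ∈ M.commonCommuting s t, M i j = 2 := by
  rintro i (rfl | rfl) j hj
  · rw [M.symmetric]; exact hj.2
  · rw [M.symmetric]; exact hj.1

/-- In a spherical set s and t already fail to commute with each other, so each commutes with every
other member. -/
theorem mem_commonCommuting_of_isSpherical (hM : M.IsEven) {T : Set B} (hT : cs.IsSpherical T)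
    {r s t : B} (hr : r ∈ T) (hs : s ∈ T) (ht : t ∈ T) (hst : 2 < M s t) (hrs : r ≠ s)
    (hrt : r ≠ t) : r ∈ M.commonCommuting s t := by
  have hsub : ∀ {a b c : B}, a ∈ T → b ∈ T → c ∈ T → cs.IsSpherical {a, b, c} :=
    fun ha hb hc => hT.mono (by rintro x (rfl | rfl | rfl) <;> assumption)
  have hne := ne_of_two_lt hst
  have hts : M t s = M s t := M.symmetric _ _
  refine ⟨?_, ?_⟩
  · exact (cs.eq_two_or_eq_two_of_isSpherical hM hrt hne.symm hrs (hsub hr ht hs)).resolve_right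
      (by omega)
  · exact (cs.eq_two_or_eq_two_of_isSpherical hM hrs hne hrt (hsub hr hs ht)).resolve_right
      (by omega)

theorem eq_union_of_isSpherical (hM : M.IsEven) {T : Set B} (hT : cs.IsSpherical T)
    {s t : B} (hs : s ∈ T) (ht : t ∈ T) (hst : 2 < M s t) :
    T = {s, t} ∪ (T ∩ M.commonCommuting s t) := by
  ext r
  constructor
  · intro hr
    by_cases hrs : r = s
    · exact Or.inl (Or.inl hrs)
    by_cases hrt : r = t
    · exact Or.inl (Or.inr hrt)
    exact Or.inr ⟨hr, mem_commonCommuting_of_isSpherical hM hT hr hs ht hst hrs hrt⟩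
  · rintro ((rfl | rfl) | hr)
    exacts [hs, ht, hr.1]

theorem eq_of_two_lt_of_isSpherical (hM : M.IsEven) {T : Set B} (hT : cs.IsSpherical T)
    {s s' t : B} (hs : s ∈ T) (hs' : s' ∈ T) (ht : t ∈ T) (hst : 2 < M s t) (hst' : 2 < M s' t) :
    s' = s := by
  by_contra hne
  have := (mem_commonCommuting_of_isSpherical hM hT hs' hs ht hst hne (ne_of_two_lt hst')).1
  omega

/-- If a coset contains two vertices of distinct colors with the same image under `g_{t}`, its type
contains `t` and a generator not commuting with `t`. -/
theorem exists_two_lt_of_color_ne (hM : M.IsEven) {t : B} {T : Set B} (hT : cs.IsSpherical T)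
    {x y : W} (hxy : x⁻¹ * y ∈ cs.parabolic T) (hc : cs.color hM t x ≠ cs.color hM t y)
    (hg : cs.retraction hM {t} x = cs.retraction hM {t} y) : t ∈ T ∧ ∃ s ∈ T, 2 < M s t := by
  have hyx : y = x * (x⁻¹ * y) := by rw [mul_inv_cancel_left]
  have ht : t ∈ T := by
    by_contra ht
    apply hc
    rw [hyx, color_mul_of_mem hM ht hxy]
  refine ⟨ht, ?_⟩
  -- If t commuted with the rest of T, W_T would split off W_{t}. Equal images under g_{t} kill that
  -- component of x⁻¹y, and the remaining factor does not affect the color.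
  by_contra! hle
  have htwo : ∀ i ∈ ({t} : Set B), ∀ j ∈ T \ {t}, M i j = 2 := by
    rintro i hi j ⟨hj, hjt⟩
    have h0 : M j t ≠ 0 := (cs.isSpherical_pair_iff hM).1 (hT.mono (by
      rintro _ (rfl | rfl) <;> assumption))
    have h1 := M.off_diagonal j t hjt
    have h2 := hle j hj
    rw [Set.mem_singleton_iff.1 hi, M.symmetric]
    omega
  have hxy' := hxy
  rw [show T = {t} ∪ T \ {t} by simp [ht]] at hxy'
  obtain ⟨a, ha, b, hb, hab⟩ := cs.exists_mul_of_mem_parabolic_union htwo hxy'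
  have hga : (cs.retraction hM {t} a : W) = a := cs.retraction_of_mem hM ha
  have hgb : cs.retraction hM {t} b = 1 :=
    cs.retraction_eq_one hM Set.disjoint_sdiff_right hb
  have h1 : cs.retraction hM {t} (x⁻¹ * y) = 1 := by rw [map_mul, map_inv, hg, inv_mul_cancel]
  rw [hab, map_mul, hgb, mul_one] at h1
  rw [h1] at hga
  have ha1 : a = 1 := hga.symm
  rw [ha1, one_mul] at hab
  apply hc
  rw [hyx, hab, color_mul_of_mem hM (fun h => h.2 rfl) hb]

/-- For T = {t} the subgroup divided out is trivial, so the color records g_{t} itself. -/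
theorem retraction_eq_of_color_eq (hM : M.IsEven) {t : B} {v w : W}
    (h : cs.color hM t v = cs.color hM t w) :
    cs.retraction hM {t} v = cs.retraction hM {t} w := by
  have := QuotientGroup.eq.1 (congrFun h ⟨{t}, cs.isSpherical_singleton t, rfl⟩)
  rw [Subgroup.mem_subgroupOf] at this
  simp only [Set.sdiff_self, parabolic_empty, Subgroup.mem_bot] at this
  exact inv_mul_eq_one.1 (Subtype.ext this)

theorem IsEvenColor.retraction_eq_one {hM : M.IsEven} {t : B} {a : cs.Color t}
    (ha : cs.IsEvenColor hM t a) {v : W} (hv : cs.color hM t v = a) :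
    cs.retraction hM {t} v = 1 := by
  obtain ⟨w, -, hw, rfl⟩ := ha
  rw [retraction_eq_of_color_eq hM hv, hw]

/-! The embedding of the Davis complex of `W_{U_st}`. -/

section

variable {s t : B} {cs' : CoxeterSystem (M.restrict (M.commonCommuting s t))
  (cs.parabolic (M.commonCommuting s t))}

theorem isSpherical_union_image (hcs' : ∀ i, (cs'.simple i : W) = cs.simple i) (hst : M s t ≠ 0)
    {R : Set (M.commonCommuting s t)} (hR : cs'.IsSpherical R) :
    cs.IsSpherical ({s, t} ∪ Subtype.val '' R) := by
  refine cs.isSpherical_union ?_ (cs.isSpherical_pair hst)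
    ((cs.isSpherical_restrict_iff hcs').1 hR)
  rintro i hi _ ⟨j, -, rfl⟩
  exact eq_two_of_mem_commonCommuting i hi j j.2

theorem union_image_subset_iff {R R' : Set (M.commonCommuting s t)} :
    ({s, t} ∪ Subtype.val '' R : Set B) ⊆ {s, t} ∪ Subtype.val '' R' ↔ R ⊆ R' := by
  refine ⟨fun h i hi => ?_, fun h => Set.union_subset_union_right _ (Set.image_mono h)⟩
  rcases h (Or.inr ⟨i, hi, rfl⟩) with (h' | h') | ⟨j, hj, hij⟩
  · exact absurd (h' ▸ i.2) notMem_commonCommuting_left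
  · exact absurd (h' ▸ i.2) notMem_commonCommuting_right
  · rwa [← Subtype.ext hij]

theorem commonCommuting_inter_union_image {R : Set (M.commonCommuting s t)} :
    M.commonCommuting s t ∩ ({s, t} ∪ Subtype.val '' R) = Subtype.val '' R := by
  ext i
  constructor
  · rintro ⟨hi, (rfl | rfl) | h⟩
    · exact absurd hi notMem_commonCommuting_left
    · exact absurd hi notMem_commonCommuting_right
    · exact h
  · rintro ⟨i, hi, rfl⟩
    exact ⟨i.2, Or.inr ⟨i, hi, rfl⟩⟩

/-- Intersecting with W' discards s and t, so inclusions between cosets in W can be tested in W'. -/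
theorem mem_parabolic_union_image_iff (hM : M.IsEven)
    (hcs' : ∀ i, (cs'.simple i : W) = cs.simple i) {R : Set (M.commonCommuting s t)}
    {x : cs.parabolic (M.commonCommuting s t)} :
    (x : W) ∈ cs.parabolic ({s, t} ∪ Subtype.val '' R) ↔ x ∈ cs'.parabolic R := by
  have := cs.parabolic_inf hM (M.commonCommuting s t) ({s, t} ∪ Subtype.val '' R)
  rw [commonCommuting_inter_union_image] at this
  rw [← cs.coe_mem_parabolic_iff hcs', ← this]
  exact ⟨fun h => ⟨x.2, h⟩, fun h => h.2⟩

/-- The embedding `x W'_R ↦ w x W_{ {s, t} ∪ R }`. -/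
theorem exists_orderEmbedding (hM : M.IsEven) (hst : M s t ≠ 0)
    (hcs' : ∀ i, (cs'.simple i : W) = cs.simple i) (w : W) :
    ∃ φ : cs'.SphericalCoset ↪o cs.SphericalCoset, ∀ x R (hR : cs'.IsSpherical R),
      φ (cs'.coset x R hR) = cs.coset (w * x) _ (isSpherical_union_image hcs' hst hR) := by
  have key : ∀ (x : cs.parabolic (M.commonCommuting s t)) R (hR : cs'.IsSpherical R)
      (x' : cs.parabolic (M.commonCommuting s t)) R' (hR' : cs'.IsSpherical R'),
      cs.coset (w * x) _ (isSpherical_union_image hcs' hst hR) ≤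
        cs.coset (w * x') _ (isSpherical_union_image hcs' hst hR') ↔
        cs'.coset x R hR ≤ cs'.coset x' R' hR' := by
    intro x R hR x' R' hR'
    rw [cs.coset_le_iff hM, cs'.coset_le_iff (isEven_restrict hM _), union_image_subset_iff,
      ← mem_parabolic_union_image_iff hM hcs', mul_inv_rev, mul_assoc, inv_mul_cancel_left]
    rfl
  choose x R hR hC using cs'.exists_eq_coset
  refine ⟨OrderEmbedding.ofMapLEIff (fun C => cs.coset (w * x C) _
    (isSpherical_union_image hcs' hst (hR C))) fun C D => ?_, fun y Q hQ => ?_⟩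
  · rw [key _ _ (hR C) _ _ (hR D), ← hC C, ← hC D]
  · change cs.coset (w * x (cs'.coset y Q hQ)) _ (isSpherical_union_image hcs' hst (hR _)) = _
    exact le_antisymm ((key _ _ (hR _) _ _ hQ).2 (hC _).ge) ((key _ _ hQ _ _ (hR _)).2 (hC _).le)

theorem exists_coset_restrict (hM : M.IsEven) (hst : 2 < M s t)
    (hcs' : ∀ i, (cs'.simple i : W) = cs.simple i) {T : Set B} (hT : cs.IsSpherical T)
    (hs : s ∈ T) (ht : t ∈ T) : ∃ R : Set (M.commonCommuting s t), ∃ _ : cs'.IsSpherical R,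
      T = {s, t} ∪ Subtype.val '' R := by
  have himg : Subtype.val '' (Subtype.val ⁻¹' T : Set (M.commonCommuting s t)) =
      T ∩ M.commonCommuting s t := by
    rw [Subtype.image_preimage_coe, Set.inter_comm]
  refine ⟨Subtype.val ⁻¹' T, ?_, ?_⟩
  · rw [cs.isSpherical_restrict_iff hcs', himg]
    exact hT.mono Set.inter_subset_left
  · rw [himg]
    exact eq_union_of_isSpherical hM hT hs ht hst

/-- A set of cosets whose types contain `t` and a generator not commuting with `t`, and which is
closed under the obvious operations, is a union of Davis complexes. -/
theorem exists_isComponentEmbedding (hM : M.IsEven) (hst : 2 < M s t)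
    (hcs' : ∀ i, (cs'.simple i : W) = cs.simple i) {Z : Set cs.SphericalCoset}
    (h1 : ∀ w T hT, cs.coset w T hT ∈ Z → t ∈ T ∧ ∃ s ∈ T, 2 < M s t)
    {w : W} {T : Set B} {hT : cs.IsSpherical T} (hs : s ∈ T) (ht : t ∈ T)
    (h2 : ∀ x ∈ cs.parabolic (M.commonCommuting s t), ∀ R ⊆ M.commonCommuting s t,
      ∀ hR : cs.IsSpherical ({s, t} ∪ R), cs.coset (w * x) _ hR ∈ Z) :
    ∃ φ : cs'.SphericalCoset → cs.SphericalCoset,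
      IsComponentEmbedding cs'.davisComplex (cs.davisComplex.restrictTo Z) φ ∧
        cs.coset w T hT ∈ Set.range φ := by
  have hst0 : M s t ≠ 0 := by omega
  obtain ⟨φ, hφ⟩ := exists_orderEmbedding hM hst0 hcs' w
  have hcoset : ∀ {x R R'} {hR : cs.IsSpherical R} {hR' : cs.IsSpherical R'}, R = R' →
      cs.coset x R hR = cs.coset x R' hR' := fun h => (cs.coset_inj hM).2 h
  have hrange : ∀ x ∈ cs.parabolic (M.commonCommuting s t), ∀ T (hT : cs.IsSpherical T), s ∈ T →
      t ∈ T → cs.coset (w * x) T hT ∈ Set.range φ := by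
    intro x hx T hT hs ht
    obtain ⟨R, hR, hTR⟩ := exists_coset_restrict hM hst hcs' hT hs ht
    refine ⟨cs'.coset ⟨x, hx⟩ R hR, ?_⟩
    rw [hφ]
    exact hcoset hTR.symm
  refine ⟨φ, isComponentEmbedding_orderComplex φ (fun C => ?_) fun D hD C hle => ?_, ?_⟩
  · obtain ⟨x, R, hR, rfl⟩ := cs'.exists_eq_coset C
    rw [hφ]
    exact h2 x x.2 _ (by rintro _ ⟨i, -, rfl⟩; exact i.2) _
  · obtain ⟨x, R, hR, rfl⟩ := cs'.exists_eq_coset C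
    rw [hφ] at hle
    obtain ⟨v, Q, hQ, rfl⟩ := cs.exists_eq_coset D
    obtain ⟨htQ, s', hs'Q, hs't⟩ := h1 v Q hQ hD
    -- A smaller coset may have another representative, but its type still contains s; the W_{s,t}
    -- part of the change is absorbed by that type and the rest lies in W'. A larger coset keeps the
    -- representative.
    rcases hle with hle | hle
    · have hle' := (cs.coset_le_iff hM).1 hle
      have hss' : s' = s := eq_of_two_lt_of_isSpherical hM (isSpherical_union_image hcs' hst0 hR)
        (Or.inl (Or.inl rfl)) (hle'.1 hs'Q) (Or.inl (Or.inr rfl)) hst hs't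
      subst hss'
      obtain ⟨d, hd, y, hy, hdy⟩ := cs.exists_mul_of_mem_parabolic_union (by
        rintro i hi _ ⟨j, -, rfl⟩
        exact eq_two_of_mem_commonCommuting i hi j j.2) hle'.2
      have hy' : y ∈ cs.parabolic (M.commonCommuting s' t) :=
        cs.parabolic_mono (by rintro _ ⟨i, -, rfl⟩; exact i.2) hy
      have hcomm := cs.commute_parabolic eq_two_of_mem_commonCommuting hd hy'
      have hv : v = w * (x * y) * d := by
        rw [inv_mul_eq_iff_eq_mul] at hdy
        rw [hdy, hcomm.eq]
        simp only [mul_assoc]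
      have : cs.coset v Q hQ = cs.coset (w * (x * y)) Q hQ := (cs.coset_eq_iff hM).2 ⟨rfl, by
        rw [hv, inv_mul_cancel_left]
        exact cs.parabolic_mono (by rintro _ (rfl | rfl) <;> assumption) hd⟩
      rw [this]
      exact hrange _ (mul_mem x.2 hy') Q hQ hs'Q htQ
    · obtain ⟨Q', hQ', he⟩ := cs.exists_of_coset_le hle
      rw [he] at hle ⊢
      exact hrange _ x.2 Q' hQ' ((cs.coset_le_coset_iff_subset hM).1 hle (Or.inl (Or.inl rfl)))
        ((cs.coset_le_coset_iff_subset hM).1 hle (Or.inl (Or.inr rfl)))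
  · simpa using hrange 1 (one_mem _) T hT hs ht

end

/-! ### The nerve of `W_{U_st}` -/

section

variable {s t : B} {cs' : CoxeterSystem (M.restrict (M.commonCommuting s t))
  (cs.parabolic (M.commonCommuting s t))}

/-- A spherical set containing s and t has all its other members in U_st. Conversely, a finite
subgroup of W' and W_{s,t} commute and generate a finite group. -/
theorem map_nerve_eq_link (hM : M.IsEven) (hst : 2 < M s t)
    (hcs' : ∀ i, (cs'.simple i : W) = cs.simple i) :
    cs'.nerve.map Subtype.val = cs.nerve.link {s, t} := by
  have hst0 : M s t ≠ 0 := by omega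
  ext σ
  constructor
  · rintro ⟨τ, ⟨hτ, hτs⟩, rfl⟩
    refine ⟨hτ.image _, ?_, ⟨s, by simp⟩, ?_⟩
    · rw [Finset.disjoint_left]
      intro i hi hi'
      obtain ⟨j, -, rfl⟩ := Finset.mem_image.1 hi
      rcases Finset.mem_insert.1 hi' with h | h
      · exact notMem_commonCommuting_left (h ▸ j.2)
      · exact notMem_commonCommuting_right (Finset.mem_singleton.1 h ▸ j.2)
    · have := isSpherical_union_image hcs' hst0 hτs
      convert this using 1
      ext i
      simp [or_assoc]
  · rintro ⟨hσ, hdisj, -, hsph⟩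
    have hsub : ∀ i ∈ σ, i ∈ M.commonCommuting s t := by
      intro i hi
      have hi' : i ∉ ({s, t} : Finset B) := Finset.disjoint_left.1 hdisj hi
      simp only [Finset.mem_insert, Finset.mem_singleton, not_or] at hi'
      exact mem_commonCommuting_of_isSpherical hM hsph (by simp [hi]) (by simp) (by simp) hst
        hi'.1 hi'.2
    have himg : (σ.subtype (· ∈ M.commonCommuting s t)).image Subtype.val = σ := by
      ext i
      simp only [Finset.mem_image, Finset.mem_subtype]
      exact ⟨by rintro ⟨j, hj, rfl⟩; exact hj, fun hi => ⟨⟨i, hsub i hi⟩, hi, rfl⟩⟩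
    refine ⟨σ.subtype (· ∈ M.commonCommuting s t), ⟨?_, ?_⟩, himg⟩
    · rw [← Finset.image_nonempty (f := Subtype.val), himg]
      exact hσ
    · rw [cs.isSpherical_restrict_iff hcs', ← Finset.coe_image, himg]
      exact hsph.mono fun i hi => by simp [Finset.mem_coe.1 hi]

theorem isSpherical_restrict_iff_union (hst : 2 < M s t)
    (hcs' : ∀ i, (cs'.simple i : W) = cs.simple i) {R : Set (M.commonCommuting s t)} :
    cs'.IsSpherical R ↔ cs.IsSpherical ({s, t} ∪ Subtype.val '' R) :=
  ⟨isSpherical_union_image hcs' (by omega), fun h =>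
    (cs.isSpherical_restrict_iff hcs').2 (h.mono Set.subset_union_right)⟩

variable {N : Type*} [TopologicalSpace N] [ChartedSpace E3 N]

theorem exists_cycle_commonCommuting [Finite B] (hM : M.IsEven) (hflag : cs.nerve.IsFlag)
    (h : cs.nerve.Realization ≃ₜ N) (hst : 2 < M s t)
    (hcs' : ∀ i, (cs'.simple i : W) = cs.simple i) :
    ∃ n : ℕ, 4 ≤ n ∧ ∃ c : ℤ → M.commonCommuting s t, (∀ i j, c i = c j ↔ (n : ℤ) ∣ i - j) ∧
      (∀ v, ∃ i, v = c i) ∧ ∀ i w, (w ≠ c i ∧ cs'.IsSpherical {c i, w}) ↔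
        w = c (i + 1) ∨ w = c (i - 1) := by
  have hne := ne_of_two_lt hst
  obtain ⟨n, hn, c, hc, hv, hadj⟩ := exists_cycle_link h hflag hne (s := s) (t := t)
    ⟨⟨s, by simp⟩, by simpa using cs.isSpherical_pair (s := s) (t := t) (by omega)⟩
  have hmem : ∀ i, c i ∈ M.commonCommuting s t := by
    intro i
    obtain ⟨h1, h2, -, h3⟩ := (hv (c i)).2 ⟨i, rfl⟩
    exact mem_commonCommuting_of_isSpherical hM h3 (by simp) (by simp) (by simp) hst h1 h2
  refine ⟨n, hn, fun i => ⟨c i, hmem i⟩, fun i j => ?_, fun v => ?_, fun i w => ?_⟩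
  · rw [Subtype.mk.injEq, hc]
  · have hs := (isSpherical_restrict_iff_union hst hcs').1 (cs'.isSpherical_singleton v)
    obtain ⟨i, hi⟩ := (hv v).1 ⟨fun h => notMem_commonCommuting_left (h ▸ v.2),
      fun h => notMem_commonCommuting_right (h ▸ v.2), ⟨s, by simp⟩, by
        convert hs using 1
        ext i
        simp
        tauto⟩
    exact ⟨i, Subtype.ext hi⟩
  · have := hadj i w
    rw [Subtype.ext_iff, Subtype.ext_iff, ← this, isSpherical_restrict_iff_union hst hcs']
    have hset : ({s, t} ∪ Subtype.val '' {(⟨c i, hmem i⟩ : M.commonCommuting s t), w} : Set B) =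
        (({s, t, c i, (w : B)} : Finset B) : Set B) := by
      ext j
      simp [Set.image_pair]
      tauto
    rw [hset, ne_eq, Subtype.ext_iff]
    constructor
    · rintro ⟨h1, h2⟩
      exact ⟨fun h => notMem_commonCommuting_left (h ▸ w.2),
        fun h => notMem_commonCommuting_right (h ▸ w.2), h1, ⟨s, by simp⟩, h2⟩
    · rintro ⟨-, -, h1, -, h2⟩
      exact ⟨h1, h2⟩

theorem hasCycleNerve [Finite B] (hM : M.IsEven) (hflag : cs.nerve.IsFlag)
    (h : cs.nerve.Realization ≃ₜ N) (hst : 2 < M s t)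
    (hcs' : ∀ i, (cs'.simple i : W) = cs.simple i) : cs'.HasCycleNerve := by
  have hne := ne_of_two_lt hst
  obtain ⟨n, hn, c, hc, hv, hadj⟩ := exists_cycle_commonCommuting hM hflag h hst hcs'
  refine ⟨⟨c 0⟩, fun R hR => ?_, fun v => ?_, fun v w => ?_⟩
  · have hs := (isSpherical_restrict_iff_union hst hcs').1 hR
    have hRfin := R.toFinite
    have hface : ({s, t} ∪ hRfin.toFinset.image Subtype.val : Finset B) ∈ cs.nerve.faces :=
      ⟨⟨s, by simp⟩, by
        convert hs using 1
        ext i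
        simp [or_assoc]⟩
    -- Simplices of L have at most four vertices and two are taken by s and t, so R has at most two
    -- elements.
    have hcard := card_le_four h hface
    rw [Finset.card_union_of_disjoint, Finset.card_pair hne,
      Finset.card_image_of_injective _ Subtype.val_injective,
      ← Set.ncard_eq_toFinset_card R hRfin] at hcard
    · have h2 : R.ncard = 0 ∨ R.ncard = 1 ∨ R.ncard = 2 := by omega
      rcases h2 with h2 | h2 | h2
      · exact Or.inl ((Set.ncard_eq_zero hRfin).1 h2)
      · exact Or.inr (Or.inl (Set.ncard_eq_one.1 h2))
      · exact Or.inr (Or.inr (Set.ncard_eq_two.1 h2))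
    · rw [Finset.disjoint_right]
      intro i hi hi'
      obtain ⟨j, -, rfl⟩ := Finset.mem_image.1 hi
      rcases Finset.mem_insert.1 hi' with h | h
      · exact notMem_commonCommuting_left (h ▸ j.2)
      · exact notMem_commonCommuting_right (Finset.mem_singleton.1 h ▸ j.2)
  · obtain ⟨i, rfl⟩ := hv v
    refine ⟨c (i + 1), c (i - 1), fun he => ?_, fun w => hadj i w⟩
    obtain ⟨k, hk⟩ := (hc _ _).1 he
    have h2 : (n : ℤ) ∣ 2 := ⟨k, by linarith⟩
    have := Int.le_of_dvd (by norm_num) h2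
    omega
  · obtain ⟨i, rfl⟩ := hv v
    obtain ⟨j, rfl⟩ := hv w
    have hstep : ∀ i, c (i + 1) ≠ c i ∧ cs'.IsSpherical {c i, c (i + 1)} :=
      fun i => (hadj i _).2 (Or.inl rfl)
    have hup : ∀ (k : ℕ) (i : ℤ), Relation.ReflTransGen
        (fun a b => b ≠ a ∧ cs'.IsSpherical {a, b}) (c i) (c (i + k)) := by
      intro k i
      induction k with
      | zero => rw [Nat.cast_zero, add_zero]
      | succ k ih =>
        refine ih.tail ?_
        rw [Nat.cast_succ, ← add_assoc]
        exact hstep _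
    rcases le_total i j with hij | hij
    · have := hup (j - i).toNat i
      rwa [Int.toNat_of_nonneg (by omega), add_sub_cancel] at this
    · have := hup (i - j).toNat j
      rw [Int.toNat_of_nonneg (by omega), add_sub_cancel] at this
      refine reflTransGen_symm (fun a b hab => ⟨hab.1.symm, ?_⟩) this
      rw [Set.pair_comm]
      exact hab.2

/-- If W' were finite, its whole generating set would be spherical and hence a pair, but three
consecutive vertices of the cycle are distinct. -/
theorem infinite_parabolic_commonCommuting [Finite B] (hM : M.IsEven) (hflag : cs.nerve.IsFlag)
    (h : cs.nerve.Realization ≃ₜ N) (hst : 2 < M s t) :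
    Infinite (cs.parabolic (M.commonCommuting s t)) := by
  obtain ⟨cs', hcs'⟩ := cs.exists_restrict hM (M.commonCommuting s t)
  obtain ⟨n, hn, c, hc, -, -⟩ := exists_cycle_commonCommuting hM hflag h hst hcs'
  have hcyc := hasCycleNerve hM hflag h hst hcs'
  by_contra hfin
  rw [not_infinite_iff_finite] at hfin
  have hsph : cs'.IsSpherical Set.univ := by
    change Finite (cs'.parabolic Set.univ)
    infer_instance
  have hcne : ∀ i j : ℤ, 0 < i - j → i - j < 4 → c i ≠ c j := by
    intro i j h1 h2 he
    have := Int.le_of_dvd h1 ((hc _ _).1 he)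
    omega
  have huniv := hcyc.eq_pair_of_subset (hcne 1 0 (by norm_num) (by norm_num)) hsph
    (Set.subset_univ _)
  have : c 2 ∈ ({c 1, c 0} : Set _) := huniv ▸ Set.mem_univ (c 2)
  rcases this with h | h
  · exact hcne 2 1 (by norm_num) (by norm_num) h
  · exact hcne 2 0 (by norm_num) (by norm_num) h

end

end CoxeterSystem

end

noncomputable section

/-! ### Conjugation in amalgamated products -/

namespace Monoid.PushoutI

open CoprodI Function

variable {ι : Type*} {G : ι → Type*} {H : Type*} [∀ i, Group (G i)] [Group H]
  {φ : ∀ i, H →* G i}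

/-- A letter of a normal form is a nontrivial coset representative from a transversal containing 1,
so it lies outside the amalgamated subgroup. -/
theorem exists_reduced (hφ : ∀ i, Injective (φ i)) (x : PushoutI φ) :
    ∃ (h : H) (w : Word G), Reduced φ w ∧ x = base φ h * ofCoprodI w.prod := by
  classical
  obtain ⟨d⟩ := NormalWord.transversal_nonempty φ hφ
  obtain ⟨w, rfl⟩ := (NormalWord.equiv (d := d)).symm.surjective x
  refine ⟨w.head, w.toWord, ?_, rfl⟩
  rintro ⟨i, g⟩ hg hmem
  have hset := w.normalized i g hg
  have := (d.compl i).1 (a₁ := (⟨g, hmem⟩, ⟨1, d.one_mem i⟩)) (a₂ := (1, ⟨g, hset⟩)) (by simp)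
  exact w.ne_one _ hg (congrArg (fun p => (p.2 : G i)) this).symm

/-- Passage to the normal form preserves the sequence of factors, and the normal form depends only
on the product. -/
theorem length_eq_of_reduced (hφ : ∀ i, Injective (φ i)) {w w' : Word G} (hw : Reduced φ w)
    (hw' : Reduced φ w') (h : (ofCoprodI w.prod : PushoutI φ) = ofCoprodI w'.prod) :
    w.toList.length = w'.toList.length := by
  classical
  obtain ⟨d⟩ := NormalWord.transversal_nonempty φ hφ
  obtain ⟨v, hv, hl⟩ := hw.exists_normalWord_prod_eq d
  obtain ⟨v', hv', hl'⟩ := hw'.exists_normalWord_prod_eq d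
  have : v = v' := NormalWord.prod_injective (hv.trans (h.trans hv'.symm))
  rw [← List.length_map (as := w.toList) Sigma.fst, ← hl, this, hl', List.length_map]

theorem length_le_one_of_reduced (hφ : ∀ i, Injective (φ i)) {w : Word G} (hw : Reduced φ w)
    {k : ι} (h : (ofCoprodI w.prod : PushoutI φ) ∈ (of k : G k →* PushoutI φ).range) :
    w.toList.length ≤ 1 := by
  classical
  obtain ⟨c, hc⟩ := h
  by_cases hcr : c ∈ (φ k).range
  · obtain ⟨y, rfl⟩ := hcr
    have := hw.eq_empty_of_mem_range hφ ⟨y, by rw [← hc, of_apply_eq_base]⟩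
    simp [this]
  · have hc1 : c ≠ 1 := fun h => hcr (h ▸ one_mem _)
    let v : Word G := ⟨[⟨k, c⟩], by simpa using hc1, by simp⟩
    refine (length_eq_of_reduced hφ (w' := v) hw ?_ ?_).le
    · intro g hg
      obtain rfl := List.mem_singleton.1 hg
      exact hcr
    · rw [← hc]
      simp [v, Word.prod]

theorem notMem_range_inv {i j : ι} (w : NeWord G i j) (hw : ∀ g ∈ w.toList, g.2 ∉ (φ g.1).range) :
    ∀ g ∈ w.inv.toList, g.2 ∉ (φ g.1).range := by
  induction w with
  | singleton x hx =>
    intro g hg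
    obtain rfl := List.mem_singleton.1 hg
    have := hw ⟨_, x⟩ (List.mem_singleton.2 rfl)
    simpa using this
  | append w₁ hne w₂ h₁ h₂ =>
    intro g hg
    rcases List.mem_append.1 hg with hg | hg
    · exact h₂ (fun g hg => hw g (List.mem_append_right _ hg)) g hg
    · exact h₁ (fun g hg => hw g (List.mem_append_left _ hg)) g hg

/-- An element conjugating `b ∈ G k` into `G k` lies in `G k`, provided that no conjugate of `b` in
`G k` lies in the amalgamated subgroup. -/
theorem mem_range_of_conj_mem_range (hφ : ∀ i, Injective (φ i)) {k : ι} {b : G k}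
    (hb : ∀ g : G k, g * b * g⁻¹ ∉ (φ k).range) {x : PushoutI φ}
    (hx : x * of k b * x⁻¹ ∈ (of k : G k →* PushoutI φ).range) :
    x ∈ (of k : G k →* PushoutI φ).range := by
  classical
  have hbase : ∀ h, base φ h ∈ (of k : G k →* PushoutI φ).range :=
    fun h => ⟨φ k h, of_apply_eq_base φ k h⟩
  have key : ∀ (w : Word G), Reduced φ w → (∀ g ∈ w.toList.getLast?, g.1 ≠ k) → ∀ g : G k,
      ofCoprodI w.prod * of k (g * b * g⁻¹) * (ofCoprodI w.prod)⁻¹ ∈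
        (of k : G k →* PushoutI φ).range → w = Word.empty := by
    intro w hw hlast g hmem
    by_contra hne
    obtain ⟨i, j, v, rfl⟩ := NeWord.of_word w hne
    have hj : j ≠ k := hlast ⟨j, v.last⟩ (by
      rw [show v.toWord.toList = v.toList from rfl, NeWord.toList_getLast?]
      rfl)
    have hg1 : g * b * g⁻¹ ≠ 1 := fun h => hb g (h ▸ one_mem _)
    -- Since v ends outside the factor k, no cancellation occurs around the middle letter; the
    -- conjugate has a reduced word of length at least 3 and cannot lie in one factor.
    let u : NeWord G i i := ((v.append hj (NeWord.singleton _ hg1)).append hj.symm v.inv)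
    have hu : Reduced φ u.toWord := by
      intro a ha
      rcases List.mem_append.1 ha with ha | ha
      · rcases List.mem_append.1 ha with ha | ha
        · exact hw a ha
        · obtain rfl := List.mem_singleton.1 ha
          exact hb g
      · exact notMem_range_inv v hw a ha
    have hprod : (ofCoprodI u.toWord.prod : PushoutI φ) =
        ofCoprodI v.toWord.prod * of k (g * b * g⁻¹) * (ofCoprodI v.toWord.prod)⁻¹ := by
      change (ofCoprodI u.prod : PushoutI φ) = ofCoprodI v.prod * _ * (ofCoprodI v.prod)⁻¹
      rw [NeWord.append_prod, NeWord.append_prod, NeWord.inv_prod, map_mul, map_mul, map_inv,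
        NeWord.prod_singleton, ofCoprodI_of]
    rw [← hprod] at hmem
    have hlen := length_le_one_of_reduced hφ hu hmem
    have hlen' : u.toWord.toList.length = (v.toList.length + 1) + v.inv.toList.length := by
      rw [show u.toWord.toList = v.toList ++ [⟨k, g * b * g⁻¹⟩] ++ v.inv.toList from rfl,
        List.length_append, List.length_append, List.length_singleton]
    have := List.length_pos_iff.2 v.toList_ne_nil
    omega
  obtain ⟨h, w, hw, rfl⟩ := exists_reduced hφ x
  have hmem : ofCoprodI w.prod * of k b * (ofCoprodI w.prod)⁻¹ ∈
      (of k : G k →* PushoutI φ).range := by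
    have := mul_mem (mul_mem (inv_mem (hbase h)) hx) (hbase h)
    simpa [mul_assoc] using this
  refine mul_mem (hbase h) ?_
  by_cases hlast : ∀ g ∈ w.toList.getLast?, g.1 ≠ k
  · rw [key w hw hlast 1 (by simpa using hmem)]
    simp
  -- A last letter from the factor k is absorbed into b. This is why `key` is stated for all
  -- conjugates of b within that factor.
  · push Not at hlast
    obtain ⟨⟨_, g⟩, hg, rfl⟩ := hlast
    obtain ⟨l, hl⟩ := List.getLast?_eq_some_iff.1 hg
    have hchain := w.chain_ne
    rw [hl, List.isChain_append] at hchain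
    let w' : Word G := ⟨l, fun a ha => w.ne_one a (hl ▸ List.mem_append_left _ ha), hchain.1⟩
    have hprod : w.prod = w'.prod * CoprodI.of g := by
      simp [Word.prod, hl, w']
    have hempty := key w' (fun a ha => hw a (hl ▸ List.mem_append_left _ ha))
      (fun a ha => hchain.2.2 a ha _ rfl) g (by
        rw [hprod] at hmem
        simpa [mul_assoc] using hmem)
    rw [hprod, hempty]
    simp

end Monoid.PushoutI

end

noncomputable section

/-! ### The intersection of two collars -/

namespace CoxeterSystem

open PreAbstractSimplicialComplex Monoid
open scoped Classical Pointwise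

variable {B W : Type*} [Group W] {M : CoxeterMatrix B} {cs : CoxeterSystem M W}

/-- If r also had a finite label with s, flagness would make {r, s, t} spherical, and r would
commute with both s and t. -/
theorem eq_zero_of_notMem_commonCommuting [Finite B] (hM : M.IsEven) (hflag : cs.nerve.IsFlag)
    {r s t : B} (hst : 2 < M s t) (hr : r ∈ M.finiteNeighbors t) (hrs : r ≠ s) (hrt : r ≠ t)
    (hrQ : r ∉ M.commonCommuting s t) : M r s = 0 := by
  by_contra h0
  refine hrQ (mem_commonCommuting_of_isSpherical hM (T := {r, s, t})
    ((cs.isSpherical_iff hM hflag).2 ?_) (by simp) (by simp) (by simp) hst hrs hrt)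
  have hdiag : ∀ i, M i i ≠ 0 := fun i => by rw [M.diagonal]; exact one_ne_zero
  have hts : M t s ≠ 0 := by rw [M.symmetric]; omega
  have hsr : M s r ≠ 0 := by rw [M.symmetric]; exact h0
  have htr : M t r ≠ 0 := by rw [M.symmetric]; exact hr
  rintro i (rfl | rfl | rfl) j (rfl | rfl | rfl)
  exacts [hdiag _, h0, hr, hsr, hdiag _, by omega, htr, hts, hdiag _]

/-- An element of `W_U` commuting with a rotation of `W_{s,t}` lies in `W_{s,t} × W_{U_st}`. -/
theorem mem_parabolic_of_commute [Finite B] (hM : M.IsEven) (hflag : cs.nerve.IsFlag) {s t : B}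
    (hst : 2 < M s t) {n : W} (hn : n ∈ cs.parabolic {s, t}) (hn1 : n ≠ 1)
    (hgn : cs.retraction hM {t} n = 1) {x : W} (hx : x ∈ cs.parabolic (M.finiteNeighbors t))
    (hcomm : x * n * x⁻¹ = n) : x ∈ cs.parabolic ({s, t} ∪ M.commonCommuting s t) := by
  set U := M.finiteNeighbors t with hU
  set Q := M.commonCommuting s t with hQ
  have hne := ne_of_two_lt hst
  -- The two factors are generated by U - s and by {s, t} ∪ U_st; they are amalgamated along the
  -- subgroup of U_st ∪ {t}.
  let S : Bool → Set B := fun b => if b then U \ {s} else {s, t} ∪ Q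
  have htU : t ∈ U := by
    change M t t ≠ 0
    rw [M.diagonal]
    exact one_ne_zero
  have hsU : s ∈ U := by
    change M s t ≠ 0
    omega
  have hQU : Q ⊆ U := by
    intro i hi
    change M i t ≠ 0
    rw [hi.1]
    exact two_ne_zero
  have hCS : ∀ b, Q ∪ {t} ⊆ S b := by
    rintro (_ | _) i (hi | hi)
    · exact Or.inr hi
    · exact Or.inl (Or.inr hi)
    · exact ⟨hQU hi, fun h => notMem_commonCommuting_left (h ▸ hi)⟩
    · rw [Set.mem_singleton_iff.1 hi]
      exact ⟨htU, hne.symm⟩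
  let φ : ∀ b, cs.parabolic (Q ∪ {t}) →* cs.parabolic (S b) :=
    fun b => Subgroup.inclusion (cs.parabolic_mono (hCS b))
  have hφ : ∀ b, Function.Injective (φ b) := fun b => Subgroup.inclusion_injective _
  let gen : ∀ b, ∀ i ∈ S b, PushoutI φ := fun b i hi =>
    PushoutI.of b ⟨cs.simple i, cs.simple_mem_parabolic hi⟩
  have hgen : ∀ i ∈ U, i ≠ s → ∀ (b) (hi : i ∈ S b) (hi' : i ∈ S true),
      gen true i hi' = gen b i hi := by
    rintro i hiU his (_ | _) hi hi'
    · have hiC : i ∈ Q ∪ {t} := by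
        rcases hi with (h | h) | h
        exacts [absurd h his, Or.inr h, Or.inl h]
      exact (PushoutI.of_apply_eq_base φ true ⟨_, cs.simple_mem_parabolic hiC⟩).trans
        (PushoutI.of_apply_eq_base φ false ⟨_, cs.simple_mem_parabolic hiC⟩).symm
    · rfl
  have hsS : s ∈ S false := Or.inl (Or.inl rfl)
  let f : B → PushoutI φ := fun i =>
    if h : i ∈ U then if h' : i = s then gen false s hsS else gen true i ⟨h, h'⟩ else 1
  have hf : ∀ (b) (i) (hi : i ∈ S b), f i = gen b i hi := by
    intro b i hi
    have hiU : i ∈ U := by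
      cases b with
      | false =>
        rcases hi with (rfl | rfl) | h
        exacts [hsU, htU, hQU h]
      | true => exact hi.1
    by_cases his : i = s
    · subst his
      cases b with
      | false => simp [f, hiU]
      | true => exact absurd rfl hi.2
    · simp only [f, hiU, his, dif_pos, dif_neg, not_false_eq_true]
      exact hgen i hiU his b hi ⟨hiU, his⟩
  have hfU : ∀ i, i ∉ U → f i = 1 := fun i hi => dif_neg hi
  have hpow : ∀ (b) (i j) (hi : i ∈ S b) (hj : j ∈ S b), (f i * f j) ^ M i j = 1 := by
    intro b i j hi hj
    rw [hf b i hi, hf b j hj]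
    simp only [gen]
    rw [← map_mul, ← map_pow]
    refine (congrArg _ (Subtype.ext ?_)).trans (map_one _)
    exact cs.simple_mul_simple_pow i j
  have hcover : ∀ i ∈ U, ∃ b, i ∈ S b := by
    intro i hi
    by_cases his : i = s
    · exact ⟨false, his ▸ hsS⟩
    · exact ⟨true, hi, his⟩
  have hsq : ∀ i, f i * f i = 1 := by
    intro i
    by_cases hi : i ∈ U
    · obtain ⟨b, hb⟩ := hcover i hi
      have := hpow b i i hb hb
      rwa [M.diagonal, pow_one] at this
    · rw [hfU i hi, one_mul]
  -- Two generators in U not contained in a common factor are s and some r with infinite label, so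
  -- they impose no relation.
  have hlift : M.IsLiftable f := by
    intro i j
    by_cases hij : i = j
    · subst hij
      rw [M.diagonal, pow_one, hsq]
    obtain ⟨m, hm⟩ := hM i j hij
    by_cases hi : i ∈ U
    swap
    · rw [hfU i hi, one_mul, hm, ← two_mul, pow_mul, pow_two, hsq, one_pow]
    by_cases hj : j ∈ U
    swap
    · rw [hfU j hj, mul_one, hm, ← two_mul, pow_mul, pow_two, hsq, one_pow]
    by_cases his : i = s
    · subst his
      by_cases hjS : j ∈ S false
      · exact hpow false i j hsS hjS
      · rw [M.symmetric, eq_zero_of_notMem_commonCommuting hM hflag hst hj (Ne.symm hij)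
          (fun h => hjS (Or.inl (Or.inr h))) (fun h => hjS (Or.inr h)), pow_zero]
    by_cases hjs : j = s
    · subst hjs
      by_cases hiS : i ∈ S false
      · exact hpow false i j hiS hsS
      · rw [eq_zero_of_notMem_commonCommuting hM hflag hst hi hij
          (fun h => hiS (Or.inl (Or.inr h))) (fun h => hiS (Or.inr h)), pow_zero]
    · exact hpow true i j ⟨hi, his⟩ ⟨hj, hjs⟩
  let Ψ : W →* PushoutI φ := cs.lift ⟨f, hlift⟩
  have hΨs : ∀ i, Ψ (cs.simple i) = f i := cs.lift_apply_simple hlift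
  have hΨ : ∀ b (w : cs.parabolic (S b)), Ψ w = PushoutI.of b w := by
    rintro b ⟨w, hw⟩
    dsimp only
    induction hw using Subgroup.closure_induction with
    | mem y hy =>
      obtain ⟨i, hi, rfl⟩ := hy
      rw [hΨs, hf b i hi]
    | one => rw [map_one]; exact (map_one (PushoutI.of b)).symm
    | mul y z hy hz h1 h2 =>
      rw [map_mul, h1, h2]
      exact (map_mul (PushoutI.of (φ := φ) b) (⟨y, hy⟩ : cs.parabolic (S b)) ⟨z, hz⟩).symm
    | inv y hy h1 =>
      rw [map_inv, h1]
      exact (map_inv (PushoutI.of (φ := φ) b) (⟨y, hy⟩ : cs.parabolic (S b))).symm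
  -- Only a left inverse of Ψ on W_U is needed, not the full isomorphism with the amalgam.
  let Λ : PushoutI φ →* W := PushoutI.lift (fun b => (cs.parabolic (S b)).subtype)
    (cs.parabolic (Q ∪ {t})).subtype (fun b => rfl)
  have hΛ : ∀ w ∈ cs.parabolic U, Λ (Ψ w) = w := by
    intro w hw
    induction hw using Subgroup.closure_induction with
    | mem y hy =>
      obtain ⟨i, hi, rfl⟩ := hy
      obtain ⟨b, hb⟩ := hcover i hi
      rw [hΨs, hf b i hb]
      exact PushoutI.lift_of ..
    | one => simp
    | mul y z _ _ h1 h2 => rw [map_mul, map_mul, h1, h2]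
    | inv y _ h1 => rw [map_inv, map_inv, h1]
  have hnS : n ∈ cs.parabolic (S false) := cs.parabolic_mono Set.subset_union_left hn
  -- The U_st component of g commutes with n, so the conjugate is dnd⁻¹ with d in W_{s,t}. If it lay
  -- in the amalgamated subgroup it would lie in W_{t}, where a trivial image under g_{t} makes it,
  -- and hence n, the identity.
  have hconj : ∀ g : cs.parabolic (S false), g * ⟨n, hnS⟩ * g⁻¹ ∉ (φ false).range := by
    rintro ⟨g, hg⟩ ⟨⟨z, hz⟩, hzg⟩
    have hzg : z = g * n * g⁻¹ := congrArg Subtype.val hzg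
    obtain ⟨d, hd, y, hy, rfl⟩ :=
      cs.exists_mul_of_mem_parabolic_union eq_two_of_mem_commonCommuting hg
    have hny := (cs.commute_parabolic eq_two_of_mem_commonCommuting hn hy).eq
    have hzd : z = d * n * d⁻¹ := by
      rw [hzg, mul_inv_rev, mul_assoc d y n, ← hny]
      group
    have hz2 : z ∈ cs.parabolic {s, t} := by
      rw [hzd]
      exact mul_mem (mul_mem hd hn) (inv_mem hd)
    have hzt : z ∈ cs.parabolic {t} := by
      have : z ∈ cs.parabolic ({s, t} ∩ (Q ∪ {t})) := by
        rw [← cs.parabolic_inf hM]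
        exact ⟨hz2, hz⟩
      refine cs.parabolic_mono ?_ this
      rintro i ⟨rfl | rfl, h | h⟩
      · exact absurd h notMem_commonCommuting_left
      · exact h
      · exact rfl
      · exact rfl
    have hz1 : z = 1 := by
      have h1 := cs.retraction_of_mem hM hzt
      rw [hzd, map_mul, map_mul, hgn, mul_one, map_inv, mul_inv_cancel] at h1
      rw [hzd]
      exact h1.symm
    rw [hz1, eq_comm, mul_inv_eq_one, mul_eq_left] at hzd
    exact hn1 hzd
  have hrange : Ψ x ∈ (PushoutI.of (φ := φ) false).range := by
    refine PushoutI.mem_range_of_conj_mem_range hφ hconj ⟨⟨n, hnS⟩, ?_⟩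
    rw [← hΨ false ⟨n, hnS⟩, ← map_inv, ← map_mul, ← map_mul, hcomm]
  obtain ⟨g, hg⟩ := hrange
  have hxg : x = g := by
    rw [← hΛ x hx, ← hg]
    exact PushoutI.lift_of ..
  rw [hxg]
  exact g.2

/-- Represent the coset as xW_T and as uyW_T, with x and y products of generators in U - t. The
color argument puts s and t into T. Two retractions then show that x, up to a factor from W_{s},
commutes with a nontrivial element of W_{s,t}, and the amalgam argument forces x into W_{s} times
W', where the W_{s} part is absorbed by T. -/
theorem exists_eq_coset_of_mem_collars [Finite B] (hM : M.IsEven) (hflag : cs.nerve.IsFlag)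
    {s t : B} (hst : 2 < M s t) {u : W} (hu : u ∈ cs.parabolic {s, t})
    (hus : u ∉ cs.parabolic {s}) (hgu : cs.retraction hM {t} u = 1) {C : cs.SphericalCoset}
    (h1 : C ∈ cs.cosetsOver (cs.parabolic (M.finiteNeighbors t \ {t})) (M.finiteNeighbors t))
    (h2 : C ∈ cs.cosetsOver (u • (cs.parabolic (M.finiteNeighbors t \ {t}) : Set W))
      (M.finiteNeighbors t)) :
    ∃ x ∈ cs.parabolic (M.commonCommuting s t), ∃ (T : Set B) (hT : cs.IsSpherical T),
      s ∈ T ∧ t ∈ T ∧ C = cs.coset x T hT := by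
  obtain ⟨x, hx, T, hT, hTU, rfl⟩ := h1
  obtain ⟨_, ⟨y, hy, rfl⟩, T', hT', -, he⟩ := h2
  obtain ⟨rfl, hmem⟩ := (cs.coset_eq_iff hM).1 he
  have hx : x ∈ cs.parabolic (M.finiteNeighbors t \ {t}) := hx
  have hy : y ∈ cs.parabolic (M.finiteNeighbors t \ {t}) := hy
  have hmem : x⁻¹ * (u * y) ∈ cs.parabolic T := by
    have := inv_mem hmem
    simpa using this
  have hne := ne_of_two_lt hst
  have hsU : s ∈ M.finiteNeighbors t \ {t} := ⟨show M s t ≠ 0 by omega, hne⟩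
  have hQU : M.commonCommuting s t ⊆ M.finiteNeighbors t \ {t} := fun i hi =>
    ⟨show M i t ≠ 0 by rw [hi.1]; exact two_ne_zero,
      fun h => notMem_commonCommuting_right (h ▸ hi)⟩
  have hsP : cs.parabolic {s} ≤ cs.parabolic (M.finiteNeighbors t \ {t}) :=
    cs.parabolic_mono (Set.singleton_subset_iff.2 hsU)
  have htn : t ∉ M.finiteNeighbors t \ {t} := fun h => h.2 rfl
  have hgt : ∀ {z}, z ∈ cs.parabolic (M.finiteNeighbors t \ {t}) → cs.retraction hM {t} z = 1 :=
    fun hz => cs.retraction_eq_one hM (Set.disjoint_singleton_left.2 htn) hz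
  have hgst : ∀ {z}, z ∈ cs.parabolic (M.finiteNeighbors t \ {t}) →
      (cs.retraction hM {s, t} z : W) ∈ cs.parabolic {s} := fun hz =>
    cs.parabolic_mono (by
      rintro i ⟨rfl | rfl, h⟩
      exacts [rfl, absurd h htn]) (cs.retraction_mem_inter hM {s, t} hz)
  have hgu' : (cs.retraction hM {s, t} u : W) = u := cs.retraction_of_mem hM hu
  -- The two colors already differ in the factor T = {s, t}, since u is not in W_{s}.
  have hcolor : cs.color hM t x ≠ cs.color hM t (u * y) := by
    rw [color_mul_of_mem hM htn hy, ← one_mul x, color_mul_of_mem hM htn hx]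
    intro hc
    have := QuotientGroup.eq.1 (congrFun hc ⟨{s, t}, cs.isSpherical_pair (by omega), by simp⟩)
    rw [Subgroup.mem_subgroupOf, map_one, inv_one, one_mul, hgu'] at this
    refine hus (cs.parabolic_mono ?_ this)
    rintro i ⟨rfl | h, h'⟩
    exacts [rfl, absurd h h']
  obtain ⟨htT, s', hs'T, hs't⟩ := exists_two_lt_of_color_ne hM hT hmem hcolor (by
    rw [map_mul, hgu, hgt hx, hgt hy, one_mul])
  -- Without s in T, the image of x⁻¹uy under g_{s,t} lies in W_{t} and has an even number of t's,
  -- so it is trivial and u would be in W_{s}.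
  have hsT : s ∈ T := by
    by_contra hsT
    have hb : (cs.retraction hM {s, t} (x⁻¹ * (u * y)) : W) ∈ cs.parabolic {t} :=
      cs.parabolic_mono (by
        rintro i ⟨rfl | rfl, h⟩
        exacts [absurd h hsT, rfl]) (cs.retraction_mem_inter hM {s, t} hmem)
    rw [map_mul, map_mul, map_inv, Subgroup.coe_mul, Subgroup.coe_mul, Subgroup.coe_inv,
      hgu'] at hb
    have ha := hgst hx
    have hc := hgst hy
    generalize (cs.retraction hM {s, t} x : W) = a at ha hb
    generalize (cs.retraction hM {s, t} y : W) = c at hc hb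
    have hb1 : a⁻¹ * (u * c) = 1 := by
      have h1 := cs.retraction_of_mem hM hb
      rw [map_mul, map_mul, map_inv, hgu, hgt (hsP ha), hgt (hsP hc)] at h1
      simpa using h1.symm
    apply hus
    have : u = a * c⁻¹ := by
      rw [inv_mul_eq_one] at hb1
      rw [hb1, mul_inv_cancel_right]
    rw [this]
    exact mul_mem ha (inv_mem hc)
  have hTeq := eq_union_of_isSpherical hM hT hsT htT hst
  have hmem' := hmem
  rw [hTeq] at hmem'
  obtain ⟨d, hd, ρ, hρ, hdρ⟩ := cs.exists_mul_of_mem_parabolic_union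
    (fun i hi j hj => eq_two_of_mem_commonCommuting i hi j hj.2) hmem'
  have hρ : ρ ∈ cs.parabolic (M.finiteNeighbors t \ {t}) :=
    cs.parabolic_mono (Set.inter_subset_right.trans hQU) hρ
  have hy' : y * ρ⁻¹ ∈ cs.parabolic (M.finiteNeighbors t \ {t}) := mul_mem hy (inv_mem hρ)
  have hxd : x * d = u * (y * ρ⁻¹) := by
    rw [inv_mul_eq_iff_eq_mul] at hdρ
    rw [← mul_assoc u, hdρ]
    group
  generalize y * ρ⁻¹ = y' at hy' hxd
  have hxd' := congrArg (fun z => (cs.retraction hM {s, t} z : W)) hxd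
  simp only [map_mul, Subgroup.coe_mul, cs.retraction_of_mem hM hd, hgu'] at hxd'
  have hes := hgst hx
  have hes' := hgst hy'
  generalize (cs.retraction hM {s, t} x : W) = e at hes hxd'
  generalize (cs.retraction hM {s, t} y' : W) = e' at hes' hxd'
  have hx1 : x * e⁻¹ ∈ cs.parabolic (M.finiteNeighbors t \ {t}) := mul_mem hx (inv_mem (hsP hes))
  have hy1 : y' * e'⁻¹ ∈ cs.parabolic (M.finiteNeighbors t \ {t}) :=
    mul_mem hy' (inv_mem (hsP hes'))
  -- Divide xd = uy' by its image ed = ue' under g_{s,t}, where e and e' lie in W_{s}.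
  have hconj : x * e⁻¹ * u = u * (y' * e'⁻¹) := by
    have hd' : d = e⁻¹ * (u * e') := by rw [← hxd', inv_mul_cancel_left]
    rw [hd'] at hxd
    rw [← mul_assoc u, ← hxd]
    group
  -- Deleting t by the retraction onto U - t gives the same relation with u replaced by σ in W_{s}.
  -- Comparison shows that xe⁻¹ commutes with uσ⁻¹, which is nontrivial because u is not in W_{s}.
  have hσ := congrArg (fun z => (cs.retraction hM (M.finiteNeighbors t \ {t}) z : W)) hconj
  rw [map_mul _ _ u, map_mul _ u, Subgroup.coe_mul, Subgroup.coe_mul, cs.retraction_of_mem hM hx1,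
    cs.retraction_of_mem hM hy1] at hσ
  have hσs : (cs.retraction hM (M.finiteNeighbors t \ {t}) u : W) ∈ cs.parabolic {s} :=
    cs.parabolic_mono (by
      rintro i ⟨h, rfl | rfl⟩
      exacts [rfl, absurd h htn]) (cs.retraction_mem_inter hM _ hu)
  generalize (cs.retraction hM (M.finiteNeighbors t \ {t}) u : W) = σ at hσ hσs
  have hst' : cs.parabolic {s} ≤ cs.parabolic {s, t} := cs.parabolic_mono (by simp)
  have hbu : u * (y' * e'⁻¹) = u * σ⁻¹ * (x * e⁻¹) * σ := by
    rw [mul_assoc (u * σ⁻¹), hσ]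
    group
  have hx1Q := mem_parabolic_of_commute hM hflag hst (n := u * σ⁻¹)
    (mul_mem hu (inv_mem (hst' hσs)))
    (fun h => hus (by rw [mul_inv_eq_one.1 h]; exact hσs))
    (by rw [map_mul, map_inv, hgu, hgt (hsP hσs), inv_one, one_mul])
    (cs.parabolic_mono Set.sdiff_subset hx1) (by
      rw [← mul_assoc (x * e⁻¹), hconj, hbu]
      group)
  have hx1s : x * e⁻¹ ∈ cs.parabolic ({s} ∪ M.commonCommuting s t) := by
    have : x * e⁻¹ ∈ cs.parabolic (({s, t} ∪ M.commonCommuting s t) ∩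
        (M.finiteNeighbors t \ {t})) := by
      rw [← cs.parabolic_inf hM]
      exact ⟨hx1Q, hx1⟩
    refine cs.parabolic_mono ?_ this
    rintro i ⟨(rfl | rfl) | h, h'⟩
    exacts [Or.inl rfl, absurd h' htn, Or.inr h]
  obtain ⟨a, ha, z, hz, haz⟩ := cs.exists_mul_of_mem_parabolic_union
    (fun i hi j hj => eq_two_of_mem_commonCommuting (s := s) (t := t) i (by
      rw [Set.mem_singleton_iff.1 hi]
      simp) j hj) hx1s
  refine ⟨z, hz, T, hT, hsT, htT, (cs.coset_eq_iff hM).2 ⟨rfl, ?_⟩⟩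
  have hcomm := (cs.commute_parabolic eq_two_of_mem_commonCommuting (hst' ha) hz).eq
  have : z⁻¹ * x = a * e := by
    rw [mul_inv_eq_iff_eq_mul] at haz
    rw [haz, hcomm]
    group
  rw [this]
  exact cs.parabolic_mono (Set.singleton_subset_iff.2 hsT) (mul_mem ha hes)

end CoxeterSystem

end

noncomputable section

/-! ### Even colors -/

namespace CoxeterSystem

open PreAbstractSimplicialComplex
open scoped Classical Pointwise

variable {B W : Type*} [Group W] {M : CoxeterMatrix B} {cs : CoxeterSystem M W}

/-- Since g_{t} kills every other generator, it counts the occurrences of t modulo 2. -/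
theorem retraction_singleton_wordProd (hM : M.IsEven) (t : B) (ω : List B) :
    cs.retraction hM {t} (cs.wordProd ω) = cs.retraction hM {t} (cs.simple t) ^ ω.count t := by
  induction ω with
  | nil => simp
  | cons i ω ih =>
    rw [cs.wordProd_cons, map_mul, ih]
    by_cases hi : i = t
    · subst hi
      rw [List.count_cons_self, pow_succ']
    · rw [List.count_cons_of_ne hi, cs.retraction_simple_of_notMem hM (T := {t}) hi, one_mul]

theorem IsTEven.retraction_eq_one (hM : M.IsEven) {s t : B} {u : W} (h : cs.IsTEven s t u) :
    cs.retraction hM {t} u = 1 := by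
  obtain ⟨ω, rfl⟩ := cs.wordProd_surjective u
  obtain ⟨k, hk⟩ := (h.2 ω rfl).2
  rw [retraction_singleton_wordProd, hk, ← two_mul, pow_mul, ← map_pow, cs.simple_sq, map_one,
    one_pow]

theorem IsTEven.notMem_parabolic {s t : B} (hst : s ≠ t) {u : W} (h : cs.IsTEven s t u) :
    u ∉ cs.parabolic {s} := by
  intro hu
  rcases cs.mem_parabolic_singleton.1 hu with rfl | rfl
  · have := (h.2 [] cs.wordProd_nil).1
    simp at this
  · have := (h.2 [s] (cs.wordProd_singleton s)).1
    rw [List.count_cons_of_ne hst] at this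
    simp at this

/-! ### Intersections of colors and of collars. -/

variable {N : Type*} [TopologicalSpace N] [ChartedSpace E3 N]

/-- The cells of the intersection of a color with a union of colors form a union of Davis complexes
of the groups `W_{U_st}`. -/
theorem exists_isComponentEmbedding_color (hM : M.IsEven) {t : B} {A : Set (cs.Color t)} {b : cs.Color t}
    (hA : ∀ a ∈ A, cs.IsEvenColor hM t a) (hb : cs.IsEvenColor hM t b) (hbA : b ∉ A)
    {C : cs.SphericalCoset} (hC : C ∈ cs.cosetsOver
        {w | w ∈ cs.parabolic (M.finiteNeighbors t) ∧ cs.color hM t w = b}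
        (M.finiteNeighbors t) ∩ cs.cosetsOver
        {w | w ∈ cs.parabolic (M.finiteNeighbors t) ∧ cs.color hM t w ∈ A}
        (M.finiteNeighbors t)) :
    ∃ s, 2 < M s t ∧ ∀ cs' : CoxeterSystem (M.restrict (M.commonCommuting s t))
      (cs.parabolic (M.commonCommuting s t)), (∀ i, (cs'.simple i : W) = cs.simple i) →
      ∃ φ : cs'.SphericalCoset → cs.SphericalCoset,
        IsComponentEmbedding cs'.davisComplex (cs.davisComplex.restrictTo (cs.cosetsOver
          {w | w ∈ cs.parabolic (M.finiteNeighbors t) ∧ cs.color hM t w = b}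
          (M.finiteNeighbors t) ∩ cs.cosetsOver
          {w | w ∈ cs.parabolic (M.finiteNeighbors t) ∧ cs.color hM t w ∈ A}
          (M.finiteNeighbors t))) φ ∧ C ∈ Set.range φ := by
  have key : ∀ w T hT, cs.coset w T hT ∈ cs.cosetsOver
        {w | w ∈ cs.parabolic (M.finiteNeighbors t) ∧ cs.color hM t w = b}
        (M.finiteNeighbors t) ∩ cs.cosetsOver
        {w | w ∈ cs.parabolic (M.finiteNeighbors t) ∧ cs.color hM t w ∈ A}
        (M.finiteNeighbors t) → t ∈ T ∧ ∃ s ∈ T, 2 < M s t := by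
    rintro w T hT ⟨⟨x, ⟨-, hx⟩, R, hR, -, h1⟩, ⟨y, ⟨-, hy⟩, R', hR', -, h2⟩⟩
    obtain ⟨rfl, hx'⟩ := (cs.coset_eq_iff hM).1 h1
    obtain ⟨rfl, hy'⟩ := (cs.coset_eq_iff hM).1 h2
    refine exists_two_lt_of_color_ne hM hT (x := x) (y := y) ?_ (fun h => hbA ?_) ?_
    · have := mul_mem hx' (inv_mem hy')
      simpa [mul_assoc] using this
    · rw [← hx, h]
      exact hy
    · rw [hb.retraction_eq_one hx, (hA _ hy).retraction_eq_one rfl]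
  obtain ⟨w, T, hT, rfl⟩ := cs.exists_eq_coset C
  obtain ⟨htT, s, hsT, hst⟩ := key w T hT hC
  refine ⟨s, hst, fun cs' hcs' => ?_⟩
  refine exists_isComponentEmbedding hM hst hcs' key hsT htT fun x hx R hR hsph => ?_
  have hsU : ({s, t} ∪ R : Set B) ⊆ M.finiteNeighbors t := by
    rintro i ((rfl | rfl) | hi)
    · exact show M i t ≠ 0 by omega
    · exact show M i i ≠ 0 by rw [M.diagonal]; exact one_ne_zero
    · exact show M i t ≠ 0 by rw [(hR hi).1]; exact two_ne_zero
  have hTeq := eq_union_of_isSpherical hM hT hsT htT hst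
  have hxU : x ∈ cs.parabolic (M.finiteNeighbors t) := by
    refine cs.parabolic_mono (fun i hi => ?_) hx
    exact show M i t ≠ 0 by rw [hi.1]; exact two_ne_zero
  -- Right multiplication by W' does not change colors, since t is not in U_st, and it commutes with
  -- the W_{s,t} component of the change of representative.
  have hmove : ∀ S : Set (cs.Color t), cs.coset w T hT ∈ cs.cosetsOver
      {w | w ∈ cs.parabolic (M.finiteNeighbors t) ∧ cs.color hM t w ∈ S} (M.finiteNeighbors t) →
      cs.coset (w * x) _ hsph ∈ cs.cosetsOver
        {w | w ∈ cs.parabolic (M.finiteNeighbors t) ∧ cs.color hM t w ∈ S}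
        (M.finiteNeighbors t) := by
    rintro S ⟨v, ⟨hvU, hv⟩, R', hR', -, he⟩
    obtain ⟨rfl, hwv⟩ := (cs.coset_eq_iff hM).1 he
    rw [hTeq] at hwv
    obtain ⟨d, hd, y, hy, hdy⟩ := cs.exists_mul_of_mem_parabolic_union
      (fun i hi j hj => eq_two_of_mem_commonCommuting i hi j hj.2) hwv
    have hy' : y ∈ cs.parabolic (M.commonCommuting s t) :=
      cs.parabolic_mono Set.inter_subset_right hy
    have hyU : y ∈ cs.parabolic (M.finiteNeighbors t) := by
      refine cs.parabolic_mono (fun i hi => ?_) hy'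
      exact show M i t ≠ 0 by rw [hi.1]; exact two_ne_zero
    have hw : w = v * (d * y) := by rw [← hdy, mul_inv_cancel_left]
    have hdx := (cs.commute_parabolic eq_two_of_mem_commonCommuting hd (mul_mem hy' hx)).eq
    refine ⟨v * (y * x), ⟨mul_mem hvU (mul_mem hyU hxU), ?_⟩, _, hsph, hsU,
      (cs.coset_eq_iff hM).2 ⟨rfl, ?_⟩⟩
    · rw [color_mul_of_mem hM notMem_commonCommuting_right (mul_mem hy' hx)]
      exact hv
    · have : (v * (y * x))⁻¹ * (w * x) = d := by
        rw [hw, mul_assoc v, mul_assoc d, hdx]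
        group
      rw [this]
      exact cs.parabolic_mono Set.subset_union_left hd
  exact ⟨hmove {b} hC.1, hmove A hC.2⟩

/-- Every vertex lies in a union of components isomorphic to the Davis complex of some W'. The
generator s may vary with the component, but each such complex is a surface with infinite
components. -/
theorem subsingleton_reducedL2Homology_inf_iSup [Finite B] (hM : M.IsEven)
    (hflag : cs.nerve.IsFlag) (h : cs.nerve.Realization ≃ₜ N) {t : B} {ι : Type*}
    {a : ι → cs.Color t} {b : cs.Color t} (ha : ∀ j, cs.IsEvenColor hM t (a j))
    (hb : cs.IsEvenColor hM t b) (hab : ∀ j, a j ≠ b) :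
    Subsingleton
      ((cs.colorComplex hM t b ⊓ ⨆ j, cs.colorComplex hM t (a j)).ReducedL2Homology 2) := by
  rw [iSup_colorComplex_eq hM hflag, colorComplex_eq hM hflag, restrictTo_inf_restrictTo]
  have hrange : {w | w ∈ cs.parabolic (M.finiteNeighbors t) ∧ ∃ j, cs.color hM t w = a j} =
      {w | w ∈ cs.parabolic (M.finiteNeighbors t) ∧ cs.color hM t w ∈ Set.range a} := by
    ext w
    exact and_congr_right fun _ => exists_congr fun j => eq_comm
  rw [hrange]
  have key := fun C hC => exists_isComponentEmbedding_color hM (A := Set.range a) (b := b) (C := C)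
    (by rintro _ ⟨j, rfl⟩; exact ha j) hb (by rintro ⟨j, hj⟩; exact hab j hj) hC
  refine IsClosedSurface.subsingleton_reducedL2Homology
    (isClosedSurface_of_cover fun C hC => ?_) fun C hC => ?_
  · obtain ⟨s, hst, hs⟩ := key C (singleton_mem_restrictTo.1 hC)
    obtain ⟨cs', hcs'⟩ := cs.exists_restrict hM (M.commonCommuting s t)
    obtain ⟨φ, hφ, hCφ⟩ := hs cs' hcs'
    exact ⟨_, _, φ, (hasCycleNerve hM hflag h hst hcs').isClosedSurface (isEven_restrict hM _),
      hφ, hCφ⟩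
  · obtain ⟨s, hst, hs⟩ := key C (singleton_mem_restrictTo.1 hC)
    obtain ⟨cs', hcs'⟩ := cs.exists_restrict hM (M.commonCommuting s t)
    obtain ⟨φ, hφ, C', rfl⟩ := hs cs' hcs'
    have := infinite_parabolic_commonCommuting hM hflag h hst
    exact hφ.infinite_setOf_edgeReachable (cs'.infinite_setOf_edgeReachable_davisComplex C')

/-- The intersection of the collars of `e` and `u` is isomorphic to the Davis complex of
`W_{U_st}`. -/
theorem exists_isComponentEmbedding_collar [Finite B] (hM : M.IsEven) (hflag : cs.nerve.IsFlag)
    {s t : B} (hst : 2 < M s t) {u : W} (hu : u ∈ cs.parabolic {s, t}) (hut : cs.IsTEven s t u)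
    {cs' : CoxeterSystem (M.restrict (M.commonCommuting s t))
      (cs.parabolic (M.commonCommuting s t))} (hcs' : ∀ i, (cs'.simple i : W) = cs.simple i) :
    ∃ φ : cs'.SphericalCoset → cs.SphericalCoset,
      IsComponentEmbedding cs'.davisComplex (cs.collar t 1 ⊓ cs.collar t u) φ ∧
        ∀ C, {C} ∈ (cs.collar t 1 ⊓ cs.collar t u).faces → C ∈ Set.range φ := by
  have hst0 : M s t ≠ 0 := by omega
  have hU : ({s, t} : Set B) ⊆ M.finiteNeighbors t := by
    rintro i (rfl | rfl)
    · exact hst0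
    · exact show M i i ≠ 0 by rw [M.diagonal]; exact one_ne_zero
  have hQU : M.commonCommuting s t ⊆ M.finiteNeighbors t \ {t} := fun i hi =>
    ⟨show M i t ≠ 0 by rw [hi.1]; exact two_ne_zero,
      fun h => notMem_commonCommuting_right (h ▸ hi)⟩
  rw [collar_eq hM hflag t (one_mem _), collar_eq hM hflag t (cs.parabolic_mono hU hu),
    restrictTo_inf_restrictTo, one_smul]
  obtain ⟨φ, hφ⟩ := exists_orderEmbedding hM hst0 hcs' 1
  have hrange : ∀ C ∈ cs.cosetsOver (cs.parabolic (M.finiteNeighbors t \ {t}))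
      (M.finiteNeighbors t) ∩ cs.cosetsOver
      (u • (cs.parabolic (M.finiteNeighbors t \ {t}) : Set W)) (M.finiteNeighbors t),
      C ∈ Set.range φ := by
    rintro C ⟨h1, h2⟩
    obtain ⟨x, hx, T, hT, hsT, htT, rfl⟩ := exists_eq_coset_of_mem_collars hM hflag hst hu
      (hut.notMem_parabolic (ne_of_two_lt hst)) (hut.retraction_eq_one hM) h1 h2
    obtain ⟨R, hR, hTR⟩ := exists_coset_restrict hM hst hcs' hT hsT htT
    refine ⟨cs'.coset ⟨x, hx⟩ R hR, ?_⟩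
    rw [hφ]
    exact (cs.coset_eq_iff hM).2 ⟨hTR.symm, by simp⟩
  refine ⟨φ, isComponentEmbedding_orderComplex φ (fun C => ?_) fun C hC _ _ => hrange C hC,
    fun C hC => hrange C (singleton_mem_restrictTo.1 hC)⟩
  obtain ⟨x, R, hR, rfl⟩ := cs'.exists_eq_coset C
  have hsub : ({s, t} ∪ Subtype.val '' R : Set B) ⊆ M.finiteNeighbors t := by
    refine Set.union_subset hU ?_
    rintro _ ⟨i, -, rfl⟩
    exact (hQU i.2).1
  rw [hφ, one_mul]
  -- The coset of x also contains ux, because x commutes with u and u lies in W_{s,t}; hence it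
  -- belongs to both collars.
  refine ⟨coset_mem_cosetsOver (cs.parabolic_mono hQU x.2) hsub, u * x,
    ⟨x, cs.parabolic_mono hQU x.2, rfl⟩, _, isSpherical_union_image hcs' hst0 hR, hsub,
    (cs.coset_eq_iff hM).2 ⟨rfl, ?_⟩⟩
  have hcomm := (cs.commute_parabolic eq_two_of_mem_commonCommuting hu x.2).eq
  rw [hcomm, mul_inv_rev, mul_assoc, inv_mul_cancel, mul_one]
  exact inv_mem (cs.parabolic_mono Set.subset_union_left hu)

end CoxeterSystem

end

/-! ### The theorem. -/

open Classical in
theorem propositionp {B W : Type*} [Finite B] [Group W] {M : CoxeterMatrix B}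
    (cs : CoxeterSystem M W) (hM : M.IsEven) (hflag : cs.nerve.IsFlag)
    (hsphere : Nonempty
      (cs.nerve.Realization ≃ₜ Metric.sphere (0 : EuclideanSpace ℝ (Fin 4)) 1))
    (t : B) :
    (∀ s : B, 2 < M s t → ∀ u ∈ cs.parabolic {s, t}, cs.IsTEven s t u →
      cs.HasReducedExprEndingIn u t →
        (∃ cs' : CoxeterSystem (M.restrict (M.commonCommuting s t))
            (cs.parabolic (M.commonCommuting s t)),
          (∀ i, (cs'.simple i : W) = cs.simple i) ∧
          Nonempty (PreAbstractSimplicialComplex.Iso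
            (cs.collar t 1 ⊓ cs.collar t u) cs'.davisComplex) ∧
          cs'.nerve.map Subtype.val = cs.nerve.link {s, t}) ∧
        Infinite (cs.collar t 1 ⊓ cs.collar t u).faces ∧
        ConnectedSpace (cs.collar t 1 ⊓ cs.collar t u).Realization ∧
        IsTopManifold 2 (cs.collar t 1 ⊓ cs.collar t u).Realization) ∧
    (∀ a a' : cs.Color t, cs.IsEvenColor hM t a → cs.IsEvenColor hM t a' → a ≠ a' →
      Subsingleton
        ((cs.colorComplex hM t a ⊓ cs.colorComplex hM t a').ReducedL2Homology 2)) ∧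
    (∀ (n : ℕ) (a : Fin n → cs.Color t) (b : cs.Color t), (∀ j, cs.IsEvenColor hM t (a j)) →
      cs.IsEvenColor hM t b → (∀ j, a j ≠ b) →
      Subsingleton
        ((cs.colorComplex hM t b ⊓ ⨆ j, cs.colorComplex hM t (a j)).ReducedL2Homology 2)) := by

  obtain ⟨h⟩ := hsphere
  -- This supplies the 3-manifold structure of the sphere, the only property of it that the argument
  -- uses.
  have : Fact (Module.finrank ℝ (EuclideanSpace ℝ (Fin 4)) = 3 + 1) := ⟨by simp⟩
  refine ⟨fun s hst u hu hut _ => ?_, fun a a' ha ha' hne => ?_, fun n a b ha hb hab =>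
    CoxeterSystem.subsingleton_reducedL2Homology_inf_iSup hM hflag h ha hb hab⟩
  · obtain ⟨cs', hcs'⟩ := cs.exists_restrict hM (M.commonCommuting s t)
    obtain ⟨φ, hφ, hsurj⟩ :=
      CoxeterSystem.exists_isComponentEmbedding_collar hM hflag hst hu hut hcs'
    have hcyc := CoxeterSystem.hasCycleNerve hM hflag h hst hcs'
    have hsurf : (cs.collar t 1 ⊓ cs.collar t u).IsClosedSurface :=
      PreAbstractSimplicialComplex.isClosedSurface_of_cover fun C hC => ⟨_, _, φ,
        hcyc.isClosedSurface (CoxeterSystem.isEven_restrict hM _), hφ, hsurj C hC⟩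
    have := CoxeterSystem.infinite_parabolic_commonCommuting hM hflag h hst
    have := cs.countable_of_finite
    have hmem : ∀ C, {φ C} ∈ (cs.collar t 1 ⊓ cs.collar t u).faces := fun C =>
      hφ.singleton_mem_iff.2 (CoxeterSystem.singleton_mem_davisComplex C)
    refine ⟨⟨cs', hcs', hφ.nonempty_iso hsurj, CoxeterSystem.map_nerve_eq_link hM hst hcs'⟩,
      ?_, ?_, hsurf.isTopManifold⟩
    · refine Infinite.of_injective (fun w => ⟨{φ (cs'.vertex w)}, hmem _⟩) fun w w' hww => ?_
      exact cs'.vertex_injective (hφ.injective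
        (Finset.singleton_injective (congrArg Subtype.val hww)))
    · refine PreAbstractSimplicialComplex.connectedSpace_realization (hmem (cs'.vertex 1))
        fun C hC => ?_
      obtain ⟨C', rfl⟩ := hsurj C hC
      exact hφ.edgeReachable (cs'.edgeReachable_davisComplex C')
  -- The statement for two colors is the one for a union indexed by a single element.
  · have := CoxeterSystem.subsingleton_reducedL2Homology_inf_iSup hM hflag h (ι := Unit)
      (a := fun _ => a') (b := a) (fun _ => ha') ha fun _ => hne.symm
    rwa [iSup_const] at this
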